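/- Let $G$ be a connected Lie group acting smoothly on a manifold $M$ by $(g,x)\mapsto\Phi_g(x)$, let $H$ be a Lie group, and let $\varpi\colon P\to M$ be a smooth principal $H$-bundle (manifolds and Lie groups are finite-dimensional, Hausdorff, second countable and without boundary, and are regarded as diffeological spaces). Let $\mathrm{Sym}_G(P)$ be the set of pairs $(g,f)$ with $g\in G$ and $f\colon P\to P$ an $H$-equivariant diffeomorphism with $\varpi\circ f=\Phi_g\circ\varpi$ (equivalently, an isomorphism $P\to\Phi_g^*P$ of $H$-bundles over $M$), with product $(g,f)(g',f')=(gg',f\circ f')$ and with the subspace diffeology of $P^P\times G$, where $P^P$ carries the mapping space diffeology. Let $\mathrm{Gau}(P)$ be the group of $H$-equivariant diffeomorphisms of $P$ covering $1_M$, with the subspace diffeology of $P^P$. Then: 1. $\mathrm{Gau}(P)$ and $\mathrm{Sym}_G(P)$ are diffeological groups, and $$1\to\mathrm{Gau}(P)\to\mathrm{Sym}_G(P)\to G\to1,\qquad \phi\mapsto(e,\phi),\quad (g,f)\mapsto g,$$ is an extension of diffeological groups: it is exact, $\mathrm{Gau}(P)$ carries the subspace diffeology of $\mathrm{Sym}_G(P)$,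 and $\mathrm{Sym}_G(P)\to G$ is a subduction and a principal $\mathrm{Gau}(P)$-bundle. 2. $\mathrm{Sym}_G(P)$ acts smoothly on $P$ by $((g,f),p)\mapsto f(p)$, and this action covers the action of $G$ on $M$. 3. Let $\widehat G$ be a Lie group, $\varphi\colon\widehat G\to G$ a Lie group homomorphism, and $\widehat\psi\colon\widehat G\times P\to P$ a smooth action which commutes with the right action of $H$ and satisfies $\varpi(\widehat\psi_k(p))=\Phi_{\varphi(k)}(\varpi(p))$ for all $k,p$. Then there is a unique smooth group homomorphism $F\colon\widehat G\to\mathrm{Sym}_G(P)$ such that $F(k)$ lies over $\varphi(k)$ and acts on $P$ as $\widehat\psi_k$, for all $k\in\widehat G$. 4. Let $A$ be any connection on $P$. Let $P_0G$ be the diffeological space of smooth paths $\gamma\colon[0,1]\to G$ with $\gamma(0)=e$ which are constant near $0$ and near $1$ (subspace diffeology of $G^{[0,1]}$). For $\gamma\in P_0G$ let $\mathtt{pt}_\gamma\colon P\to P$ be the map that on the fibre over $x\in M$ is parallel transport along $t\mapsto\Phi_{\gamma(t)}(x)$. For $\gamma,\alpha\in P_0G$ with $\gamma(1)=\alpha(1)$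 let $\mathrm{hol}(P,\alpha,\gamma)\colon P\to P$ be the map that on the fibre over $x$ is the holonomy of $A$ along the loop $t\mapsto\Phi_{(\overline\alpha\star\gamma)(t)}(x)$, where $\overline\alpha\star\gamma$ is $\gamma$ followed by the reverse of $\alpha$. The parallel transports in question exist and are unique; $(\gamma,\alpha)\mapsto\mathrm{hol}(P,\alpha,\gamma)$ is a smooth map from the pairs of paths in $P_0G$ with equal end points to $\mathrm{Gau}(P)$; and $(\gamma,\phi)\sim(\alpha,\mathrm{hol}(P,\alpha,\gamma)\circ\phi)$, for $\gamma(1)=\alpha(1)$, is an equivalence relation on $P_0G\times\mathrm{Gau}(P)$. Let $\mathcal L_G=(P_0G\times\mathrm{Gau}(P))/{\sim}$ with the quotient diffeology. Then $$[\gamma,\phi]\,[\gamma',\phi']=\big[\gamma\gamma',\ \mathtt{pt}_{\gamma\gamma'}^{-1}\circ\mathtt{pt}_\gamma\circ\phi\circ\mathtt{pt}_{\gamma'}\circ\phi'\big]$$ (compositions as maps $P\to P$, and $\gamma\gamma'$ the pointwise product) is a well-defined group structure on $\mathcal L_G$, and with the maps $\phi\mapsto[e,\phi]$ ($e$ the constant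 path) and $[\gamma,\phi]\mapsto\gamma(1)$ it is an extension of diffeological groups $1\to\mathrm{Gau}(P)\to\mathcal L_G\to G\to1$ in the sense of 1. The map $$\Gamma\colon\mathcal L_G\to\mathrm{Sym}_G(P),\qquad [\gamma,\phi]\mapsto(\gamma(1),\ \mathtt{pt}_\gamma\circ\phi),$$ is a well-defined isomorphism of extensions of diffeological groups: a group isomorphism, a diffeomorphism, and compatible with the maps from $\mathrm{Gau}(P)$ and to $G$. -/

import Mathlib

open Set Filter Topology Diffeology
open scoped Manifold ContDiff

namespace SymExt

noncomputable section

universe u v w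

/-! ## Basic constructions with diffeologies

The class `DiffeologicalSpace` and smoothness `Diffeology.DSmooth` are those of Mathlib; plots are
given on the Cartesian spaces `EuclideanSpace ℝ (Fin n)`. -/

/-- Every open set around `x` contains the image of a smooth map which is the identity near `x`. -/
theorem exists_smooth_shrink {n : ℕ} {u : Set (EuclideanSpace ℝ (Fin n))} (hu : IsOpen u)
    {x : EuclideanSpace ℝ (Fin n)} (hx : x ∈ u) :
    ∃ f : EuclideanSpace ℝ (Fin n) → EuclideanSpace ℝ (Fin n),
      ContDiff ℝ ∞ f ∧ (∀ y, f y ∈ u) ∧ ∀ᶠ y in 𝓝 x, f y = y := by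
  obtain ⟨ε, hε, hball⟩ := Metric.isOpen_iff.1 hu x hx
  let χ : ContDiffBump x := ⟨ε / 3, ε / 2, by positivity, by linarith⟩
  refine ⟨fun y => x + χ y • (y - x), ?_, ?_, ?_⟩
  · exact contDiff_const.add (χ.contDiff.smul (contDiff_id.sub contDiff_const))
  · intro y
    apply hball
    rw [Metric.mem_ball, dist_eq_norm, add_sub_cancel_left, norm_smul, Real.norm_eq_abs,
      abs_of_nonneg χ.nonneg]
    by_cases hy : dist y x < ε / 2
    · rw [dist_eq_norm] at hy
      nlinarith [χ.nonneg (x := y), χ.le_one (x := y), norm_nonneg (y - x)]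
    · rw [χ.zero_of_le_dist (not_lt.1 hy), zero_mul]
      exact hε
  · filter_upwards [χ.eventuallyEq_one] with y hy
    simp [hy]

section Constructions

variable {X : Type u} {Y : Type v}

/-- The diffeology induced by a map `f : X → Y` into a diffeological space. -/
@[reducible]
def inducedD [DiffeologicalSpace Y] (f : X → Y) : DiffeologicalSpace X where
  plots _ := {p | IsPlot (f ∘ p)}
  constant_plots x := isPlot_const (x := f x)
  plot_reparam hp hf := isPlot_reparam hp hf
  locality {_ p} h := DiffeologicalSpace.locality (p := f ∘ p) h

/-- The subspace diffeology. -/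
instance subtypeD [DiffeologicalSpace X] {q : X → Prop} : DiffeologicalSpace (Subtype q) :=
  inducedD Subtype.val

/-- The product diffeology. -/
instance prodD [DiffeologicalSpace X] [DiffeologicalSpace Y] : DiffeologicalSpace (X × Y) where
  plots _ := {p | IsPlot (fun y => (p y).1) ∧ IsPlot (fun y => (p y).2)}
  constant_plots x := ⟨isPlot_const (x := x.1), isPlot_const (x := x.2)⟩
  plot_reparam hp hf := ⟨isPlot_reparam hp.1 hf, isPlot_reparam hp.2 hf⟩
  locality {_ p} h := by
    refine ⟨DiffeologicalSpace.locality fun x => ?_, DiffeologicalSpace.locality fun x => ?_⟩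
    · obtain ⟨u, hu, hx, hp⟩ := h x
      exact ⟨u, hu, hx, fun hf hf' => (hp hf hf').1⟩
    · obtain ⟨u, hu, hx, hp⟩ := h x
      exact ⟨u, hu, hx, fun hf hf' => (hp hf hf').2⟩

/-- The quotient diffeology: a map is a plot iff it lifts locally to plots. (By
`exists_smooth_shrink`, a plot on a neighbourhood of `x` agrees near `x` with a plot on the
whole Cartesian space, so local lifts may be taken to be global plots.) -/
instance quotD [DiffeologicalSpace X] (r : X → X → Prop) : DiffeologicalSpace (Quot r) where
  plots n := {p | ∀ x, ∃ q : EuclideanSpace ℝ (Fin n) → X, IsPlot q ∧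
    ∀ᶠ y in 𝓝 x, Quot.mk r (q y) = p y}
  constant_plots x := fun _ => by
    obtain ⟨a, rfl⟩ := Quot.exists_rep x
    exact ⟨fun _ => a, isPlot_const, Eventually.of_forall fun _ => rfl⟩
  plot_reparam {_ _ p f} hp hf := fun x => by
    obtain ⟨q, hq, hqp⟩ := hp (f x)
    exact ⟨q ∘ f, isPlot_reparam hq hf, (hf.continuous.tendsto x).eventually hqp⟩
  locality {n p} h := fun x => by
    obtain ⟨u, hu, hx, hp⟩ := h x
    obtain ⟨f, hf, hfu, hfx⟩ := exists_smooth_shrink hu hx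
    obtain ⟨q, hq, hqp⟩ := hp hfu hf x
    refine ⟨q, hq, ?_⟩
    filter_upwards [hqp, hfx] with y h1 h2
    rw [h1, Function.comp_apply, h2]

/-- The set of smooth maps between two diffeological spaces. -/
@[ext]
structure DMap (X : Type u) (Y : Type v) [DiffeologicalSpace X] [DiffeologicalSpace Y] where
  /-- the underlying map -/
  toFun : X → Y
  smooth : DSmooth toFun

/-- The mapping space diffeology: `p` is a plot iff `(u, x) ↦ p u x` is smooth. -/
instance mapD [DiffeologicalSpace X] [DiffeologicalSpace Y] : DiffeologicalSpace (DMap X Y) where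
  plots n := {p | DSmooth (fun z : EuclideanSpace ℝ (Fin n) × X => (p z.1).toFun z.2)}
  constant_plots f := fun _ q hq => f.smooth _ (fun y => (q y).2) hq.2
  plot_reparam {_ _ p f} hp hf := fun k q hq =>
    hp k (fun y => (f (q y).1, (q y).2))
      ⟨(hf.comp (IsPlot.contDiff hq.1)).isPlot, hq.2⟩
  locality {n p} h := fun k q hq => by
    refine DiffeologicalSpace.locality fun x => ?_
    obtain ⟨u, hu, hx, hp⟩ := h (q x).1
    have hq1 : ContDiff ℝ ∞ (fun y => (q y).1) := IsPlot.contDiff hq.1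
    refine ⟨(fun y => (q y).1) ⁻¹' u, hu.preimage hq1.continuous, hx, ?_⟩
    intro m f hfu hf
    exact hp (f := fun y => (q (f y)).1) hfu (hq1.comp hf) m (fun y => (y, (q (f y)).2))
      ⟨isPlot_id, isPlot_reparam hq.2 hf⟩

/-- A subduction: a smooth map along which all plots lift locally. -/
def IsSubduction [DiffeologicalSpace X] [DiffeologicalSpace Y] (f : X → Y) : Prop :=
  DSmooth f ∧ ∀ (n : ℕ) (p : EuclideanSpace ℝ (Fin n) → Y), IsPlot p → ∀ x,
    ∃ q : EuclideanSpace ℝ (Fin n) → X, IsPlot q ∧ ∀ᶠ y in 𝓝 x, f (q y) = p y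

end Constructions

/-! ## Diffeological groups, principal bundles, extensions -/

/-- A diffeological group: multiplication and inversion are smooth. -/
structure IsDiffGroup (K : Type u) [Group K] [DiffeologicalSpace K] : Prop where
  smooth_mul : DSmooth (fun z : K × K => z.1 * z.2)
  smooth_inv : DSmooth (fun x : K => x⁻¹)

/-- `π : X → Q` with the map `a : X × K → X` is a principal `K`-bundle of diffeological spaces:
`π` is a subduction, `a` is a fibre-preserving right action, and
`X × K → X ×_Q X`, `(x, k) ↦ (x, x · k)` is a diffeomorphism. -/
structure IsDiffPrincipalBundle {X : Type u} {K : Type v} {Q : Type w} [DiffeologicalSpace X]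
    [DiffeologicalSpace K] [DiffeologicalSpace Q] [Group K]
    (π : X → Q) (a : X → K → X) : Prop where
  subduction : IsSubduction π
  act_one : ∀ x, a x 1 = x
  act_mul : ∀ x k l, a x (k * l) = a (a x k) l
  proj_act : ∀ x k, π (a x k) = π x
  shear : ∃ e : X × K ≃ {z : X × X // π z.1 = π z.2},
    DSmooth e ∧ DSmooth e.symm ∧ ∀ z : X × K, (e z).1 = (z.1, a z.1 z.2)

/-- `1 → K → E → Q → 1` is an extension of diffeological groups: a short exact sequence in
which `K` carries the subspace diffeology of `E`, and `E → Q` is a principal `K`-bundle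
(in particular a subduction). -/
structure IsDiffExtension {K : Type u} {E : Type v} {Q : Type w} [Group K] [Group E] [Group Q]
    [DiffeologicalSpace K] [DiffeologicalSpace E] [DiffeologicalSpace Q]
    (i : K →* E) (π : E →* Q) : Prop where
  group_left : IsDiffGroup K
  group_mid : IsDiffGroup E
  group_right : IsDiffGroup Q
  injective : Function.Injective i
  exact : i.range = π.ker
  induction : ∀ (n : ℕ) (p : EuclideanSpace ℝ (Fin n) → K), IsPlot p ↔ IsPlot (i ∘ p)
  subduction : IsSubduction π
  principal : IsDiffPrincipalBundle π (fun x k => x * i k)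

/-! ## Manifolds as diffeological spaces -/

/-- The manifold `M` (modelled on `E`), regarded as a diffeological space. -/
def Mfd (_E : Type u) (M : Type v) : Type v := M

instance {E : Type u} {G : Type v} [Group G] : Group (Mfd E G) := inferInstanceAs (Group G)

/-- The plots of a manifold are the smooth maps. -/
instance mfdD {E : Type u} {M : Type v} [NormedAddCommGroup E] [NormedSpace ℝ E]
    [TopologicalSpace M] [ChartedSpace E M] : DiffeologicalSpace (Mfd E M) where
  plots n := {p | ContMDiff 𝓘(ℝ, EuclideanSpace ℝ (Fin n)) 𝓘(ℝ, E) (M' := M) ∞ p}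
  constant_plots _ := contMDiff_const (M' := M)
  plot_reparam hp hf := ContMDiff.comp (M'' := M) hp hf.contMDiff
  locality {n p} h := fun x => by
    obtain ⟨u, hu, hx, hp⟩ := h x
    obtain ⟨f, hf, hfu, hfx⟩ := exists_smooth_shrink hu hx
    have h1 : ContMDiff 𝓘(ℝ, EuclideanSpace ℝ (Fin n)) 𝓘(ℝ, E) (M' := M) ∞
        (fun y => p (f y)) := hp hfu hf
    refine (h1 x).congr_of_eventuallyEq ?_
    filter_upwards [hfx] with y hy
    rw [hy]

theorem isPlot_mfd_iff {E : Type u} {M : Type v} [NormedAddCommGroup E] [NormedSpace ℝ E]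
    [TopologicalSpace M] [ChartedSpace E M] {n : ℕ} {p : EuclideanSpace ℝ (Fin n) → Mfd E M} :
    IsPlot p ↔ ContMDiff 𝓘(ℝ, EuclideanSpace ℝ (Fin n)) 𝓘(ℝ, E) (M' := M) ∞ p := Iff.rfl

/-! ## Principal bundles over manifolds and connections -/

section Bundles

variable (EH EM EP H M P : Type*)
  [NormedAddCommGroup EH] [NormedSpace ℝ EH]
  [NormedAddCommGroup EM] [NormedSpace ℝ EM]
  [NormedAddCommGroup EP] [NormedSpace ℝ EP]
  [TopologicalSpace H] [ChartedSpace EH H] [Group H]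
  [TopologicalSpace M] [ChartedSpace EM M]
  [TopologicalSpace P] [ChartedSpace EP P]

/-- A smooth principal `H`-bundle over the manifold `M` with total space the manifold `P`:
a smooth right action of `H` on `P`, and a projection `P → M` which is locally isomorphic,
`H`-equivariantly, to `U × H → U`. -/
structure PrincipalBundle where
  /-- the bundle projection -/
  proj : P → M
  /-- the right action of the structure group -/
  act : P → H → P
  act_one : ∀ p, act p 1 = p
  act_mul : ∀ p h k, act p (h * k) = act (act p h) k
  proj_smooth : ContMDiff 𝓘(ℝ, EP) 𝓘(ℝ, EM) ∞ proj
  act_smooth : ContMDiff (𝓘(ℝ, EP).prod 𝓘(ℝ, EH)) 𝓘(ℝ, EP) ∞ (fun z : P × H => act z.1 z.2)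
  proj_act : ∀ p h, proj (act p h) = proj p
  locally_trivial : ∀ x : M, ∃ (U : Set M) (e : OpenPartialHomeomorph P (M × H)),
    IsOpen U ∧ x ∈ U ∧ e.source = proj ⁻¹' U ∧ e.target = U ×ˢ (univ : Set H) ∧
    ContMDiffOn 𝓘(ℝ, EP) (𝓘(ℝ, EM).prod 𝓘(ℝ, EH)) ∞ e e.source ∧
    ContMDiffOn (𝓘(ℝ, EM).prod 𝓘(ℝ, EH)) 𝓘(ℝ, EP) ∞ e.symm e.target ∧
    (∀ p ∈ e.source, (e p).1 = proj p) ∧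
    ∀ p ∈ e.source, ∀ h, (e (act p h)).2 = (e p).2 * h

variable {EH EM EP H M P}

variable (EH) in
/-- The adjoint action `Ad_{h⁻¹}` on the Lie algebra of `H`: the derivative at `1` of
`k ↦ h⁻¹ k h`. -/
def adInv (h : H) : GroupLieAlgebra 𝓘(ℝ, EH) H →L[ℝ] GroupLieAlgebra 𝓘(ℝ, EH) H :=
  mfderiv 𝓘(ℝ, EH) 𝓘(ℝ, EH) (fun k : H => h⁻¹ * k * h) 1

variable (EH) in
/-- The left-invariant Maurer-Cartan form `θ` of `H`: at `h` it is the derivative of left translation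
by `h⁻¹`, with values in the tangent space at `h⁻¹ * h = 1`. -/
def maurerCartan (h : H) : TangentSpace 𝓘(ℝ, EH) h →L[ℝ] GroupLieAlgebra 𝓘(ℝ, EH) H :=
  mfderiv 𝓘(ℝ, EH) 𝓘(ℝ, EH) (fun k : H => h⁻¹ * k) h

/-- A connection on a principal `H`-bundle: a smooth 1-form `A` on `P` with values in the Lie
algebra of `H` such that, with `ρ : P × H → P` the action and `θ` the left-invariant
Maurer-Cartan form, `ρ^* A = Ad_{h⁻¹} (A) + θ` on `P × H`. -/
structure Connection [IsManifold 𝓘(ℝ, EP) ∞ P] (B : PrincipalBundle EH EM EP H M P) where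
  /-- the connection 1-form -/
  form : ∀ p : P, TangentSpace 𝓘(ℝ, EP) p →L[ℝ] GroupLieAlgebra 𝓘(ℝ, EH) H
  smooth : ContMDiff 𝓘(ℝ, EP).tangent 𝓘(ℝ, EH) (M' := EH) ∞
    (fun v : TangentBundle 𝓘(ℝ, EP) P => form v.proj v.snd)
  equivariant : ∀ (p : P) (h : H) (v : TangentSpace 𝓘(ℝ, EP) p) (ξ : TangentSpace 𝓘(ℝ, EH) h),
    form (B.act p h)
      (mfderiv (𝓘(ℝ, EP).prod 𝓘(ℝ, EH)) 𝓘(ℝ, EP) (fun z : P × H => B.act z.1 z.2) (p, h) (v, ξ)) =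
    adInv EH h (form p v) + maurerCartan EH h ξ

/-! ## The gauge group and the group of symmetries -/

/-- The group of gauge transformations: `H`-equivariant diffeomorphisms of `P` covering the
identity of `M`. -/
@[ext]
structure Gau (B : PrincipalBundle EH EM EP H M P) where
  /-- the underlying diffeomorphism -/
  diffeo : Diffeomorph 𝓘(ℝ, EP) 𝓘(ℝ, EP) P P ∞
  equivariant : ∀ p h, diffeo (B.act p h) = B.act (diffeo p) h
  covers : ∀ p, B.proj (diffeo p) = B.proj p

/-- An element of `Sym_G(P)`: an element `base` of `G` and an `H`-equivariant diffeomorphism of `P`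
covering the action of `base` on `M`, that is, an isomorphism from `P` to the pullback of `P` along
the action of `base`. -/
@[ext]
structure SymG (EG G : Type*) [Group G] [MulAction G M] (B : PrincipalBundle EH EM EP H M P) where
  /-- the covered group element -/
  base : G
  /-- the underlying diffeomorphism -/
  diffeo : Diffeomorph 𝓘(ℝ, EP) 𝓘(ℝ, EP) P P ∞
  equivariant : ∀ p h, diffeo (B.act p h) = B.act (diffeo p) h
  covers : ∀ p, B.proj (diffeo p) = base • B.proj p

/-- A smooth map of manifolds as a smooth map of diffeological spaces. -/
def toDMap (f : P → P) (hf : ContMDiff 𝓘(ℝ, EP) 𝓘(ℝ, EP) ∞ f) : DMap (Mfd EP P) (Mfd EP P) where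
  toFun := f
  smooth := fun n p hp => by
    have hp' : ContMDiff 𝓘(ℝ, EuclideanSpace ℝ (Fin n)) 𝓘(ℝ, EP) (M' := P) ∞ p := hp
    exact hf.comp hp'

namespace Gau

variable {B : PrincipalBundle EH EM EP H M P}

instance : CoeFun (Gau B) (fun _ => P → P) := ⟨fun φ => φ.diffeo⟩

/-- The group structure is composition. -/
instance : Group (Gau B) where
  mul φ ψ := ⟨ψ.diffeo.trans φ.diffeo,
    fun p h => by simp [ψ.equivariant, φ.equivariant], fun p => by simp [ψ.covers, φ.covers]⟩
  one := ⟨Diffeomorph.refl _ P ∞, fun _ _ => rfl, fun _ => rfl⟩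
  inv φ := ⟨φ.diffeo.symm,
    fun p h => by
      refine φ.diffeo.injective (?_ : φ.diffeo _ = φ.diffeo _)
      rw [φ.equivariant, Diffeomorph.apply_symm_apply, Diffeomorph.apply_symm_apply],
    fun p => by rw [← φ.covers, Diffeomorph.apply_symm_apply]⟩
  mul_assoc _ _ _ := rfl
  one_mul _ := rfl
  mul_one _ := rfl
  inv_mul_cancel φ := Gau.ext (Diffeomorph.ext fun p => φ.diffeo.symm_apply_apply p)

/-- The diffeology induced from the mapping space `P^P`. -/
instance : DiffeologicalSpace (Gau B) :=
  inducedD (fun φ : Gau B => toDMap (EP := EP) φ.diffeo φ.diffeo.contMDiff)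

end Gau

namespace SymG

variable {EG G : Type*} [Group G] [MulAction G M] {B : PrincipalBundle EH EM EP H M P}

instance : CoeFun (SymG EG G B) (fun _ => P → P) := ⟨fun ψ => ψ.diffeo⟩

/-- The product of `ψ` over `g` and `φ` over `g'` is `ψ ∘ φ` over `g * g'`. -/
instance : Group (SymG EG G B) where
  mul ψ φ := ⟨ψ.base * φ.base, φ.diffeo.trans ψ.diffeo,
    fun p h => by simp [ψ.equivariant, φ.equivariant],
    fun p => by simp [ψ.covers, φ.covers, mul_smul]⟩
  one := ⟨1, Diffeomorph.refl _ P ∞, fun _ _ => rfl, fun p => (one_smul G (B.proj p)).symm⟩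
  inv ψ := ⟨ψ.base⁻¹, ψ.diffeo.symm,
    fun p h => by
      refine ψ.diffeo.injective (?_ : ψ.diffeo _ = ψ.diffeo _)
      rw [ψ.equivariant, Diffeomorph.apply_symm_apply, Diffeomorph.apply_symm_apply],
    fun p => by
      rw [eq_inv_smul_iff, ← ψ.covers, Diffeomorph.apply_symm_apply]⟩
  mul_assoc _ _ _ := SymG.ext (mul_assoc _ _ _) rfl
  one_mul _ := SymG.ext (one_mul _) rfl
  mul_one _ := SymG.ext (mul_one _) rfl
  inv_mul_cancel ψ := SymG.ext (inv_mul_cancel _)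
    (Diffeomorph.ext fun p => ψ.diffeo.symm_apply_apply p)

/-- The subspace diffeology of `P^P × G`. -/
instance [NormedAddCommGroup EG] [NormedSpace ℝ EG] [TopologicalSpace G] [ChartedSpace EG G] :
    DiffeologicalSpace (SymG EG G B) :=
  inducedD (Y := DMap (Mfd EP P) (Mfd EP P) × Mfd EG G) (fun ψ : SymG EG G B =>
    (toDMap (EP := EP) ψ.diffeo ψ.diffeo.contMDiff, ψ.base))

variable (EG G B) in
/-- The projection `Sym_G(P) → G`. -/
def proj : SymG EG G B →* Mfd EG G where
  toFun ψ := ψ.base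
  map_one' := rfl
  map_mul' _ _ := rfl

variable (EG G B) in
/-- The inclusion `Gau(P) → Sym_G(P)` as the fibre over `1`. -/
def incl : Gau B →* SymG EG G B where
  toFun φ := ⟨1, φ.diffeo, φ.equivariant, fun p => by rw [φ.covers, one_smul]⟩
  map_one' := rfl
  map_mul' _ _ := SymG.ext (one_mul 1).symm rfl

end SymG

/-! ## Paths, parallel transport and holonomy -/

section Paths

/-- The path `f` followed by the path `g`, in the order of composition: `concatPath g f` is `g ⋆ f`. -/
def concatPath {X : Type*} (g f : unitInterval → X) : unitInterval → X := fun t =>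
  if (t : ℝ) ≤ 1 / 2 then f (projIcc 0 1 zero_le_one (2 * t))
  else g (projIcc 0 1 zero_le_one (2 * t - 1))

/-- The reversed path. -/
def revPath {X : Type*} (f : unitInterval → X) : unitInterval → X := fun t => f (unitInterval.symm t)

/-- The diffeological space `P_0 G` of smooth paths `[0,1] → G` which start at `1` and are constant
near `0` and near `1`, with the subspace diffeology of the mapping space `G^[0,1]`. -/
def BasedPath (EG G : Type*) [NormedAddCommGroup EG] [NormedSpace ℝ EG] [Group G]
    [TopologicalSpace G] [ChartedSpace EG G] : Type _ :=
  {γ : DMap unitInterval (Mfd EG G) // γ.toFun 0 = 1 ∧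
    (∀ᶠ t in 𝓝 0, γ.toFun t = γ.toFun 0) ∧ ∀ᶠ t in 𝓝 1, γ.toFun t = γ.toFun 1}

namespace BasedPath

variable {EG G : Type*} [NormedAddCommGroup EG] [NormedSpace ℝ EG] [Group G]
    [TopologicalSpace G] [ChartedSpace EG G]

instance : DiffeologicalSpace (BasedPath EG G) := subtypeD

/-- The underlying map of a path. -/
def toFun (γ : BasedPath EG G) : unitInterval → G := γ.1.toFun

instance : CoeFun (BasedPath EG G) (fun _ => unitInterval → G) := ⟨toFun⟩

/-- The constant path. -/
instance : One (BasedPath EG G) :=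
  ⟨⟨⟨fun _ => 1, dSmooth_const⟩, rfl, Eventually.of_forall fun _ => rfl,
    Eventually.of_forall fun _ => rfl⟩⟩

/-- The pointwise product of paths. -/
instance [LieGroup 𝓘(ℝ, EG) ∞ G] : Mul (BasedPath EG G) where
  mul γ δ := ⟨⟨fun t => γ.1.toFun t * δ.1.toFun t, fun n q hq =>
      isPlot_mfd_iff.2
        ((isPlot_mfd_iff.1 (γ.1.smooth n q hq)).mul (isPlot_mfd_iff.1 (δ.1.smooth n q hq)))⟩,
    by simp [γ.2.1, δ.2.1],
    by filter_upwards [γ.2.2.1, δ.2.2.1] with t h1 h2; rw [h1, h2],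
    by filter_upwards [γ.2.2.2, δ.2.2.2] with t h1 h2; rw [h1, h2]⟩

end BasedPath

variable [IsManifold 𝓘(ℝ, EP) ∞ P] {B : PrincipalBundle EH EM EP H M P}

/-- `σ` restricted to `[0,1]` is a smooth lift to `P` of the path `c` in `M` which is horizontal,
i.e. the connection form vanishes on its velocity. -/
structure IsHorizontalLift (A : Connection B) (c : unitInterval → M) (σ : ℝ → P) : Prop where
  smooth : ContMDiffOn 𝓘(ℝ, ℝ) 𝓘(ℝ, EP) ∞ σ (Icc 0 1)
  lift : ∀ t : unitInterval, B.proj (σ t) = c t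
  horizontal : ∀ t ∈ Icc (0 : ℝ) 1,
    A.form (σ t) (mfderivWithin 𝓘(ℝ, ℝ) 𝓘(ℝ, EP) σ (Icc 0 1) t 1) = 0

/-- There is exactly one horizontal lift of `c` starting at `p`. -/
def HasUniqueHorizontalLift (A : Connection B) (c : unitInterval → M) (p : P) : Prop :=
  (∃ σ : ℝ → P, IsHorizontalLift A c σ ∧ σ 0 = p) ∧
  ∀ σ τ : ℝ → P, IsHorizontalLift A c σ → IsHorizontalLift A c τ → σ 0 = p → τ 0 = p →
    EqOn σ τ (Icc 0 1)

open Classical in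
/-- Parallel transport of `p` along `c`: the end point of the horizontal lift of `c` starting at `p`
(and, as a default value, `p` itself if there is no such lift). -/
def transport (A : Connection B) (c : unitInterval → M) (p : P) : P :=
  if h : ∃ σ : ℝ → P, IsHorizontalLift A c σ ∧ σ 0 = p then h.choose 1 else p

variable {EG G : Type*} [NormedAddCommGroup EG] [NormedSpace ℝ EG] [Group G]
    [TopologicalSpace G] [ChartedSpace EG G] [MulAction G M]

/-- The path `γ_x` in `M` traced out by the point `x` under a path in `G`. -/
def orbitPath (γ : unitInterval → G) (x : M) : unitInterval → M := fun t => γ t • x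

/-- The map `pt_γ : P → P` covering the action of `γ 1`: on the fibre over `x` it is parallel
transport along `γ_x`. -/
def pt (A : Connection B) (γ : BasedPath EG G) (p : P) : P :=
  transport A (orbitPath γ (B.proj p)) p

/-- The loop `α⁻ ⋆ γ` in `G` (`γ` followed by the reverse `α⁻` of `α`), for paths `γ`, `α` with the same end point. -/
def loop (α γ : BasedPath EG G) : unitInterval → G := concatPath (revPath α) γ

/-- The map `hol(P, α, γ) : P → P`: on the fibre over `x` it is the holonomy of the connection
along the loop `(α⁻ ⋆ γ)_x`. -/
def hol (A : Connection B) (α γ : BasedPath EG G) (p : P) : P :=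
  transport A (orbitPath (loop α γ) (B.proj p)) p

/-! ## The bundle `L_G` obtained by descent -/

variable (EG G) in
/-- The relation `(γ, φ) ∼ (α, hol(P, α, γ) ∘ φ)` for paths `γ`, `α` with the same end point. -/
def LRel (A : Connection B) (a b : BasedPath EG G × Gau B) : Prop :=
  a.1 1 = b.1 1 ∧ ∀ p, b.2 p = hol A b.1 a.1 (a.2 p)

variable (EG G) in
/-- `L_G = (P_0 G × Gau(P)) / ∼`, with the quotient diffeology. -/
def LG (A : Connection B) : Type _ := Quot (LRel EG G A)

instance (A : Connection B) : DiffeologicalSpace (LG EG G A) := quotD _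

/-- The class `[(γ, φ)]` in `L_G`. -/
def LG.mk (A : Connection B) (γ : BasedPath EG G) (φ : Gau B) : LG EG G A :=
  Quot.mk (LRel EG G A) (γ, φ)

/-- `(P_0 G)^[2]`: pairs of paths with the same end point. -/
abbrev PathPair (EG G : Type*) [NormedAddCommGroup EG] [NormedSpace ℝ EG] [Group G]
    [TopologicalSpace G] [ChartedSpace EG G] : Type _ :=
  {z : BasedPath EG G × BasedPath EG G // z.1 1 = z.2 1}

end Paths

end Bundles

end

end SymExt

open SymExt

/-! Parallel transport along the orbit paths of a based path `γ` is `H`-equivariant and covers the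
action of `γ 1`, so each connection yields a smooth map `ptSym` from based paths to `Sym_G(P)`.
Everything about `L_G` is read off from `descend`, the map `(γ, φ) ↦ pt_γ ∘ φ`. It is a subduction:
as `G` is connected, `γ ↦ γ 1` is a subduction, and a plot of symmetries lying over the end points
of a plot `γ` differs from `pt_γ` by a plot of gauge transformations. Its fibres are the classes of
`∼`, because `pt_α ∘ hol(P, α, γ) = pt_γ` (`pt_hol`). Hence the quotient `L_G` is diffeomorphic to
`Sym_G(P)`, and group structure, product formula and extension are carried across this bijection.

For `Sym_G(P)` itself the one non-formal point of the group structure is smoothness of inversion. An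
equivariant map is inverted explicitly by local sections and the division map of the bundle
(`contMDiff_inverse_family`). A short exact sequence whose kernel has the subspace diffeology and
whose projection is a subduction is automatically principal (`IsDiffExtension.of_subduction`). The
projection to `G` is a subduction because `ptSym` lifts local families of paths; the connection used
there comes from a partition of unity.

The analytic core is that parallel transport exists and depends smoothly on parameters. Writing a
lift as a local section times a curve in `H` turns horizontality into an ordinary differential
equation in a chart of `H`. Its smooth dependence on parameters follows from the implicit function
theorem in a Banach space of curves, applied to a rescaled Picard equation. Local lifts are glued
over `[0, 1]` by compactness. Uniqueness holds because the quotient of two horizontal lifts has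
vanishing Maurer-Cartan derivative, hence is constant. -/

namespace SymExt
-- Smoothness of composition operators on spaces of continuous functions.
section Nemytskii

variable {K : Type*} [TopologicalSpace K] [CompactSpace K]

/-- Pointwise application of a family of continuous linear maps to a family of vectors. -/
noncomputable def pointwiseApply (K : Type*) [TopologicalSpace K] [CompactSpace K]
    (W E : Type*) [NormedAddCommGroup W] [NormedSpace ℝ W]
    [NormedAddCommGroup E] [NormedSpace ℝ E] :
    C(K, W →L[ℝ] E) →L[ℝ] C(K, W) →L[ℝ] C(K, E) :=
  LinearMap.mkContinuous₂
    (LinearMap.mk₂ ℝ (fun (T : C(K, W →L[ℝ] E)) (w : C(K, W)) =>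
        (⟨fun k => T k (w k), T.continuous.clm_apply w.continuous⟩ : C(K, E)))
      (fun _ _ _ => by ext; simp) (fun _ _ _ => by ext; simp)
      (fun _ _ _ => by ext; simp) (fun _ _ _ => by ext; simp)) 1
    (fun T w => by
      rw [one_mul]
      refine (ContinuousMap.norm_le _ (by positivity)).2 fun k => ?_
      exact ((T k).le_opNorm _).trans
        (mul_le_mul (T.norm_coe_le_norm k) (w.norm_coe_le_norm k) (norm_nonneg _) (by positivity)))

/-- Postcomposition with `F'` is continuous for the sup norm, so `F'` varies by at most `ε` along
the segments from `w k` to `w k + h k`, uniformly in `k`. The mean value inequality on each segment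
then gives the estimate. -/
theorem hasFDerivAt_postcomp {W E : Type*} [NormedAddCommGroup W] [NormedSpace ℝ W]
    [NormedAddCommGroup E] [NormedSpace ℝ E] (F : C(W, E)) (F' : C(W, W →L[ℝ] E))
    (hF : ∀ x, HasFDerivAt F (F' x) x) (w : C(K, W)) :
    HasFDerivAt (fun w : C(K, W) => F.comp w) (pointwiseApply K W E (F'.comp w)) w := by
  rw [hasFDerivAt_iff_isLittleO_nhds_zero, Asymptotics.isLittleO_iff]
  intro ε hε
  have hc : Continuous fun v : C(K, W) => F'.comp v := F'.continuous_postcomp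
  obtain ⟨δ, hδ, hδ'⟩ := Metric.eventually_nhds_iff.1
    ((hc.tendsto w).eventually (Metric.ball_mem_nhds (F'.comp w) hε))
  filter_upwards [Metric.ball_mem_nhds (0 : C(K, W)) hδ] with h hh
  rw [mem_ball_zero_iff] at hh
  refine (ContinuousMap.norm_le _ (by positivity)).2 fun k => ?_
  have key := (convex_segment (𝕜 := ℝ) (w k) (w k + h k)).norm_image_sub_le_of_norm_hasFDerivWithin_le'
    (f := F) (f' := F') (φ := F' (w k)) (C := ε)
    (fun x _ => (hF x).hasFDerivWithinAt) (fun x hx => by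
      rw [segment_eq_image'] at hx
      obtain ⟨t, ht, rfl⟩ := hx
      have h1 : dist (w + t • h) w < δ := by
        rw [dist_eq_norm, add_sub_cancel_left, norm_smul, Real.norm_eq_abs, abs_of_nonneg ht.1]
        nlinarith [norm_nonneg h, ht.2]
      have h2 := (ContinuousMap.dist_apply_le_dist (f := F'.comp (w + t • h)) (g := F'.comp w) k).trans
        (Metric.mem_ball.1 (hδ' h1)).le
      simpa [dist_eq_norm] using h2) (left_mem_segment ℝ _ _) (right_mem_segment ℝ _ _)
  have h3 : ‖h k‖ ≤ ‖h‖ := h.norm_coe_le_norm k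
  simp only [add_sub_cancel_left] at key
  refine key.trans ?_
  gcongr

/-- Induction on the order: the derivative is again a postcomposition, with `fderiv ℝ F`, followed
by a bounded operator. The target changes to `W →L[ℝ] E`, so `E` is quantified inside the induction,
and `W` and `E` share a universe. -/
theorem contDiff_postcomp {W : Type} [NormedAddCommGroup W] [NormedSpace ℝ W] (n : ℕ) :
    ∀ {E : Type} [NormedAddCommGroup E] [NormedSpace ℝ E] (F : C(W, E)), ContDiff ℝ ∞ F →
      ContDiff ℝ n (fun w : C(K, W) => F.comp w) := by
  induction n with
  | zero =>
    intro E _ _ F hF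
    exact contDiff_zero.2 F.continuous_postcomp
  | succ n ih =>
    intro E _ _ F hF
    let F' : C(W, W →L[ℝ] E) := ⟨fderiv ℝ F, hF.continuous_fderiv (by simp)⟩
    have hF' : ContDiff ℝ ∞ F' := hF.fderiv_right (m := ∞) (by simp)
    have hd := hasFDerivAt_postcomp (K := K) F F'
      (fun x => (hF.differentiable (by simp) x).hasFDerivAt)
    rw [Nat.cast_succ, contDiff_succ_iff_fderiv]
    refine ⟨fun w => (hd w).differentiableAt, by simp, ?_⟩
    rw [show fderiv ℝ (fun w : C(K, W) => F.comp w) = fun w => pointwiseApply K W E (F'.comp w) from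
      funext fun w => (hd w).fderiv]
    exact (pointwiseApply K W E).contDiff.comp (ih F' hF')

end Nemytskii
end SymExt

namespace SymExt
-- Ordinary differential equations with smooth dependence on parameters.
section Flow

/-- Integration from `0`, as an operator on continuous functions on `[-1, 1]`. -/
noncomputable def integralFromZero (E : Type*) [NormedAddCommGroup E] [NormedSpace ℝ E]
    [CompleteSpace E] : C(Icc (-1 : ℝ) 1, E) →L[ℝ] C(Icc (-1 : ℝ) 1, E) :=
  LinearMap.mkContinuous
    { toFun := fun f => ⟨fun t => ∫ τ in (0 : ℝ)..t, IccExtend (by norm_num) f τ,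
        (intervalIntegral.continuous_primitive
          (fun a b => (f.continuous.Icc_extend' (h := by norm_num)).intervalIntegrable a b) 0).comp
          continuous_subtype_val⟩
      map_add' := fun f g => by
        ext t
        exact intervalIntegral.integral_add
          ((f.continuous.Icc_extend' (h := by norm_num)).intervalIntegrable _ _)
          ((g.continuous.Icc_extend' (h := by norm_num)).intervalIntegrable _ _)
      map_smul' := fun c f => by
        ext t
        exact intervalIntegral.integral_smul c _ } 1
    (fun f => by
      rw [one_mul]
      refine (ContinuousMap.norm_le _ (norm_nonneg _)).2 fun t => ?_
      refine (intervalIntegral.norm_integral_le_of_norm_le_const (C := ‖f‖)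
        fun x _ => f.norm_coe_le_norm _).trans ?_
      have : |(t : ℝ) - 0| ≤ 1 := by rw [sub_zero]; exact abs_le.2 t.2
      nlinarith [norm_nonneg f])

theorem integralFromZero_apply {E : Type*} [NormedAddCommGroup E] [NormedSpace ℝ E]
    [CompleteSpace E] (f : C(Icc (-1 : ℝ) 1, E)) (t : Icc (-1 : ℝ) 1) :
    integralFromZero E f t = ∫ τ in (0 : ℝ)..t, IccExtend (by norm_num) f τ := rfl

variable {V E : Type} [NormedAddCommGroup V] [NormedSpace ℝ V]
  [NormedAddCommGroup E] [NormedSpace ℝ E]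

/-- The curve `t ↦ ((v, s₀ + ε t), y t)`, as a function of `((v, ε), y)`. -/
noncomputable def graphCurve (s₀ : ℝ) (x : (V × ℝ) × C(Icc (-1 : ℝ) 1, E)) :
    C(Icc (-1 : ℝ) 1, (V × ℝ) × E) :=
  ⟨fun t => ((x.1.1, s₀ + x.1.2 * t), x.2 t), by fun_prop⟩

theorem contDiff_graphCurve (s₀ : ℝ) :
    ContDiff ℝ ∞ (graphCurve s₀ : (V × ℝ) × C(Icc (-1 : ℝ) 1, E) → _) := by
  let K := Icc (-1 : ℝ) 1
  let iV : V →L[ℝ] (V × ℝ) × E := (ContinuousLinearMap.inl ℝ (V × ℝ) E).comp (.inl ℝ V ℝ)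
  let iR : ℝ →L[ℝ] (V × ℝ) × E := (ContinuousLinearMap.inl ℝ (V × ℝ) E).comp (.inr ℝ V ℝ)
  let T : C(K, ℝ) := ⟨fun t => t, by fun_prop⟩
  have : (graphCurve s₀ : (V × ℝ) × C(Icc (-1 : ℝ) 1, E) → _) = fun x =>
      ContinuousLinearMap.const ℝ K (iV x.1.1) +
      (ContinuousLinearMap.const ℝ K (iR s₀) + x.1.2 • iR.compLeftContinuous ℝ K T) +
      (ContinuousLinearMap.inr ℝ (V × ℝ) E).compLeftContinuous ℝ K x.2 := by
    funext x
    ext t : 1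
    change _ = iV x.1.1 + (iR s₀ + x.1.2 • iR t) + ContinuousLinearMap.inr ℝ (V × ℝ) E (x.2 t)
    ext <;> simp [graphCurve, iV, iR]
  rw [this]
  have h1 := (ContinuousLinearMap.const ℝ (M := (V × ℝ) × E) K).contDiff (n := ∞)
  have h2 := ((ContinuousLinearMap.inr ℝ (V × ℝ) E).compLeftContinuous ℝ K).contDiff (n := ∞)
  exact ((h1.comp (iV.contDiff.comp (contDiff_fst.comp contDiff_fst))).add
    (contDiff_const.add ((contDiff_snd.comp contDiff_fst).smul contDiff_const))).add
    (h2.comp contDiff_snd)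

variable [CompleteSpace V] [CompleteSpace E]

/-- The equation `y = y₀ + ε ∫₀ F (v, s₀ + ε t, y t) dt`, whose solutions are the
rescaled integral curves of `F`. -/
noncomputable def picardDefect (F : C((V × ℝ) × E, E)) (s₀ : ℝ) (y₀ : E)
    (x : (V × ℝ) × C(Icc (-1 : ℝ) 1, E)) : C(Icc (-1 : ℝ) 1, E) :=
  x.2 - .const _ y₀ - x.1.2 • integralFromZero E (F.comp (graphCurve s₀ x))

omit [CompleteSpace V] in
theorem contDiff_picardDefect (F : C((V × ℝ) × E, E)) (hF : ContDiff ℝ ∞ F) (s₀ : ℝ) (y₀ : E) :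
    ContDiff ℝ ∞ (picardDefect F s₀ y₀) := by
  have h1 : ContDiff ℝ ∞ fun w : C(Icc (-1 : ℝ) 1, (V × ℝ) × E) => F.comp w :=
    contDiff_infty.2 fun n => contDiff_postcomp n F hF
  have h2 : ContDiff ℝ ∞ (graphCurve s₀ : (V × ℝ) × C(Icc (-1 : ℝ) 1, E) → _) :=
    contDiff_graphCurve s₀
  exact (contDiff_snd.sub contDiff_const).sub ((contDiff_snd.comp contDiff_fst).smul
    ((integralFromZero E).contDiff.comp (h1.comp h2)))

/-- Multiplication by `r ∈ [-1, 1]` on `[-1, 1]`. -/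
noncomputable def scaleIcc (r : Icc (-1 : ℝ) 1) : C(Icc (-1 : ℝ) 1, Icc (-1 : ℝ) 1) :=
  ⟨fun t => ⟨r * t, abs_le.1 (by
    rw [abs_mul]; exact mul_le_one₀ (abs_le.2 r.2) (abs_nonneg _) (abs_le.2 t.2))⟩, by fun_prop⟩

-- Substitution `τ ↦ r τ` in the integral. This converts smooth dependence on the length `ε` of the
-- time interval into smooth dependence on time.
omit [NormedSpace ℝ V] [CompleteSpace V] in
theorem picardDefect_scale (F : C((V × ℝ) × E, E)) (s₀ : ℝ) (y₀ : E) (v : V) (ε : ℝ)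
    (y : C(Icc (-1 : ℝ) 1, E)) (h : picardDefect F s₀ y₀ ((v, ε), y) = 0) (r : Icc (-1 : ℝ) 1) :
    picardDefect F s₀ y₀ ((v, r * ε), y.comp (scaleIcc r)) = 0 := by
  ext t
  have h1 := congrArg (fun f : C(Icc (-1 : ℝ) 1, E) => f (scaleIcc r t)) h
  simp only [picardDefect, ContinuousMap.sub_apply, ContinuousMap.smul_apply,
    integralFromZero_apply, ContinuousMap.const_apply, ContinuousMap.zero_apply,
    ContinuousMap.comp_apply] at h1 ⊢
  rw [← h1]
  congr 1
  rw [mul_comm, mul_smul]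
  congr 1
  have h2 : ((scaleIcc r t : Icc (-1 : ℝ) 1) : ℝ) = r * t := rfl
  rw [h2, show (∫ τ in (0 : ℝ)..r * t, IccExtend (by norm_num)
    (F.comp (graphCurve s₀ ((v, ε), y))) τ) = ∫ τ in (r : ℝ) * 0..r * t, IccExtend (by norm_num)
    (F.comp (graphCurve s₀ ((v, ε), y))) τ by rw [mul_zero],
    ← intervalIntegral.smul_integral_comp_mul_left]
  congr 1
  refine intervalIntegral.integral_congr fun τ hτ => ?_
  have hτ' : τ ∈ Icc (-1 : ℝ) 1 :=
    (uIcc_subset_Icc (by norm_num) t.2 : uIcc (0 : ℝ) t ⊆ Icc (-1) 1) hτ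
  have hrτ : (r : ℝ) * τ ∈ Icc (-1 : ℝ) 1 := (scaleIcc r ⟨τ, hτ'⟩).2
  rw [IccExtend_of_mem _ _ hτ', IccExtend_of_mem _ _ hrτ]
  simp only [ContinuousMap.comp_apply, graphCurve, ContinuousMap.coe_mk, scaleIcc]
  congr 4
  ring

/-- Being `C^∞` at one point only gives `C^n` on neighbourhoods depending on `n`. Instead the
implicit function theorem is applied afresh at each nearby `(x, Y x)`, where the partial derivative
is still invertible since invertibility is an open condition. Local uniqueness identifies the new
implicit function with `Y`. -/
theorem eventually_contDiffAt_implicitFunction {E₁ E₂ F : Type*} [NormedAddCommGroup E₁]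
    [NormedSpace ℝ E₁] [CompleteSpace E₁] [NormedAddCommGroup E₂] [NormedSpace ℝ E₂]
    [CompleteSpace E₂] [NormedAddCommGroup F] [NormedSpace ℝ F] [CompleteSpace F]
    {f : E₁ × E₂ → F} {u : E₁ × E₂} (hf : ContDiff ℝ ∞ f)
    (if₂ : (fderiv ℝ f u ∘L .inr ℝ E₁ E₂).IsInvertible) :
    ∀ᶠ x in 𝓝 u.1, ContDiffAt ℝ ∞
      (hf.contDiffAt.implicitFunction (u := u) (by simp) if₂) x := by
  set Y := hf.contDiffAt.implicitFunction (u := u) (by simp) if₂ with hYdef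
  have hY : ContDiffAt ℝ ∞ Y u.1 := hf.contDiffAt.contDiffAt_implicitFunction (by simp) if₂
  have hY0 : Y u.1 = u.2 := hf.contDiffAt.implicitFunction_apply_self (by simp) if₂
  have hYc : ∀ᶠ x in 𝓝 u.1, ContDiffAt ℝ 1 Y x :=
    (hY.of_le (m := 1) (by simp)).eventually (by simp)
  have hYs : ∀ᶠ x in 𝓝 u.1, ∀ᶠ x' in 𝓝 x, f (x', Y x') = f u :=
    eventually_eventually_nhds.2 (hf.contDiffAt.eventually_apply_implicitFunction (by simp) if₂)
  have hinv : ∀ᶠ x in 𝓝 u.1, (fderiv ℝ f (x, Y x) ∘L .inr ℝ E₁ E₂).IsInvertible := by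
    have hc : ContinuousAt (fun x => fderiv ℝ f (x, Y x) ∘L .inr ℝ E₁ E₂) u.1 := by
      have h1 : ContinuousAt (fun x => fderiv ℝ f (x, Y x)) u.1 :=
        (hf.continuous_fderiv (by simp)).continuousAt.comp
          (continuousAt_id.prodMk hY.continuousAt)
      exact h1.clm_comp continuousAt_const
    obtain ⟨e, he⟩ := if₂
    have := e.nhds
    rw [he] at this
    have hu : (u.1, Y u.1) = u := by rw [hY0]
    refine hc.preimage_mem_nhds (t := {L | L.IsInvertible}) ?_
    rwa [hu]
  filter_upwards [hYc, hYs, hinv] with x h1 h2 h3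
  have h4 := hf.contDiffAt.contDiffAt_implicitFunction (u := (x, Y x)) (n := ∞) (by simp) h3
  refine h4.congr_of_eventuallyEq ?_
  have h5 := hf.contDiffAt.eventually_apply_eq_iff_implicitFunction (n := ∞) (u := (x, Y x)) (by simp) h3
  filter_upwards [(continuousAt_id.prodMk h1.continuousAt).eventually h5, h2] with x' h6 h7
  exact (h6.1 (h7.trans h2.self_of_nhds.symm)).symm

/-- Local existence of solutions of ordinary differential equations, with smooth dependence on
parameters. -/
theorem exists_smooth_solution_of_contDiff (F : (V × ℝ) × E → E) (hF : ContDiff ℝ ∞ F) (v₀ : V)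
    (s₀ : ℝ) (y₀ : E) :
    ∃ y : V × ℝ → E, y (v₀, s₀) = y₀ ∧
      ∀ᶠ z in 𝓝 (v₀, s₀), ContDiffAt ℝ ∞ y z ∧ HasDerivAt (fun s => y (z.1, s)) (F (z, y z)) z.2 := by
  let Fc : C((V × ℝ) × E, E) := ⟨F, hF.continuous⟩
  let u : (V × ℝ) × C(Icc (-1 : ℝ) 1, E) := ((v₀, 0), .const _ y₀)
  have cdf : ContDiffAt ℝ ∞ (picardDefect Fc s₀ y₀) u := (contDiff_picardDefect Fc hF s₀ y₀).contDiffAt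
  have hu : picardDefect Fc s₀ y₀ u = 0 := by simp [picardDefect, u]
  -- At `ε = 0` the integral term drops out, so the partial derivative in `y` is the identity.
  have hid : fderiv ℝ (picardDefect Fc s₀ y₀) u ∘L .inr ℝ (V × ℝ) _ = .id ℝ _ := by
    have h1 : HasFDerivAt (fun y => picardDefect Fc s₀ y₀ ((v₀, 0), y))
        (fderiv ℝ (picardDefect Fc s₀ y₀) u ∘L .inr ℝ (V × ℝ) _) (.const _ y₀) :=
      HasFDerivAt.comp (g := picardDefect Fc s₀ y₀) (f := fun y => ((v₀, (0 : ℝ)), y)) _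
        (cdf.differentiableAt (by simp)).hasFDerivAt (hasFDerivAt_prodMk_right _ _)
    have h2 : (fun y => picardDefect Fc s₀ y₀ ((v₀, 0), y)) = fun y => y - .const _ y₀ := by
      funext y; simp [picardDefect]
    rw [h2] at h1
    exact h1.unique ((hasFDerivAt_id _).sub_const _)
  have hinv : (fderiv ℝ (picardDefect Fc s₀ y₀) u ∘L .inr ℝ (V × ℝ) _).IsInvertible := by
    rw [hid]; exact ⟨ContinuousLinearEquiv.refl ℝ _, rfl⟩
  let Y := cdf.implicitFunction (by simp) hinv
  have hY : ContDiffAt ℝ ∞ Y (v₀, 0) := cdf.contDiffAt_implicitFunction (by simp) hinv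
  have hY0 : Y (v₀, 0) = .const _ y₀ := cdf.implicitFunction_apply_self (by simp) hinv
  have hYs : ∀ᶠ x in 𝓝 (v₀, (0 : ℝ)), picardDefect Fc s₀ y₀ (x, Y x) = 0 := by
    have := cdf.eventually_apply_implicitFunction (by simp) hinv
    rwa [hu] at this
  have hYu : ∀ᶠ w in 𝓝 u, picardDefect Fc s₀ y₀ w = 0 → Y w.1 = w.2 := by
    have := cdf.eventually_apply_eq_iff_implicitFunction (by simp) hinv
    rw [hu] at this
    exact this.mono fun w hw => hw.1
  obtain ⟨a, ha, ha'⟩ := Metric.eventually_nhds_iff.1 hYu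
  have hYn : ∀ᶠ x in 𝓝 (v₀, (0 : ℝ)), dist (Y x) (.const _ y₀) < a := by
    have := hY.continuousAt.tendsto
    rw [hY0] at this
    exact this.eventually (Metric.ball_mem_nhds _ ha)
  obtain ⟨b, hb, hb'⟩ := Metric.eventually_nhds_iff.1 (hYs.and hYn)
  have one_mem : (1 : ℝ) ∈ Icc (-1 : ℝ) 1 := by norm_num
  -- Here `a` is a radius on which solutions are unique and `b` one on which `Y` solves the equation
  -- and stays `a`-close to the constant curve. Below both, rescaled solutions remain in the
  -- uniqueness region.
  let ρ := min a b / 2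
  have hρ : 0 < ρ := by positivity
  have hρa : ρ < a := lt_of_lt_of_le (half_lt_self (by positivity)) (min_le_left _ _)
  have hρb : ρ < b := lt_of_lt_of_le (half_lt_self (by positivity)) (min_le_right _ _)
  have key : ∀ v, dist v v₀ < ρ → ∀ r : Icc (-1 : ℝ) 1, Y (v, r * ρ) ⟨1, one_mem⟩ = Y (v, ρ) r := by
    intro v hv r
    have hd : dist (v, ρ) (v₀, (0 : ℝ)) < b := by
      rw [Prod.dist_eq, Real.dist_eq, sub_zero, abs_of_pos hρ]
      exact max_lt (hv.trans hρb) hρb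
    have h1 := picardDefect_scale Fc s₀ y₀ v ρ _ (hb' hd).1 r
    have hr : |(r : ℝ)| ≤ 1 := abs_le.2 r.2
    have h2 : dist ((v, r * ρ), (Y (v, ρ)).comp (scaleIcc r)) u < a := by
      rw [Prod.dist_eq, Prod.dist_eq, Real.dist_eq, sub_zero, abs_mul, abs_of_pos hρ]
      refine max_lt (max_lt (hv.trans hρa) (lt_of_le_of_lt ?_ hρa)) ?_
      · nlinarith
      · refine lt_of_le_of_lt ((ContinuousMap.dist_le dist_nonneg).2 fun t => ?_) (hb' hd).2
        exact ContinuousMap.dist_apply_le_dist (f := Y (v, ρ)) (g := .const _ y₀) (scaleIcc r t)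
    have h3 := ha' h2 h1
    have h4 := congrArg (fun f : C(Icc (-1 : ℝ) 1, E) => f ⟨1, one_mem⟩) h3
    refine h4.trans ?_
    simp [scaleIcc]
  have hYev : ∀ᶠ x in 𝓝 (v₀, (0 : ℝ)), ContDiffAt ℝ ∞ Y x :=
    eventually_contDiffAt_implicitFunction (contDiff_picardDefect Fc hF s₀ y₀) hinv
  have hshift : Tendsto (fun z : V × ℝ => (z.1, z.2 - s₀)) (𝓝 (v₀, s₀)) (𝓝 (v₀, 0)) := by
    have : Continuous (fun z : V × ℝ => (z.1, z.2 - s₀)) := by fun_prop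
    simpa using this.tendsto (v₀, s₀)
  -- The value at time `s` is the end point of the rescaled curve of length `s - s₀`, so joint
  -- smoothness comes from `Y`. For the equation, `key` replaces this varying curve by the single
  -- curve `Y (v, ρ)`, which satisfies an integral equation.
  refine ⟨fun z => Y (z.1, z.2 - s₀) ⟨1, one_mem⟩, by simp [hY0], ?_⟩
  filter_upwards [Metric.ball_mem_nhds (v₀, s₀) hρ, hshift.eventually hYev] with z hz hYz
  constructor
  · have h1 : ContDiffAt ℝ ∞ (fun z : V × ℝ => Y (z.1, z.2 - s₀)) z :=
      ContDiffAt.comp (g := Y) _ hYz (contDiffAt_fst.prodMk (contDiffAt_snd.sub contDiffAt_const))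
    exact (ContinuousMap.evalCLM ℝ (⟨1, one_mem⟩ : Icc (-1 : ℝ) 1)).contDiff.contDiffAt.comp _ h1
  · clear hYz
    rw [Metric.mem_ball, Prod.dist_eq, max_lt_iff, Real.dist_eq] at hz
    have hd : dist (z.1, ρ) (v₀, (0 : ℝ)) < b := by
      rw [Prod.dist_eq, Real.dist_eq, sub_zero, abs_of_pos hρ]
      exact max_lt (hz.1.trans hρb) hρb
    have hsol := (hb' hd).1
    have hin : ∀ s : ℝ, |s - s₀| < ρ → (s - s₀) / ρ ∈ Icc (-1 : ℝ) 1 := fun s hs => by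
      rw [mem_Icc, ← abs_le, abs_div, abs_of_pos hρ]
      exact (div_le_one hρ).2 hs.le
    have heq : ∀ s : ℝ, ∀ hs : |s - s₀| < ρ,
        Y (z.1, s - s₀) ⟨1, one_mem⟩ = Y (z.1, ρ) ⟨(s - s₀) / ρ, hin s hs⟩ := fun s hs => by
      rw [← key z.1 hz.1, div_mul_cancel₀ _ hρ.ne']
    let f := IccExtend (by norm_num : (-1 : ℝ) ≤ 1) (Fc.comp (graphCurve s₀ ((z.1, ρ), Y (z.1, ρ))))
    have hf : Continuous f := (ContinuousMap.continuous _).Icc_extend'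
    have hint : ∀ s : ℝ, |s - s₀| < ρ →
        Y (z.1, s - s₀) ⟨1, one_mem⟩ = y₀ + ρ • ∫ τ in (0 : ℝ)..(s - s₀) / ρ, f τ := fun s hs => by
      rw [heq s hs]
      have := congrArg (fun g : C(Icc (-1 : ℝ) 1, E) => g ⟨(s - s₀) / ρ, hin s hs⟩) hsol
      simp only [picardDefect, ContinuousMap.sub_apply, ContinuousMap.smul_apply,
        integralFromZero_apply, ContinuousMap.const_apply, ContinuousMap.zero_apply] at this
      rwa [sub_sub, sub_eq_zero] at this
    have h1 : HasDerivAt (fun s : ℝ => (s - s₀) / ρ) (1 / ρ) z.2 :=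
      ((hasDerivAt_id _).sub_const _).div_const _
    have h2 := ((hf.integral_hasStrictDerivAt 0 ((z.2 - s₀) / ρ)).hasDerivAt.scomp z.2 h1).const_smul ρ
    have h3 := h2.const_add y₀
    refine (h3.congr_of_eventuallyEq ?_).congr_deriv ?_
    · have : ∀ᶠ s in 𝓝 z.2, |s - s₀| < ρ :=
        (by fun_prop : Continuous fun s : ℝ => |s - s₀|).tendsto z.2 |>.eventually_lt_const hz.2
      filter_upwards [this] with s hs
      exact hint s hs
    · rw [smul_smul, mul_one_div_cancel hρ.ne', one_smul]
      simp only [f]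
      rw [IccExtend_of_mem _ _ (hin z.2 hz.2)]
      simp only [ContinuousMap.comp_apply, graphCurve, ContinuousMap.coe_mk, Fc]
      rw [heq z.2 hz.2, mul_div_cancel₀ _ hρ.ne', add_sub_cancel]

/-- Every open set around `x` contains the image of a smooth map which is the identity near `x`. -/
theorem exists_contDiff_shrink {W : Type*} [NormedAddCommGroup W] [NormedSpace ℝ W]
    [FiniteDimensional ℝ W] {u : Set W} (hu : IsOpen u) {x : W} (hx : x ∈ u) :
    ∃ f : W → W, ContDiff ℝ ∞ f ∧ (∀ y, f y ∈ u) ∧ ∀ᶠ y in 𝓝 x, f y = y := by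
  let L : W ≃L[ℝ] _ := toEuclidean (E := W)
  obtain ⟨f, hf, hfu, hfx⟩ := exists_smooth_shrink (hu.preimage L.symm.continuous)
    (x := L x) (by simpa using hx)
  refine ⟨fun y => L.symm (f (L y)), L.symm.contDiff.comp (hf.comp L.contDiff), fun y => hfu _, ?_⟩
  filter_upwards [L.continuous.tendsto x |>.eventually hfx] with y hy
  rw [hy, L.symm_apply_apply]

/-- Local existence of solutions of ordinary differential equations, with smooth dependence on
parameters. -/
theorem exists_smooth_solution {V : Type} [NormedAddCommGroup V] [NormedSpace ℝ V]
    [FiniteDimensional ℝ V] {E : Type*} [NormedAddCommGroup E] [NormedSpace ℝ E]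
    [FiniteDimensional ℝ E] (F : (V × ℝ) × E → E) (v₀ : V) (s₀ : ℝ) (y₀ : E)
    {u : Set ((V × ℝ) × E)} (hu : IsOpen u) (hmem : ((v₀, s₀), y₀) ∈ u) (hF : ContDiffOn ℝ ∞ F u) :
    ∃ y : V × ℝ → E, y (v₀, s₀) = y₀ ∧
      ∀ᶠ z in 𝓝 (v₀, s₀), ContDiffAt ℝ ∞ y z ∧ HasDerivAt (fun s => y (z.1, s)) (F (z, y z)) z.2 := by
  -- Composing with `f` makes `F` globally smooth without changing it near the initial point. The
  -- Euclidean model `L` moves `E` to the universe of the preceding result.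
  obtain ⟨f, hf, hfu, hfx⟩ := exists_contDiff_shrink hu hmem
  let L : E ≃L[ℝ] _ := toEuclidean (E := E)
  obtain ⟨y, hy0, hyd⟩ := exists_smooth_solution_of_contDiff
    (fun w => L (F (f (w.1, L.symm w.2)))) (L.contDiff.comp (contDiffOn_univ.1
      (hF.comp (t := u) (hf.comp (contDiff_fst.prodMk (L.symm.contDiff.comp contDiff_snd))).contDiffOn
        (fun _ _ => hfu _)))) v₀ s₀ (L y₀)
  refine ⟨fun z => L.symm (y z), by simp [hy0], ?_⟩
  have ht : Tendsto (fun z => (z, L.symm (y z))) (𝓝 (v₀, s₀)) (𝓝 ((v₀, s₀), y₀)) := by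
    have := (continuousAt_id.prodMk
      (L.symm.continuous.continuousAt.comp hyd.self_of_nhds.1.continuousAt)).tendsto
    simpa [hy0] using this
  filter_upwards [hyd, ht.eventually hfx] with z hz hfz
  refine ⟨L.symm.contDiff.contDiffAt.comp _ hz.1, ?_⟩
  have := L.symm.hasFDerivAt.comp_hasDerivAt z.2 hz.2
  rw [hfz] at this
  refine this.congr_deriv ?_
  simp

end Flow
end SymExt

namespace SymExt
-- Local sections, fibre coordinates and the division map of a principal bundle.
section Bundle

variable {EH EM EP H M P : Type*}
  [NormedAddCommGroup EH] [NormedSpace ℝ EH]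
  [NormedAddCommGroup EM] [NormedSpace ℝ EM]
  [NormedAddCommGroup EP] [NormedSpace ℝ EP]
  [TopologicalSpace H] [ChartedSpace EH H] [Group H]
  [TopologicalSpace M] [ChartedSpace EM M]
  [TopologicalSpace P] [ChartedSpace EP P]

namespace PrincipalBundle

variable (B : PrincipalBundle EH EM EP H M P)

/-- Local sections of a principal bundle and the corresponding local fibre coordinates. -/
theorem exists_local (x : M) : ∃ (U : Set M) (s : M → P) (τ : P → H), IsOpen U ∧ x ∈ U ∧
    ContMDiffOn 𝓘(ℝ, EM) 𝓘(ℝ, EP) ∞ s U ∧ ContMDiffOn 𝓘(ℝ, EP) 𝓘(ℝ, EH) ∞ τ (B.proj ⁻¹' U) ∧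
    (∀ y ∈ U, B.proj (s y) = y) ∧ (∀ p, B.proj p ∈ U → ∀ h, τ (B.act p h) = τ p * h) ∧
    ∀ p, B.proj p ∈ U → B.act (s (B.proj p)) (τ p) = p := by
  obtain ⟨U, e, hU, hx, hes, het, he, hes', hep, hea⟩ := B.locally_trivial x
  have htgt : ∀ y ∈ U, (y, (1 : H)) ∈ e.target := fun y hy => by rw [het]; exact ⟨hy, mem_univ _⟩
  have hs : ∀ y ∈ U, B.proj (e.symm (y, 1)) = y := fun y hy => by
    rw [← hep _ (e.map_target (htgt y hy)), e.right_inv (htgt y hy)]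
  refine ⟨U, fun y => e.symm (y, 1), fun p => (e p).2, hU, hx, ?_, ?_, hs, ?_, ?_⟩
  · exact hes'.comp (contMDiff_id.prodMk contMDiff_const).contMDiffOn htgt
  · rw [← hes]
    exact contMDiff_snd.comp_contMDiffOn he
  · intro p hp h
    exact hea p (by rw [hes]; exact hp) h
  · intro p hp
    have hp' : p ∈ e.source := by rw [hes]; exact hp
    have hq : e.symm (B.proj p, 1) ∈ e.source := e.map_target (htgt _ hp)
    refine e.injOn ?_ hp' (Prod.ext ?_ ?_)
    · rw [hes, mem_preimage, B.proj_act, hs _ hp]; exact hp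
    · rw [hep, hep p hp', B.proj_act, hs _ hp]
      rw [hes, mem_preimage, B.proj_act, hs _ hp]; exact hp
    · rw [hea _ hq, e.right_inv (htgt _ hp), one_mul]

/-- A fibre coordinate turns the action into right multiplication in `H`, which is free. -/
theorem act_injective (p : P) {h k : H} (e : B.act p h = B.act p k) : h = k := by
  obtain ⟨U, s, τ, -, hx, -, -, -, hτ, -⟩ := B.exists_local (B.proj p)
  have := congrArg τ e
  rwa [hτ p hx, hτ p hx, mul_right_inj] at this

theorem exists_act_eq {p q : P} (e : B.proj p = B.proj q) : ∃ h, B.act p h = q := by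
  obtain ⟨U, s, τ, -, hx, -, -, -, hτ, hs⟩ := B.exists_local (B.proj p)
  refine ⟨(τ p)⁻¹ * τ q, ?_⟩
  nth_rw 1 [← hs p hx]
  rw [← B.act_mul, mul_inv_cancel_left, e, hs q (e ▸ hx)]

open Classical in
/-- For `p` and `q` in the same fibre, the element of the structure group which takes `p` to `q`. -/
noncomputable def div (p q : P) : H := if e : B.proj p = B.proj q then (B.exists_act_eq e).choose else 1

theorem act_div {p q : P} (e : B.proj p = B.proj q) : B.act p (B.div p q) = q := by
  rw [div, dif_pos e]
  exact (B.exists_act_eq e).choose_spec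

theorem div_act (p : P) (h : H) : B.div p (B.act p h) = h :=
  B.act_injective p (B.act_div (B.proj_act p h).symm)

section Smooth

variable {EN HN N : Type*} [NormedAddCommGroup EN] [NormedSpace ℝ EN] [TopologicalSpace HN]
  {I : ModelWithCorners ℝ EN HN} [TopologicalSpace N] [ChartedSpace HN N]

theorem contMDiffWithinAt_act {a : N → P} {h : N → H} {S : Set N} {x : N}
    (ha : ContMDiffWithinAt I 𝓘(ℝ, EP) ∞ a S x) (hh : ContMDiffWithinAt I 𝓘(ℝ, EH) ∞ h S x) :
    ContMDiffWithinAt I 𝓘(ℝ, EP) ∞ (fun y => B.act (a y) (h y)) S x :=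
  B.act_smooth.contMDiffAt.comp_contMDiffWithinAt x (ha.prodMk hh)

/-- In a local fibre coordinate `τ` the division map is `(τ a)⁻¹ * τ b`. -/
theorem contMDiffWithinAt_div [LieGroup 𝓘(ℝ, EH) ∞ H] {a b : N → P} {S : Set N} {x : N} (hx : x ∈ S)
    (ha : ContMDiffWithinAt I 𝓘(ℝ, EP) ∞ a S x) (hb : ContMDiffWithinAt I 𝓘(ℝ, EP) ∞ b S x)
    (hab : ∀ y ∈ S, B.proj (a y) = B.proj (b y)) :
    ContMDiffWithinAt I 𝓘(ℝ, EH) ∞ (fun y => B.div (a y) (b y)) S x := by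
  obtain ⟨U, s, τ, hU, hxU, -, hτs, -, hτ, hs⟩ := B.exists_local (B.proj (a x))
  have hUo : IsOpen (B.proj ⁻¹' U) := hU.preimage B.proj_smooth.continuous
  have h1 : ContMDiffWithinAt I 𝓘(ℝ, EH) ∞ (fun y => (τ (a y))⁻¹ * τ (b y)) S x :=
    ((hτs.contMDiffAt (hUo.mem_nhds hxU)).comp_contMDiffWithinAt x ha).inv.mul
      ((hτs.contMDiffAt (hUo.mem_nhds (by
        change B.proj (b x) ∈ U; rw [← hab x hx]; exact hxU))).comp_contMDiffWithinAt x hb)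
  have h2 : ∀ y ∈ S, B.proj (a y) ∈ U → B.div (a y) (b y) = (τ (a y))⁻¹ * τ (b y) := by
    intro y hy hyU
    rw [eq_inv_mul_iff_mul_eq, ← hτ _ hyU, B.act_div (hab y hy)]
  refine h1.congr_of_eventuallyEq ?_ (h2 x hx hxU)
  filter_upwards [self_mem_nhdsWithin, ha.continuousWithinAt (hUo.mem_nhds hxU)] with y hy hyU
  exact h2 y hy hyU

end Smooth
end PrincipalBundle
end Bundle
end SymExt

namespace SymExt
-- Horizontal curves and their uniqueness.
section Horizontal

variable {EH EM EP H M P : Type*}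
  [NormedAddCommGroup EH] [NormedSpace ℝ EH]
  [NormedAddCommGroup EM] [NormedSpace ℝ EM]
  [NormedAddCommGroup EP] [NormedSpace ℝ EP]
  [TopologicalSpace H] [ChartedSpace EH H] [Group H]
  [TopologicalSpace M] [ChartedSpace EM M]
  [TopologicalSpace P] [ChartedSpace EP P]

omit [Group H] in
/-- A curve in a manifold with vanishing derivative is constant. -/
theorem eq_of_hasMFDerivWithinAt_zero [IsManifold 𝓘(ℝ, EH) 1 H] {h : ℝ → H} {S : Set ℝ}
    (hS : Convex ℝ S)
    (hh : ∀ t ∈ S, HasMFDerivWithinAt 𝓘(ℝ, ℝ) 𝓘(ℝ, EH) h S t 0) {a b : ℝ} (ha : a ∈ S)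
    (hb : b ∈ S) : h a = h b := by
  have hloc : IsLocallyConstant (S.domRestrict h) := by
    refine (IsLocallyConstant.iff_eventually_eq _).2 fun t => ?_
    have hc : ContinuousWithinAt h S t := (hh t t.2).continuousWithinAt
    have hmem : ∀ᶠ y in 𝓝[S] (t : ℝ), h y ∈ (extChartAt 𝓘(ℝ, EH) (h t)).source :=
      hc (extChartAt_source_mem_nhds _)
    obtain ⟨ε, hε, hball⟩ := Metric.mem_nhdsWithin_iff.1 hmem
    have hd : ∀ y ∈ Metric.ball (t : ℝ) ε ∩ S, HasFDerivWithinAt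
        (fun y => extChartAt 𝓘(ℝ, EH) (h t) (h y)) (0 : ℝ →L[ℝ] EH) (Metric.ball (t : ℝ) ε ∩ S) y := by
      intro y hy
      have hy' := hball hy
      have h1 := (mdifferentiableAt_extChartAt (I := 𝓘(ℝ, EH)) (x := h t) (y := h y)
        (by simpa using hy')).hasMFDerivAt.comp_hasMFDerivWithinAt y (hh y hy.2)
      have h2 := h1.mono (t := S) (s := Metric.ball (t : ℝ) ε ∩ S) inter_subset_right
      rw [ContinuousLinearMap.comp_zero] at h2
      exact hasMFDerivWithinAt_iff_hasFDerivWithinAt.1 h2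
    have hconv : Convex ℝ (Metric.ball (t : ℝ) ε ∩ S) := (convex_ball _ _).inter hS
    have hnear : ∀ᶠ y : S in 𝓝 t, (y : ℝ) ∈ Metric.ball (t : ℝ) ε :=
      continuous_subtype_val.tendsto t |>.eventually (Metric.ball_mem_nhds _ hε)
    filter_upwards [hnear] with y hy
    have htb : (t : ℝ) ∈ Metric.ball (t : ℝ) ε ∩ S := ⟨Metric.mem_ball_self hε, t.2⟩
    have := hconv.norm_image_sub_le_of_norm_hasFDerivWithin_le (C := 0) hd (by simp) htb ⟨hy, y.2⟩
    rw [zero_mul, norm_le_zero_iff, sub_eq_zero] at this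
    exact (extChartAt 𝓘(ℝ, EH) (h t)).injOn (hball ⟨hy, y.2⟩) (hball htb) this
  have : PreconnectedSpace S := isPreconnected_iff_preconnectedSpace.1 hS.isPreconnected
  exact hloc.apply_eq_of_preconnectedSpace ⟨a, ha⟩ ⟨b, hb⟩

variable [IsManifold 𝓘(ℝ, EP) ∞ P] {B : PrincipalBundle EH EM EP H M P}

/-- The identity `ρ^* A = Ad_{h⁻¹} (A) + θ` evaluated on the velocity of `t ↦ (σ t, h t)`.
Quantifying over a derivative `d` avoids requiring unique derivatives within `S`. -/
theorem form_hasMFDerivWithinAt_act (A : Connection B) {σ : ℝ → P} {h : ℝ → H} {S : Set ℝ} {t : ℝ}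
    {σ' : TangentSpace 𝓘(ℝ, ℝ) t →L[ℝ] TangentSpace 𝓘(ℝ, EP) (σ t)}
    {h' : TangentSpace 𝓘(ℝ, ℝ) t →L[ℝ] TangentSpace 𝓘(ℝ, EH) (h t)}
    (hσ : HasMFDerivWithinAt 𝓘(ℝ, ℝ) 𝓘(ℝ, EP) σ S t σ')
    (hh : HasMFDerivWithinAt 𝓘(ℝ, ℝ) 𝓘(ℝ, EH) h S t h') :
    ∃ d : TangentSpace 𝓘(ℝ, ℝ) t →L[ℝ] TangentSpace 𝓘(ℝ, EP) (B.act (σ t) (h t)),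
      HasMFDerivWithinAt 𝓘(ℝ, ℝ) 𝓘(ℝ, EP) (fun t => B.act (σ t) (h t)) S t d ∧
      A.form (B.act (σ t) (h t)) (d (1 : ℝ)) =
        adInv EH (h t) (A.form (σ t) (σ' (1 : ℝ))) + maurerCartan EH (h t) (h' (1 : ℝ)) := by
  have h1 := ((B.act_smooth.mdifferentiable (by simp)) (σ t, h t)).hasMFDerivAt
  exact ⟨_, h1.comp_hasMFDerivWithinAt t (hσ.prodMk hh), A.equivariant _ _ _ _⟩

/-- The curve `σ` has a derivative at `t` within `S` which is annihilated by the connection form. -/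
def HorizontalAt (A : Connection B) (σ : ℝ → P) (S : Set ℝ) (t : ℝ) : Prop :=
  ∃ σ' : TangentSpace 𝓘(ℝ, ℝ) t →L[ℝ] TangentSpace 𝓘(ℝ, EP) (σ t),
    HasMFDerivWithinAt 𝓘(ℝ, ℝ) 𝓘(ℝ, EP) σ S t σ' ∧ A.form (σ t) (σ' (1 : ℝ)) = 0

namespace HorizontalAt

variable {A : Connection B} {σ τ : ℝ → P} {S T : Set ℝ} {t : ℝ}

theorem mono (h : HorizontalAt A σ S t) (hT : T ⊆ S) : HorizontalAt A σ T t := by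
  obtain ⟨σ', h1, h2⟩ := h
  exact ⟨σ', h1.mono hT, h2⟩

theorem congr (h : HorizontalAt A σ S t) (e : τ =ᶠ[𝓝[S] t] σ) (et : τ t = σ t) :
    HorizontalAt A τ S t := by
  obtain ⟨σ', h1, h2⟩ := h
  have h3 := h1.congr_of_eventuallyEq e et
  -- The type of `σ'` mentions the base point `σ t`, so `σ'` is generalized before that point is
  -- rewritten.
  revert h3 h2 σ'
  rw [← et]
  exact fun σ' _ h2 h3 => ⟨σ', h3, h2⟩

theorem act_const (h : HorizontalAt A σ S t) (k : H) :
    HorizontalAt A (fun t => B.act (σ t) k) S t := by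
  obtain ⟨σ', h1, h2⟩ := h
  obtain ⟨d, h3, h4⟩ := form_hasMFDerivWithinAt_act A h1 (hasMFDerivWithinAt_const k S t)
  refine ⟨d, h3, h4.trans ?_⟩
  rw [h2, map_zero, zero_add]
  exact map_zero _

/-- The chain rule multiplies the velocity by `q'`, and the form is linear. Since `q'` is arbitrary,
constant and reversed reparametrizations are covered. -/
theorem comp {q : ℝ → ℝ} {q' : ℝ} (h : HorizontalAt A σ S (q t)) (hq : HasDerivWithinAt q q' T t)
    (hm : MapsTo q T S) : HorizontalAt A (σ ∘ q) T t := by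
  obtain ⟨σ', h1, h2⟩ := h
  have h3 := h1.comp t (hasMFDerivWithinAt_iff_hasFDerivWithinAt.2 hq.hasFDerivWithinAt) hm
  refine ⟨_, h3, ?_⟩
  have h4 : ∀ c : ℝ, A.form (σ (q t)) (σ' c) = 0 := fun c => by
    have : (c : ℝ) = c • (1 : ℝ) := by simp
    rw [this]
    erw [map_smul, map_smul]
    rw [h2, smul_zero]
  exact h4 _

end HorizontalAt

/-- Left translation by `h` undoes left translation by `h⁻¹`. -/
theorem maurerCartan_injective [LieGroup 𝓘(ℝ, EH) ∞ H] (h : H) :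
    Function.Injective (maurerCartan EH h) := by
  have h1 : MDifferentiable 𝓘(ℝ, EH) 𝓘(ℝ, EH) (fun k : H => h⁻¹ * k) :=
    (contMDiff_mul_left (n := ∞)).mdifferentiable (by simp)
  have h2 : MDifferentiable 𝓘(ℝ, EH) 𝓘(ℝ, EH) (fun k : H => h * k) :=
    (contMDiff_mul_left (n := ∞)).mdifferentiable (by simp)
  have h3 := mfderiv_comp h (h2 (h⁻¹ * h)) (h1 h)
  have h4 : (fun k : H => h * k) ∘ (fun k : H => h⁻¹ * k) = id := by
    funext k; simp
  rw [h4, mfderiv_id] at h3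
  intro v w hvw
  have h5 := congrArg (mfderiv 𝓘(ℝ, EH) 𝓘(ℝ, EH) (fun k : H => h * k) (h⁻¹ * h)) hvw
  have h6 := fun v => DFunLike.congr_fun h3 v
  exact (h6 v).trans (h5.trans (h6 w).symm)

/-- Two horizontal curves with the same projection differ by a constant element of the structure
group. -/
theorem div_eq_of_horizontal [LieGroup 𝓘(ℝ, EH) ∞ H] {A : Connection B} {σ τ : ℝ → P} {S : Set ℝ}
    (hS : Convex ℝ S) (hSu : UniqueDiffOn ℝ S)
    (hσs : ContMDiffOn 𝓘(ℝ, ℝ) 𝓘(ℝ, EP) ∞ σ S) (hτs : ContMDiffOn 𝓘(ℝ, ℝ) 𝓘(ℝ, EP) ∞ τ S)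
    (hσ : ∀ t ∈ S, HorizontalAt A σ S t) (hτ : ∀ t ∈ S, HorizontalAt A τ S t)
    (e : ∀ t ∈ S, B.proj (σ t) = B.proj (τ t)) {a b : ℝ} (ha : a ∈ S) (hb : b ∈ S) :
    B.div (σ a) (τ a) = B.div (σ b) (τ b) := by
  have : IsManifold 𝓘(ℝ, EH) 1 H := .of_le (n := ∞) (by simp)
  have hd : ContMDiffOn 𝓘(ℝ, ℝ) 𝓘(ℝ, EH) ∞ (fun t => B.div (σ t) (τ t)) S :=
    fun t ht => B.contMDiffWithinAt_div ht (hσs t ht) (hτs t ht) e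
  refine eq_of_hasMFDerivWithinAt_zero (EH := EH) (h := fun t => B.div (σ t) (τ t)) hS
    (fun t ht => ?_) ha hb
  have hdt := ((hd t ht).mdifferentiableWithinAt (by simp)).hasMFDerivWithinAt
  obtain ⟨σ', hσ1, hσ2⟩ := hσ t ht
  obtain ⟨τ', hτ1, hτ2⟩ := hτ t ht
  obtain ⟨d, hd1, hd2⟩ := form_hasMFDerivWithinAt_act A hσ1 hdt
  rw [hσ2, map_zero, zero_add] at hd2
  have hact : ∀ t ∈ S, B.act (σ t) (B.div (σ t) (τ t)) = τ t := fun t ht => B.act_div (e t ht)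
  -- With `τ = σ · g`, the connection identity reads `A(τ') = Ad(A(σ')) + θ(g')`. Both curves are
  -- horizontal, so `θ(g') = 0`, and injectivity of `θ` gives `g' = 0`.
  have h0 : maurerCartan EH (B.div (σ t) (τ t))
      (mfderivWithin 𝓘(ℝ, ℝ) 𝓘(ℝ, EH) (fun t => B.div (σ t) (τ t)) S t (1 : ℝ)) = 0 := by
    have h1 := hd1.congr_of_eventuallyEq (f₁ := τ) (by
      filter_upwards [self_mem_nhdsWithin] with y hy using (hact y hy).symm) (hact t ht).symm
    rw [← hd2]
    revert hd1 hd2 h1 d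
    rw [hact t ht]
    intro d _ _ h1
    rw [← hτ2]
    have hu : UniqueMDiffWithinAt 𝓘(ℝ, ℝ) S t := (hSu t ht).uniqueMDiffWithinAt
    rw [← h1.mfderivWithin hu, ← hτ1.mfderivWithin hu]
  have h0' := maurerCartan_injective _ (h0.trans (map_zero _).symm)
  have : mfderivWithin 𝓘(ℝ, ℝ) 𝓘(ℝ, EH) (fun t => B.div (σ t) (τ t)) S t = 0 := by
    refine ContinuousLinearMap.ext_ring ?_
    exact h0'
  rw [← this]
  exact hdt

theorem eqOn_of_horizontal [LieGroup 𝓘(ℝ, EH) ∞ H] {A : Connection B} {σ τ : ℝ → P} {S : Set ℝ}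
    (hS : Convex ℝ S) (hSu : UniqueDiffOn ℝ S)
    (hσs : ContMDiffOn 𝓘(ℝ, ℝ) 𝓘(ℝ, EP) ∞ σ S) (hτs : ContMDiffOn 𝓘(ℝ, ℝ) 𝓘(ℝ, EP) ∞ τ S)
    (hσ : ∀ t ∈ S, HorizontalAt A σ S t) (hτ : ∀ t ∈ S, HorizontalAt A τ S t)
    (e : ∀ t ∈ S, B.proj (σ t) = B.proj (τ t)) {a : ℝ} (ha : a ∈ S) (hστ : σ a = τ a) :
    EqOn σ τ S := by
  intro t ht
  have h1 := div_eq_of_horizontal hS hSu hσs hτs hσ hτ e ha ht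
  have h2 : B.div (σ a) (σ a) = 1 := by simpa only [B.act_one] using B.div_act (σ a) 1
  rw [← hστ, h2] at h1
  rw [← B.act_div (e t ht), ← h1, B.act_one]

end Horizontal
end SymExt

namespace SymExt
-- Local horizontal lifts as solutions of a differential equation on `H`.
section LocalLift

variable {EH EM EP H M P : Type*}
  [NormedAddCommGroup EH] [NormedSpace ℝ EH]
  [NormedAddCommGroup EM] [NormedSpace ℝ EM]
  [NormedAddCommGroup EP] [NormedSpace ℝ EP]
  [TopologicalSpace H] [ChartedSpace EH H] [Group H]
  [TopologicalSpace M] [ChartedSpace EM M]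
  [TopologicalSpace P] [ChartedSpace EP P]

/-- The generator, in the chart at `1`, of the left translations by elements near `1`. -/
noncomputable def chartGenerator (EH : Type*) {H : Type*} [NormedAddCommGroup EH] [NormedSpace ℝ EH]
    [TopologicalSpace H] [ChartedSpace EH H] [Group H] (y : EH) : EH →L[ℝ] EH :=
  fderiv ℝ (fun w => extChartAt 𝓘(ℝ, EH) (1 : H)
    ((extChartAt 𝓘(ℝ, EH) (1 : H)).symm w * (extChartAt 𝓘(ℝ, EH) (1 : H)).symm y))
    (extChartAt 𝓘(ℝ, EH) (1 : H) 1)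

section
variable [LieGroup 𝓘(ℝ, EH) ∞ H]

theorem contDiffAt_chart_mul {y : EH} (hy : y ∈ (extChartAt 𝓘(ℝ, EH) (1 : H)).target) :
    ContDiffAt ℝ ∞ (fun z : EH × EH => extChartAt 𝓘(ℝ, EH) (1 : H)
      ((extChartAt 𝓘(ℝ, EH) (1 : H)).symm z.2 * (extChartAt 𝓘(ℝ, EH) (1 : H)).symm z.1))
      (y, extChartAt 𝓘(ℝ, EH) (1 : H) 1) := by
  have : IsManifold 𝓘(ℝ, EH) ∞ H := inferInstance
  set ψ := extChartAt 𝓘(ℝ, EH) (1 : H)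
  have ht : IsOpen ψ.target := isOpen_extChartAt_target _
  have h1t : ψ 1 ∈ ψ.target := mem_extChartAt_target _
  rw [← contMDiffAt_iff_contDiffAt]
  have hsymm : ContMDiffOn 𝓘(ℝ, EH) 𝓘(ℝ, EH) ∞ ψ.symm ψ.target := contMDiffOn_extChartAt_symm _
  have hs1 : ContMDiffAt 𝓘(ℝ, EH × EH) 𝓘(ℝ, EH) ∞ (fun z : EH × EH => ψ.symm z.2) (y, ψ 1) :=
    (hsymm.contMDiffAt (ht.mem_nhds h1t)).comp (y, ψ 1) contDiffAt_snd.contMDiffAt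
  have hs2 : ContMDiffAt 𝓘(ℝ, EH × EH) 𝓘(ℝ, EH) ∞ (fun z : EH × EH => ψ.symm z.1) (y, ψ 1) :=
    (hsymm.contMDiffAt (ht.mem_nhds hy)).comp (y, ψ 1) contDiffAt_fst.contMDiffAt
  refine ContMDiffAt.comp (I' := 𝓘(ℝ, EH)) (y, ψ 1) (g := ψ)
    (f := fun z : EH × EH => ψ.symm z.2 * ψ.symm z.1) ?_ (hs1.mul hs2)
  refine contMDiffAt_extChartAt' ?_
  have h3 : ψ.symm (ψ 1) = 1 := extChartAt_to_inv _
  rw [h3, one_mul, ← extChartAt_source 𝓘(ℝ, EH)]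
  exact ψ.map_target hy

theorem contDiffOn_chartGenerator :
    ContDiffOn ℝ ∞ (chartGenerator EH (H := H)) (extChartAt 𝓘(ℝ, EH) (1 : H)).target :=
  fun _ hy => (ContDiffAt.fderiv (n := ∞) (contDiffAt_chart_mul hy)
    contDiffAt_const (by simp)).contDiffWithinAt

-- Tangent spaces at different points all unfold to `EH`; this moves base points along an equality
-- without casts.
omit [Group H] [LieGroup 𝓘(ℝ, EH) ∞ H] in
theorem mfderiv_apply_congr {f : H → H} {x y : H} (e : x = y) (v : EH) :
    (mfderiv 𝓘(ℝ, EH) 𝓘(ℝ, EH) f x v : EH) = mfderiv 𝓘(ℝ, EH) 𝓘(ℝ, EH) f y v := by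
  subst e; rfl

/-- Differentiate `ψ.symm (G w) = ψ.symm w * h` at `w = ψ 1`, where the derivative of the inverse
chart is the identity. Thus `chartGenerator` is the chart expression of the right-invariant vector
fields. -/
theorem chartGenerator_eq {y : EH} (hy : y ∈ (extChartAt 𝓘(ℝ, EH) (1 : H)).target) (a : EH) :
    (mfderiv 𝓘(ℝ, EH) 𝓘(ℝ, EH) (extChartAt 𝓘(ℝ, EH) (1 : H)).symm y
      (chartGenerator EH (H := H) y a) : EH) =
    mfderiv 𝓘(ℝ, EH) 𝓘(ℝ, EH)
      (fun k : H => k * (extChartAt 𝓘(ℝ, EH) (1 : H)).symm y) 1 a := by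
  have : IsManifold 𝓘(ℝ, EH) 1 H := .of_le (n := ∞) (by simp)
  set ψ := extChartAt 𝓘(ℝ, EH) (1 : H) with hψ
  have h1t : ψ 1 ∈ ψ.target := mem_extChartAt_target _
  have ht : IsOpen ψ.target := isOpen_extChartAt_target _
  have h3 : ψ.symm (ψ 1) = 1 := extChartAt_to_inv _
  have hsd : ∀ z ∈ ψ.target, HasMFDerivAt 𝓘(ℝ, EH) 𝓘(ℝ, EH) ψ.symm z
      (mfderiv 𝓘(ℝ, EH) 𝓘(ℝ, EH) ψ.symm z) := fun z hz =>
    ((mdifferentiableWithinAt_extChartAt_symm hz).mdifferentiableAt (by simp)).hasMFDerivAt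
  have hid : mfderiv 𝓘(ℝ, EH) 𝓘(ℝ, EH) ψ.symm (ψ 1) a = a := by
    have := mfderivWithin_range_extChartAt_symm (I := 𝓘(ℝ, EH)) (x := (1 : H))
    rw [modelWithCornersSelf_coe, range_id, mfderivWithin_univ] at this
    exact DFunLike.congr_fun this a
  let h := ψ.symm y
  let G : EH → EH := fun w => ψ (ψ.symm w * h)
  have hG1 : G (ψ 1) = y := by simp only [G, h, h3, one_mul]; exact ψ.right_inv hy
  have hGd : HasMFDerivAt 𝓘(ℝ, EH) 𝓘(ℝ, EH) G (ψ 1) (chartGenerator EH (H := H) y) :=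
    hasMFDerivAt_iff_hasFDerivAt.2 (((contDiffAt_chart_mul hy).comp (ψ 1)
      (contDiffAt_const.prodMk contDiffAt_id)).differentiableAt (by simp)).hasFDerivAt
  have hR : MDifferentiable 𝓘(ℝ, EH) 𝓘(ℝ, EH) (fun k : H => k * h) :=
    (contMDiff_mul_right (n := ∞)).mdifferentiable (by simp)
  have e1 := (hsd (G (ψ 1)) (by rw [hG1]; exact hy)).comp (ψ 1) hGd
  have e2 := (hR (ψ.symm (ψ 1))).hasMFDerivAt.comp (ψ 1) (hsd _ h1t)
  have hev : ψ.symm ∘ G =ᶠ[𝓝 (ψ 1)] (fun k : H => k * h) ∘ ψ.symm := by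
    have hs : (fun k : H => k * h) (ψ.symm (ψ 1)) ∈ ψ.source := by
      rw [h3]
      simpa only [one_mul] using ψ.map_target hy
    filter_upwards [e2.continuousAt.preimage_mem_nhds
      ((isOpen_extChartAt_source (1 : H)).mem_nhds hs)] with w hw
    exact ψ.left_inv hw
  have e3 := hasMFDerivAt_unique e1 (e2.congr_of_eventuallyEq hev)
  have e4 := DFunLike.congr_fun e3 a
  have e5 : ∀ z, z = y → ∀ v : EH, (mfderiv 𝓘(ℝ, EH) 𝓘(ℝ, EH) ψ.symm z v : EH) =
      mfderiv 𝓘(ℝ, EH) 𝓘(ℝ, EH) ψ.symm y v := by rintro z rfl v; rfl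
  refine (e5 _ hG1 _).symm.trans (e4.trans ?_)
  refine (mfderiv_apply_congr h3 _).trans ?_
  exact congrArg (fun v : EH => (mfderiv 𝓘(ℝ, EH) 𝓘(ℝ, EH) (fun k : H => k * h) 1 v : EH)) hid

/-- Translating `k * h` by `h⁻¹` on the left is conjugation, so `θ` of a right-invariant field is
`Ad_{h⁻¹}` of its value at `1`. -/
theorem maurerCartan_mul_right (h : H) (a : EH) :
    (maurerCartan EH h (mfderiv 𝓘(ℝ, EH) 𝓘(ℝ, EH) (fun k : H => k * h) 1 a : EH) : EH) =
      adInv EH h a := by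
  have h1 : MDifferentiable 𝓘(ℝ, EH) 𝓘(ℝ, EH) (fun k : H => h⁻¹ * k) :=
    (contMDiff_mul_left (n := ∞)).mdifferentiable (by simp)
  have h2 : MDifferentiable 𝓘(ℝ, EH) 𝓘(ℝ, EH) (fun k : H => k * h) :=
    (contMDiff_mul_right (n := ∞)).mdifferentiable (by simp)
  have h3 := mfderiv_comp (1 : H) (h1 (1 * h)) (h2 1)
  have h4 : (fun k : H => h⁻¹ * k) ∘ (fun k : H => k * h) = fun k => h⁻¹ * k * h := by
    funext k; simp [mul_assoc]
  rw [h4] at h3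
  rw [adInv, h3]
  exact (mfderiv_apply_congr (one_mul h) _).symm
end

variable [IsManifold 𝓘(ℝ, EP) ∞ P] {B : PrincipalBundle EH EM EP H M P}

theorem contDiff_form_mfderiv (A : Connection B) {W : Type*} [NormedAddCommGroup W] [NormedSpace ℝ W]
    {S : W → P} (hS : ContMDiff 𝓘(ℝ, W) 𝓘(ℝ, EP) ∞ S) (w : W) :
    ContDiff ℝ ∞ (F := EH) (fun z => (A.form (S z) (mfderiv 𝓘(ℝ, W) 𝓘(ℝ, EP) S z w) : EH)) := by
  refine contMDiff_iff_contDiff.1 ?_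
  have h1 : ContMDiff 𝓘(ℝ, W).tangent 𝓘(ℝ, EP).tangent ∞ (tangentMap 𝓘(ℝ, W) 𝓘(ℝ, EP) S) :=
    hS.contMDiff_tangentMap (by simp)
  have h2 : ContMDiff 𝓘(ℝ, W) 𝓘(ℝ, W).tangent ∞ (fun z : W => (⟨z, w⟩ : TangentBundle 𝓘(ℝ, W) W)) :=
    contMDiff_vectorSpace_iff_contDiff.2 contDiff_const
  exact A.smooth.comp (h1.comp h2)

/-- Existence of local horizontal lifts of a family of curves, depending smoothly on parameters. -/
theorem exists_local_horizontal [LieGroup 𝓘(ℝ, EH) ∞ H] [FiniteDimensional ℝ EH]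
    (A : Connection B) {V : Type} [NormedAddCommGroup V] [NormedSpace ℝ V] [FiniteDimensional ℝ V]
    {c : V × ℝ → M} (hc : ContMDiff 𝓘(ℝ, V × ℝ) 𝓘(ℝ, EM) ∞ c) (z₀ : V × ℝ) :
    ∃ τ : V × ℝ → P, ∀ᶠ z in 𝓝 z₀, ContMDiffAt 𝓘(ℝ, V × ℝ) 𝓘(ℝ, EP) ∞ τ z ∧
      B.proj (τ z) = c z ∧ HorizontalAt A (fun s => τ (z.1, s)) univ z.2 := by
  have : IsManifold 𝓘(ℝ, EH) ∞ H := inferInstance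
  obtain ⟨v₀, s₀⟩ := z₀
  obtain ⟨U, s, -, hU, hx, hs, -, hps, -, -⟩ := B.exists_local (c (v₀, s₀))
  obtain ⟨f, hf, hfu, hfx⟩ := exists_contDiff_shrink (hU.preimage hc.continuous) hx
  let S : V × ℝ → P := fun z => s (c (f z))
  have hS : ContMDiff 𝓘(ℝ, V × ℝ) 𝓘(ℝ, EP) ∞ S :=
    contMDiffOn_univ.1 (hs.comp (hc.comp hf.contMDiff).contMDiffOn fun z _ => hfu z)
  let a : V × ℝ → EH := fun z => A.form (S z) (mfderiv 𝓘(ℝ, V × ℝ) 𝓘(ℝ, EP) S z ((0 : V), (1 : ℝ)))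
  have ha : ContDiff ℝ ∞ a := contDiff_form_mfderiv A hS ((0 : V), (1 : ℝ))
  set ψ := extChartAt 𝓘(ℝ, EH) (1 : H) with hψ
  have ht : IsOpen ψ.target := isOpen_extChartAt_target _
  -- For a lift `S · h`, horizontality is `Ad_{h⁻¹} (a) + θ(h') = 0`. It is solved by the
  -- right-invariant equation with generator `-a`, written here in the chart at `1`, where the
  -- solution starts.
  let F : (V × ℝ) × EH → EH := fun w => -(chartGenerator EH (H := H) w.2 (a w.1))
  have hF : ContDiffOn ℝ ∞ F (univ ×ˢ ψ.target) :=
    ((contDiffOn_chartGenerator.comp contDiffOn_snd fun w hw => hw.2).clm_apply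
      (ha.comp contDiff_fst).contDiffOn).neg
  obtain ⟨y, hy0, hy⟩ := exists_smooth_solution F v₀ s₀ (ψ 1) (isOpen_univ.prod ht)
    ⟨mem_univ _, mem_extChartAt_target _⟩ hF
  have hyt : ∀ᶠ z in 𝓝 (v₀, s₀), y z ∈ ψ.target :=
    hy.self_of_nhds.1.continuousAt.preimage_mem_nhds (ht.mem_nhds (by
      rw [hy0]; exact mem_extChartAt_target _))
  have hsymm : ContMDiffOn 𝓘(ℝ, EH) 𝓘(ℝ, EH) ∞ ψ.symm ψ.target := contMDiffOn_extChartAt_symm _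
  refine ⟨fun z => B.act (S z) (ψ.symm (y z)), ?_⟩
  filter_upwards [hy, hyt, hfx] with z hz hzt hfz
  refine ⟨?_, ?_, ?_⟩
  · exact B.contMDiffWithinAt_act (hS z) ((hsymm.contMDiffAt (ht.mem_nhds hzt)).comp z
      hz.1.contMDiffAt)
  · rw [B.proj_act, hps _ (hfu z), hfz]
  · have h1 := HasMFDerivAt.comp (g := S) (f := fun s : ℝ => (z.1, s)) z.2
        ((hS.mdifferentiable (by simp)) z).hasMFDerivAt
        (hasMFDerivAt_iff_hasFDerivAt.2 (hasFDerivAt_prodMk_right z.1 z.2))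
    have h2 := HasMFDerivAt.comp (g := ψ.symm) (f := fun s : ℝ => y (z.1, s)) z.2
        ((hsymm.contMDiffAt (ht.mem_nhds hzt)).mdifferentiableAt (by simp)).hasMFDerivAt
        (hasMFDerivAt_iff_hasFDerivAt.2 hz.2.hasFDerivAt)
    obtain ⟨d, hd1, hd2⟩ := form_hasMFDerivWithinAt_act A h1.hasMFDerivWithinAt
      (h2.hasMFDerivWithinAt (s := univ))
    refine ⟨d, hd1, hd2.trans ?_⟩
    have h3 : (mfderiv 𝓘(ℝ, EH) 𝓘(ℝ, EH) ψ.symm (y z) ((1 : ℝ) • F (z, y z)) : EH) =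
        -(mfderiv 𝓘(ℝ, EH) 𝓘(ℝ, EH) (fun k : H => k * ψ.symm (y z)) 1 (a z) : EH) := by
      rw [one_smul, ← chartGenerator_eq hzt]
      exact map_neg _ _
    have h4 : (maurerCartan EH (ψ.symm (y z))
        (mfderiv 𝓘(ℝ, EH) 𝓘(ℝ, EH) ψ.symm (y z) ((1 : ℝ) • F (z, y z))) : EH) =
        -(adInv EH (ψ.symm (y z)) (a z) : EH) := by
      rw [← maurerCartan_mul_right]
      exact (congrArg (fun v : EH => (maurerCartan EH (ψ.symm (y z)) v : EH)) h3).trans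
        (map_neg _ _)
    let w : EH := adInv EH (ψ.symm (y z)) (a z)
    exact (congrArg (fun v : EH => w + v) h4).trans
      (add_neg_cancel _)

end LocalLift
end SymExt

namespace SymExt
-- Smooth families of horizontal lifts over all of `[0, 1]`.
section GlobalLift

variable {EH EM EP H M P : Type*}
  [NormedAddCommGroup EH] [NormedSpace ℝ EH]
  [NormedAddCommGroup EM] [NormedSpace ℝ EM]
  [NormedAddCommGroup EP] [NormedSpace ℝ EP]
  [TopologicalSpace H] [ChartedSpace EH H] [Group H]
  [TopologicalSpace M] [ChartedSpace EM M]
  [TopologicalSpace P] [ChartedSpace EP P]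
  [IsManifold 𝓘(ℝ, EP) ∞ P] {B : PrincipalBundle EH EM EP H M P}

/-- `σ` is, over the points of `W`, a smooth family of horizontal lifts of the family of curves `c`. -/
def HorizontalFamily (A : Connection B) {V : Type} [NormedAddCommGroup V] [NormedSpace ℝ V]
    (c : V × ℝ → M) (σ : V × ℝ → P) (W : Set (V × ℝ)) : Prop :=
  ∀ z ∈ W, ContMDiffAt 𝓘(ℝ, V × ℝ) 𝓘(ℝ, EP) ∞ σ z ∧
      B.proj (σ z) = c z ∧ HorizontalAt A (fun s => σ (z.1, s)) univ z.2

namespace HorizontalFamily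

variable {A : Connection B} {V : Type} [NormedAddCommGroup V] [NormedSpace ℝ V]
  {c : V × ℝ → M} {σ τ : V × ℝ → P} {W W' : Set (V × ℝ)}

theorem mono (h : HorizontalFamily A c σ W) (hW : W' ⊆ W) : HorizontalFamily A c σ W' :=
  fun z hz => h z (hW hz)

theorem congr (h : HorizontalFamily A c σ W) (hW : IsOpen W) (e : EqOn τ σ W) :
    HorizontalFamily A c τ W := by
  intro z hz
  obtain ⟨h1, h2, h3⟩ := h z hz
  have he : τ =ᶠ[𝓝 z] σ := e.eventuallyEq_of_mem (hW.mem_nhds hz)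
  refine ⟨h1.congr_of_eventuallyEq he, by rw [e hz, h2], h3.congr ?_ (e hz)⟩
  rw [nhdsWithin_univ]
  have : Tendsto (fun s => (z.1, s)) (𝓝 z.2) (𝓝 z) := by
    exact (by fun_prop : Continuous fun s : ℝ => (z.1, s)).tendsto z.2
  exact this.eventually he

theorem union (h : HorizontalFamily A c σ W) (h' : HorizontalFamily A c σ W') :
    HorizontalFamily A c σ (W ∪ W') := fun z hz => hz.elim (h z) (h' z)

theorem contMDiffOn_slice (h : HorizontalFamily A c σ W) (v : V) {S : Set ℝ}
    (hS : ∀ s ∈ S, (v, s) ∈ W) : ContMDiffOn 𝓘(ℝ, ℝ) 𝓘(ℝ, EP) ∞ (fun s => σ (v, s)) S := fun s hs =>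
  ((h (v, s) (hS s hs)).1.comp s (contDiffAt_const.prodMk contDiffAt_id).contMDiffAt).contMDiffWithinAt

theorem horizontalAt_slice (h : HorizontalFamily A c σ W) (v : V) {S : Set ℝ}
    (hS : ∀ s ∈ S, (v, s) ∈ W) : ∀ s ∈ S, HorizontalAt A (fun s => σ (v, s)) S s := fun s hs =>
  (h (v, s) (hS s hs)).2.2.mono (subset_univ _)

variable [LieGroup 𝓘(ℝ, EH) ∞ H]

/-- The horizontal family `τ`, translated so that it takes the values `p` at `m`. -/
theorem exists_translate {N : Set V} (hN : IsOpen N) {a b m : ℝ} (hm : m ∈ Ioo a b)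
    (hτ : HorizontalFamily A c τ (N ×ˢ Ioo a b)) {p : V → P}
    (hp : ∀ v ∈ N, ContMDiffAt 𝓘(ℝ, V) 𝓘(ℝ, EP) ∞ p v) (hpc : ∀ v ∈ N, B.proj (p v) = c (v, m)) :
    ∃ ρ : V × ℝ → P, HorizontalFamily A c ρ (N ×ˢ Ioo a b) ∧ ∀ v ∈ N, ρ (v, m) = p v := by
  have hm' : ∀ v ∈ N, (v, m) ∈ N ×ˢ Ioo a b := fun v hv => ⟨hv, hm⟩
  have hproj : ∀ v ∈ N, B.proj (τ (v, m)) = B.proj (p v) := fun v hv => by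
    rw [(hτ _ (hm' v hv)).2.1, hpc v hv]
  have hg : ∀ v ∈ N, ContMDiffAt 𝓘(ℝ, V) 𝓘(ℝ, EH) ∞ (fun v => B.div (τ (v, m)) (p v)) v := by
    intro v hv
    refine ContMDiffWithinAt.contMDiffAt (s := N) ?_ (hN.mem_nhds hv)
    exact B.contMDiffWithinAt_div hv (((hτ _ (hm' v hv)).1.comp v
      (contDiffAt_id.prodMk contDiffAt_const).contMDiffAt).contMDiffWithinAt)
      (hp v hv).contMDiffWithinAt hproj
  refine ⟨fun z => B.act (τ z) (B.div (τ (z.1, m)) (p z.1)), fun z hz => ?_, fun v hv =>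
    B.act_div (hproj v hv)⟩
  obtain ⟨h1, h2, h3⟩ := hτ z hz
  exact ⟨B.contMDiffWithinAt_act h1 ((hg z.1 hz.1).comp z contDiffAt_fst.contMDiffAt),
    (B.proj_act _ _).trans h2, h3.act_const _⟩

/-- Gluing of horizontal families along a common parameter `m`. -/
theorem exists_glue {N : Set V} (hN : IsOpen N) {a₀ a b d m : ℝ} (ha₀ : a₀ < m)
    (ham : a < m) (hmb : m < b) (hbd : b ≤ d)
    (hσ : HorizontalFamily A c σ (N ×ˢ Ioo a₀ b)) (hτ : HorizontalFamily A c τ (N ×ˢ Ioo a d)) :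
    ∃ ρ : V × ℝ → P, HorizontalFamily A c ρ (N ×ˢ Ioo a₀ d) ∧
      ∀ v ∈ N, ∀ s ∈ Ioo a₀ b, ρ (v, s) = σ (v, s) := by
  have hm' : ∀ v ∈ N, (v, m) ∈ N ×ˢ Ioo a₀ b := fun v hv => ⟨hv, ha₀, hmb⟩
  obtain ⟨τ', hτ', hτm⟩ := exists_translate hN ⟨ham, hmb.trans_le hbd⟩ hτ
    (p := fun v => σ (v, m)) (fun v hv => (hσ _ (hm' v hv)).1.comp v
      (contDiffAt_id.prodMk contDiffAt_const).contMDiffAt) (fun v hv => (hσ _ (hm' v hv)).2.1)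
  -- For each fixed `v` both families are horizontal over the same curve and agree at `m`, so
  -- uniqueness makes them agree on the whole overlap. Gluing therefore costs no parameters.
  have heq : ∀ v ∈ N, EqOn (fun s => σ (v, s)) (fun s => τ' (v, s)) (Ioo (max a₀ a) b) := by
    intro v hv
    have h1 : ∀ s ∈ Ioo (max a₀ a) b, (v, s) ∈ N ×ˢ Ioo a₀ b := fun s hs =>
      ⟨hv, (le_max_left _ _).trans_lt hs.1, hs.2⟩
    have h2 : ∀ s ∈ Ioo (max a₀ a) b, (v, s) ∈ N ×ˢ Ioo a d := fun s hs =>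
      ⟨hv, (le_max_right _ _).trans_lt hs.1, hs.2.trans_le hbd⟩
    refine eqOn_of_horizontal (convex_Ioo _ _) isOpen_Ioo.uniqueDiffOn (hσ.contMDiffOn_slice v h1)
      (hτ'.contMDiffOn_slice v h2) (hσ.horizontalAt_slice v h1) (hτ'.horizontalAt_slice v h2)
      (fun s hs => ?_) (a := m) ⟨max_lt ha₀ ham, hmb⟩ (hτm v hv).symm
    rw [(hσ _ (h1 s hs)).2.1, (hτ' _ (h2 s hs)).2.1]
  classical
  let ρ : V × ℝ → P := fun z => if z.2 < m then σ z else τ' z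
  have hρσ : EqOn ρ σ (N ×ˢ Ioo a₀ b) := by
    intro z hz
    by_cases h : z.2 < m
    · simp only [ρ, if_pos h]
    · simp only [ρ, if_neg h]
      exact (heq z.1 hz.1 ⟨(max_lt ha₀ ham).trans_le (not_lt.1 h), hz.2.2⟩).symm
  have hρτ : EqOn ρ τ' (N ×ˢ Ioo (max a₀ a) d) := by
    intro z hz
    by_cases h : z.2 < m
    · simp only [ρ, if_pos h]
      exact heq z.1 hz.1 ⟨hz.2.1, h.trans hmb⟩
    · simp only [ρ, if_neg h]
  refine ⟨ρ, ?_, fun v hv s hs => hρσ ⟨hv, hs⟩⟩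
  refine ((hσ.congr (hN.prod isOpen_Ioo) hρσ).union ((hτ'.mono ?_).congr (hN.prod isOpen_Ioo) hρτ)).mono ?_
  · exact prod_mono_right (Ioo_subset_Ioo_left (le_max_right _ _))
  · intro z hz
    by_cases h : z.2 < b
    · exact Or.inl ⟨hz.1, hz.2.1, h⟩
    · exact Or.inr ⟨hz.1, ((max_lt ha₀ ham).trans hmb).trans_le (not_lt.1 h), hz.2.2⟩

variable [FiniteDimensional ℝ EH] [FiniteDimensional ℝ V]

theorem exists_local (A : Connection B) (hc : ContMDiff 𝓘(ℝ, V × ℝ) 𝓘(ℝ, EM) ∞ c) (v₀ : V) (s₀ : ℝ) :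
    ∃ (N : Set V) (δ : ℝ) (τ : V × ℝ → P), IsOpen N ∧ v₀ ∈ N ∧ 0 < δ ∧
      HorizontalFamily A c τ (N ×ˢ Ioo (s₀ - δ) (s₀ + δ)) := by
  obtain ⟨τ, hτ⟩ := exists_local_horizontal A hc (v₀, s₀)
  rw [nhds_prod_eq, eventually_prod_iff] at hτ
  obtain ⟨p, hp, q, hq, h⟩ := hτ
  obtain ⟨N, hN, hNo, hNv⟩ := eventually_nhds_iff.1 hp
  obtain ⟨δ, hδ, hδq⟩ := Metric.eventually_nhds_iff.1 hq
  refine ⟨N, δ, τ, hNo, hNv, hδ, fun z hz => h (hN _ hz.1) (hδq ?_)⟩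
  rw [Real.dist_eq, abs_lt]
  constructor <;> linarith [hz.2.1, hz.2.2]

/-- Existence of horizontal lifts over `[0, 1]` of a family of curves, smooth in the parameters. -/
theorem exists_global (A : Connection B) (hc : ContMDiff 𝓘(ℝ, V × ℝ) 𝓘(ℝ, EM) ∞ c) (v₀ : V) {p : V → P}
    (hp : ContMDiff 𝓘(ℝ, V) 𝓘(ℝ, EP) ∞ p) (hpc : ∀ v, B.proj (p v) = c (v, 0)) :
    ∃ (N : Set V) (δ : ℝ) (σ : V × ℝ → P), IsOpen N ∧ v₀ ∈ N ∧ 0 < δ ∧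
      HorizontalFamily A c σ (N ×ˢ Ioo (-δ) (1 + δ)) ∧ ∀ v ∈ N, σ (v, 0) = p v := by
  choose N δ τ hNo hNv hδ hτ using exists_local A hc v₀
  -- With a Lebesgue number `ε`, finitely many steps of length `ε / 2` reach time `1`, so the
  -- neighbourhood of `v₀` shrinks only finitely often.
  obtain ⟨ε, hε, hεc⟩ := lebesgue_number_lemma_of_metric (isCompact_Icc (a := (0 : ℝ)) (b := 1))
    (c := fun s : ℝ => Ioo (s - δ s) (s + δ s)) (fun _ => isOpen_Ioo)
    (fun s _ => mem_iUnion.2 ⟨s, by linarith [hδ s], by linarith [hδ s]⟩)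
  have hε2 : 0 < ε / 2 := half_pos hε
  have key : ∀ n : ℕ, ∃ (N : Set V) (δ : ℝ) (σ : V × ℝ → P), IsOpen N ∧ v₀ ∈ N ∧ 0 < δ ∧
      HorizontalFamily A c σ (N ×ˢ Ioo (-δ) (min (n * (ε / 2)) 1 + δ)) ∧ ∀ v ∈ N, σ (v, 0) = p v := by
    intro n
    induction n with
    | zero =>
      obtain ⟨ρ, hρ, hρ0⟩ := exists_translate (p := p) (hNo 0) (m := 0)
        (by constructor <;> linarith [hδ 0]) (hτ 0) (fun v _ => hp v) (fun v _ => hpc v)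
      refine ⟨N 0, δ 0, ρ, hNo 0, hNv 0, hδ 0, hρ.mono (prod_mono_right ?_), hρ0⟩
      simp
    | succ n ih =>
      obtain ⟨N', δ', σ, hN', hv', hδ', hσ, hσ0⟩ := ih
      set T := min (n * (ε / 2)) 1
      have hT0 : 0 ≤ T := le_min (by positivity) zero_le_one
      have hTle : min ((n + 1 : ℕ) * (ε / 2)) 1 ≤ T + ε / 2 := by
        rw [min_add]
        refine min_le_min ?_ (by linarith)
        push_cast
        linarith
      obtain ⟨s, hs⟩ := hεc T ⟨hT0, min_le_right _ _⟩
      rw [Real.ball_eq_Ioo] at hs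
      -- The local lift reaches up to `T + ε`. The next end time is at most `T + ε / 2`, and `η ≤ ε
      -- / 2` leaves room for the margin past it.
      let η := min δ' (ε / 2)
      have hη : 0 < η := lt_min hδ' hε2
      have hηε : η ≤ ε / 2 := min_le_right _ _
      have hηδ : η ≤ δ' := min_le_left _ _
      obtain ⟨ρ, hρ, hρσ⟩ := exists_glue (hN'.inter (hNo s)) (a₀ := -η) (a := T - ε) (b := T + η)
        (d := T + ε) (m := T) (by linarith) (by linarith) (by linarith) (by linarith)
        (hσ.mono (prod_mono inter_subset_left (Ioo_subset_Ioo (by linarith) (by linarith))))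
        ((hτ s).mono (prod_mono inter_subset_right hs))
      refine ⟨N' ∩ N s, η, ρ, hN'.inter (hNo s), ⟨hv', hNv s⟩, hη,
        hρ.mono (prod_mono_right (Ioo_subset_Ioo_right (by linarith))), fun v hv => ?_⟩
      rw [hρσ v hv 0 ⟨by linarith, by linarith⟩, hσ0 v hv.1]
  obtain ⟨n, hn⟩ := exists_nat_ge (1 / (ε / 2))
  have := key n
  rwa [min_eq_right ((div_le_iff₀ hε2).1 hn)] at this

end HorizontalFamily
end GlobalLift
end SymExt

namespace SymExt
-- Plots in manifolds, diffeological groups and extensions.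
section DiffeologyGeneral

theorem isPlot_of_eventuallyEq {X : Type*} [DiffeologicalSpace X] {n : ℕ}
    {p : EuclideanSpace ℝ (Fin n) → X}
    (h : ∀ x, ∃ q : EuclideanSpace ℝ (Fin n) → X, IsPlot q ∧ ∀ᶠ y in 𝓝 x, q y = p y) : IsPlot p := by
  refine DiffeologicalSpace.locality fun x => ?_
  obtain ⟨q, hq, hqp⟩ := h x
  obtain ⟨u, hu, huo, hx⟩ := eventually_nhds_iff.1 hqp
  refine ⟨u, huo, hx, fun {m f} hf hfs => ?_⟩
  have : p ∘ f = q ∘ f := funext fun y => (hu _ (hf y)).symm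
  rw [this]
  exact isPlot_reparam hq hfs

section
variable {E M E' N : Type*} [NormedAddCommGroup E] [NormedSpace ℝ E]
  [TopologicalSpace M] [ChartedSpace E M] [NormedAddCommGroup E'] [NormedSpace ℝ E']
  [TopologicalSpace N] [ChartedSpace E' N]

/-- Plots parametrized by an arbitrary finite-dimensional space. -/
theorem contMDiff_comp_of_dSmooth {X : Type*} [DiffeologicalSpace X] {W : Type*} [NormedAddCommGroup W]
    [NormedSpace ℝ W] [FiniteDimensional ℝ W] {f : X → M} (hf : DSmooth (Y := Mfd E M) f) {q : W → X}
    (hq : IsPlot (q ∘ (toEuclidean (E := W)).symm)) : ContMDiff 𝓘(ℝ, W) 𝓘(ℝ, E) ∞ (fun w => f (q w)) := by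
  have h1 := isPlot_mfd_iff.1 (hf _ _ hq)
  have h2 := h1.comp (toEuclidean (E := W)).contDiff.contMDiff
  refine h2.congr fun w => ?_
  change f (q w) = f (q (toEuclidean.symm (toEuclidean w)))
  rw [ContinuousLinearEquiv.symm_apply_apply]

/-- An inverse chart, precomposed with a map shrinking into the chart target, is a globally defined
plot which is the inverse chart near the centre. Testing `f` on it gives smoothness there. -/
theorem dSmooth_mfd_iff [FiniteDimensional ℝ E] [IsManifold 𝓘(ℝ, E) ∞ M] {f : M → N} :
    DSmooth (X := Mfd E M) (Y := Mfd E' N) f ↔ ContMDiff 𝓘(ℝ, E) 𝓘(ℝ, E') ∞ f := by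
  constructor
  · intro hf x
    have ht : IsOpen (extChartAt 𝓘(ℝ, E) x).target := isOpen_extChartAt_target _
    obtain ⟨k, hk, hkt, hkx⟩ := exists_contDiff_shrink ht (mem_extChartAt_target (I := 𝓘(ℝ, E)) x)
    have hs : ContMDiff 𝓘(ℝ, E) 𝓘(ℝ, E) ∞ (fun y => (extChartAt 𝓘(ℝ, E) x).symm (k y)) :=
      contMDiffOn_univ.1 ((contMDiffOn_extChartAt_symm x).comp hk.contMDiff.contMDiffOn
        fun y _ => hkt y)
    have h1 : ContMDiff 𝓘(ℝ, E) 𝓘(ℝ, E') ∞ (fun y => f ((extChartAt 𝓘(ℝ, E) x).symm (k y))) :=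
      contMDiff_comp_of_dSmooth (X := Mfd E M) hf
        (isPlot_mfd_iff.2 (hs.comp (toEuclidean (E := E)).symm.contDiff.contMDiff))
    have h2 := (h1 (extChartAt 𝓘(ℝ, E) x x)).comp x (contMDiffAt_extChartAt (n := ∞))
    refine h2.congr_of_eventuallyEq ?_
    filter_upwards [(continuousAt_extChartAt (I := 𝓘(ℝ, E)) x).eventually hkx,
      extChartAt_source_mem_nhds (I := 𝓘(ℝ, E)) x] with y hy hys
    simp only [Function.comp_apply, hy]
    rw [(extChartAt 𝓘(ℝ, E) x).left_inv hys]
  · intro hf n p hp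
    exact isPlot_mfd_iff.2 (hf.comp (isPlot_mfd_iff.1 hp))

theorem isDiffGroup_mfd [Group M] [LieGroup 𝓘(ℝ, E) ∞ M] : IsDiffGroup (Mfd E M) where
  smooth_mul _ _ hp := isPlot_mfd_iff.2 (ContMDiff.mul (G := M) (isPlot_mfd_iff.1 hp.1)
    (isPlot_mfd_iff.1 hp.2))
  smooth_inv _ _ hp := isPlot_mfd_iff.2 (ContMDiff.inv (G := M) (isPlot_mfd_iff.1 hp))

end

/-- Two groups that are isomorphic by an inducing homomorphism. -/
theorem IsDiffGroup.of_induction {K L : Type*} [Group K] [DiffeologicalSpace K] [Group L]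
    [DiffeologicalSpace L] (hL : IsDiffGroup L) (i : K →* L)
    (hi : ∀ (n : ℕ) (p : EuclideanSpace ℝ (Fin n) → K), IsPlot p ↔ IsPlot (i ∘ p)) :
    IsDiffGroup K where
  smooth_mul n p hp := by
    rw [hi]
    have h : i ∘ (fun z : K × K => z.1 * z.2) ∘ p =
        fun y => (fun z : L × L => z.1 * z.2) (i (p y).1, i (p y).2) := by
      funext y; simp
    rw [h]
    exact hL.smooth_mul n (fun y => (i (p y).1, i (p y).2)) ⟨(hi _ _).1 hp.1, (hi _ _).1 hp.2⟩
  smooth_inv n p hp := by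
    rw [hi]
    have h : i ∘ (fun z : K => z⁻¹) ∘ p = (fun z : L => z⁻¹) ∘ (i ∘ p) := by
      funext y; simp
    rw [h]
    exact hL.smooth_inv n _ ((hi _ _).1 hp)

/-- A short exact sequence of diffeological groups in which the kernel carries the subspace
diffeology and the projection is a subduction is an extension. -/
theorem IsDiffExtension.of_subduction {K E Q : Type*} [Group K] [Group E] [Group Q]
    [DiffeologicalSpace K] [DiffeologicalSpace E] [DiffeologicalSpace Q]
    {i : K →* E} {π : E →* Q} (hE : IsDiffGroup E) (hQ : IsDiffGroup Q)
    (hinj : Function.Injective i) (hex : i.range = π.ker)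
    (hind : ∀ (n : ℕ) (p : EuclideanSpace ℝ (Fin n) → K), IsPlot p ↔ IsPlot (i ∘ p))
    (hπ : IsSubduction π) : IsDiffExtension i π where
  group_left := hE.of_induction i hind
  group_mid := hE
  group_right := hQ
  injective := hinj
  exact := hex
  induction := hind
  subduction := hπ
  principal :=
    { subduction := hπ
      act_one := fun x => by simp
      act_mul := fun x k l => by simp [mul_assoc]
      proj_act := fun x k => by
        have : i k ∈ π.ker := hex ▸ ⟨k, rfl⟩
        rw [map_mul, MonoidHom.mem_ker.1 this, mul_one]
      shear := by
        -- The inverse shear sends `(x, y)` to `x` and the preimage under `i` of `x⁻¹ * y`. It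
        -- exists by exactness and is smooth because `i` induces the diffeology of `K`.
        have hk : ∀ z : {z : E × E // π z.1 = π z.2}, ∃ k, i k = z.1.1⁻¹ * z.1.2 := fun z => by
          have : z.1.1⁻¹ * z.1.2 ∈ π.ker := by
            rw [MonoidHom.mem_ker, map_mul, map_inv, z.2, inv_mul_cancel]
          rw [← hex] at this
          exact this
        choose d hd using hk
        have hp : ∀ x k, π x = π (x * i k) := fun x k => by
          have : i k ∈ π.ker := hex ▸ ⟨k, rfl⟩
          rw [map_mul, MonoidHom.mem_ker.1 this, mul_one]
        refine ⟨⟨fun z => ⟨(z.1, z.1 * i z.2), hp _ _⟩, fun z => (z.1.1, d z), fun z => ?_, fun z => ?_⟩,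
          ?_, ?_, fun z => rfl⟩
        · refine Prod.ext rfl (hinj ?_)
          simp [hd]
        · refine Subtype.ext (Prod.ext rfl ?_)
          simp [hd]
        · intro n p hp
          exact ⟨hp.1, hE.smooth_mul n (fun y => ((p y).1, i (p y).2)) ⟨hp.1, (hind _ _).1 hp.2⟩⟩
        · intro n p hp
          refine ⟨hp.1, (hind _ _).2 ?_⟩
          have h : i ∘ (fun y => d (p y)) = fun y => (p y).1.1⁻¹ * (p y).1.2 := funext fun y => hd _
          change IsPlot (i ∘ fun y => d (p y))
          rw [h]
          exact hE.smooth_mul n (fun y => ((p y).1.1⁻¹, (p y).1.2))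
            ⟨hE.smooth_inv n (fun y => (p y).1.1) hp.1, hp.2⟩ }

end DiffeologyGeneral
end SymExt

namespace SymExt
-- Parallel transport and holonomy along paths in `G`.
section Transport

variable {EH EM EP H M P : Type*}
  [NormedAddCommGroup EH] [NormedSpace ℝ EH]
  [NormedAddCommGroup EM] [NormedSpace ℝ EM]
  [NormedAddCommGroup EP] [NormedSpace ℝ EP]
  [TopologicalSpace H] [ChartedSpace EH H] [Group H]
  [TopologicalSpace M] [ChartedSpace EM M]
  [TopologicalSpace P] [ChartedSpace EP P]
  [IsManifold 𝓘(ℝ, EP) ∞ P] {B : PrincipalBundle EH EM EP H M P}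

/-- Derivatives within `[0, 1]` are unique, so `mfderivWithin` may be traded for any derivative
annihilated by the form. -/
theorem isHorizontalLift_iff {A : Connection B} {c : unitInterval → M} {σ : ℝ → P} :
    IsHorizontalLift A c σ ↔ ContMDiffOn 𝓘(ℝ, ℝ) 𝓘(ℝ, EP) ∞ σ (Icc 0 1) ∧
      (∀ t : unitInterval, B.proj (σ t) = c t) ∧
      ∀ t ∈ Icc (0 : ℝ) 1, HorizontalAt A σ (Icc 0 1) t := by
  constructor
  · rintro ⟨h1, h2, h3⟩
    exact ⟨h1, h2, fun t ht =>
      ⟨_, ((h1 t ht).mdifferentiableWithinAt (by simp)).hasMFDerivWithinAt, h3 t ht⟩⟩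
  · rintro ⟨h1, h2, h3⟩
    refine ⟨h1, h2, fun t ht => ?_⟩
    obtain ⟨σ', h4, h5⟩ := h3 t ht
    rw [h4.mfderivWithin ((uniqueDiffOn_Icc zero_lt_one) t ht).uniqueMDiffWithinAt]
    exact h5

namespace IsHorizontalLift

variable {A : Connection B} {c : unitInterval → M} {σ τ : ℝ → P}

theorem act_const (h : IsHorizontalLift A c σ) (k : H) :
    IsHorizontalLift A c (fun t => B.act (σ t) k) := by
  rw [isHorizontalLift_iff] at h ⊢
  exact ⟨fun t ht => B.contMDiffWithinAt_act (h.1 t ht) contMDiffWithinAt_const,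
    fun t => (B.proj_act _ _).trans (h.2.1 t), fun t ht => (h.2.2 t ht).act_const k⟩

theorem reparam (h : IsHorizontalLift A c σ) {Q : ℝ → ℝ} (hQ : ContDiff ℝ ∞ Q)
    (hm : MapsTo Q (Icc 0 1) (Icc 0 1)) {c' : unitInterval → M}
    (hc : ∀ t s : unitInterval, (s : ℝ) = Q t → c' t = c s) : IsHorizontalLift A c' (σ ∘ Q) := by
  rw [isHorizontalLift_iff] at h ⊢
  refine ⟨h.1.comp hQ.contMDiff.contMDiffOn hm, fun t => ?_, fun t ht => ?_⟩
  · rw [hc t ⟨Q t, hm t.2⟩ rfl]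
    exact h.2.1 ⟨Q t, hm t.2⟩
  · exact (h.2.2 (Q t) (hm ht)).comp
      (hQ.differentiable (by simp) t).hasDerivAt.hasDerivWithinAt hm

variable [LieGroup 𝓘(ℝ, EH) ∞ H]

theorem eqOn (hσ : IsHorizontalLift A c σ) (hτ : IsHorizontalLift A c τ) (e : σ 0 = τ 0) :
    EqOn σ τ (Icc 0 1) := by
  rw [isHorizontalLift_iff] at hσ hτ
  exact eqOn_of_horizontal (convex_Icc _ _) (uniqueDiffOn_Icc zero_lt_one) hσ.1 hτ.1 hσ.2.2 hτ.2.2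
    (fun t ht => (hσ.2.1 ⟨t, ht⟩).trans (hτ.2.1 ⟨t, ht⟩).symm) (left_mem_Icc.2 zero_le_one) e

/-- The lift chosen in `transport` coincides with `σ` by uniqueness; the default value is not used.
-/
theorem transport_eq (hσ : IsHorizontalLift A c σ) : transport A c (σ 0) = σ 1 := by
  have h : ∃ τ : ℝ → P, IsHorizontalLift A c τ ∧ τ 0 = σ 0 := ⟨σ, hσ, rfl⟩
  rw [transport, dif_pos h]
  exact h.choose_spec.1.eqOn hσ h.choose_spec.2 (right_mem_Icc.2 zero_le_one)

end IsHorizontalLift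

section Existence

variable {A : Connection B} {V : Type} [NormedAddCommGroup V] [NormedSpace ℝ V]
  {c : V × ℝ → M} {σ : V × ℝ → P}

theorem HorizontalFamily.isHorizontalLift {N : Set V} {δ : ℝ} (hδ : 0 < δ)
    (h : HorizontalFamily A c σ (N ×ˢ Ioo (-δ) (1 + δ))) {v : V} (hv : v ∈ N) :
    IsHorizontalLift A (fun t => c (v, t)) (fun s => σ (v, s)) := by
  have hS : ∀ s ∈ Icc (0 : ℝ) 1, (v, s) ∈ N ×ˢ Ioo (-δ) (1 + δ) := fun s hs =>
    ⟨hv, by linarith [hs.1], by linarith [hs.2]⟩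
  exact isHorizontalLift_iff.2 ⟨h.contMDiffOn_slice v hS, fun t => (h _ (hS t t.2)).2.1,
    h.horizontalAt_slice v hS⟩

variable [LieGroup 𝓘(ℝ, EH) ∞ H] [FiniteDimensional ℝ EH]

/-- Parallel transport depends smoothly on parameters. -/
theorem contMDiff_transport [FiniteDimensional ℝ V] (hc : ContMDiff 𝓘(ℝ, V × ℝ) 𝓘(ℝ, EM) ∞ c)
    {p : V → P} (hp : ContMDiff 𝓘(ℝ, V) 𝓘(ℝ, EP) ∞ p) (hpc : ∀ v, B.proj (p v) = c (v, 0)) :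
    ContMDiff 𝓘(ℝ, V) 𝓘(ℝ, EP) ∞ (fun v => transport A (fun t => c (v, t)) (p v)) := by
  intro v₀
  obtain ⟨N, δ, σ, hN, hv₀, hδ, hσ, hσ0⟩ := HorizontalFamily.exists_global A hc v₀ hp hpc
  have h1 : ContMDiffAt 𝓘(ℝ, V) 𝓘(ℝ, EP) ∞ (fun v => σ (v, 1)) v₀ :=
    (hσ (v₀, 1) ⟨hv₀, by linarith, by linarith⟩).1.comp v₀
      (contDiffAt_id.prodMk contDiffAt_const).contMDiffAt
  refine h1.congr_of_eventuallyEq ?_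
  filter_upwards [hN.mem_nhds hv₀] with v hv
  rw [← hσ0 v hv]
  exact (hσ.isHorizontalLift hδ hv).transport_eq

/-- A single curve is a family over the zero-dimensional parameter space. -/
theorem exists_isHorizontalLift (A : Connection B) {c : ℝ → M} (hc : ContMDiff 𝓘(ℝ, ℝ) 𝓘(ℝ, EM) ∞ c)
    {γ : unitInterval → M} (hγ : ∀ t, γ t = c t) {p : P} (hp : B.proj p = c 0) :
    ∃ σ : ℝ → P, IsHorizontalLift A γ σ ∧ σ 0 = p := by
  have h1 : ContMDiff 𝓘(ℝ, EuclideanSpace ℝ (Fin 0) × ℝ) 𝓘(ℝ, EM) ∞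
      (fun z : EuclideanSpace ℝ (Fin 0) × ℝ => c z.2) := hc.comp contDiff_snd.contMDiff
  obtain ⟨N, δ, σ, -, hv₀, hδ, hσ, hσ0⟩ := HorizontalFamily.exists_global A h1 0
    (p := fun _ => p) contMDiff_const fun _ => hp
  refine ⟨fun s => σ (0, s), ?_, hσ0 0 hv₀⟩
  rw [show γ = fun t : unitInterval => c t from funext hγ]
  exact hσ.isHorizontalLift hδ hv₀

theorem hasUniqueHorizontalLift (A : Connection B) {c : ℝ → M}
    (hc : ContMDiff 𝓘(ℝ, ℝ) 𝓘(ℝ, EM) ∞ c) {γ : unitInterval → M} (hγ : ∀ t, γ t = c t) {p : P}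
    (hp : B.proj p = c 0) : HasUniqueHorizontalLift A γ p :=
  ⟨exists_isHorizontalLift A hc hγ hp, fun _ _ hσ hτ h0 h0' => hσ.eqOn hτ (h0.trans h0'.symm)⟩

end Existence

section Paths

variable {EG G : Type*} [NormedAddCommGroup EG] [NormedSpace ℝ EG] [Group G]
    [TopologicalSpace G] [ChartedSpace EG G]

theorem contMDiff_basedPath_family {n : ℕ} {g : EuclideanSpace ℝ (Fin n) → BasedPath EG G} (hg : IsPlot g)
    {W : Type*} [NormedAddCommGroup W] [NormedSpace ℝ W] [FiniteDimensional ℝ W]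
    {a : W → EuclideanSpace ℝ (Fin n)} (ha : ContDiff ℝ ∞ a) {f : W → ℝ} (hf : ContDiff ℝ ∞ f)
    (hm : ∀ w, f w ∈ Icc (0 : ℝ) 1) :
    ContMDiff 𝓘(ℝ, W) 𝓘(ℝ, EG) ∞ (fun w => g (a w) ⟨f w, hm w⟩) := by
  have hg' : DSmooth (Y := Mfd EG G)
      (fun z : EuclideanSpace ℝ (Fin n) × unitInterval => (g z.1).1.toFun z.2) := hg
  refine contMDiff_comp_of_dSmooth (M := G) (q := fun w => (a w, (⟨f w, hm w⟩ : unitInterval))) hg' ⟨?_, ?_⟩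
  · exact (ha.comp (toEuclidean (E := W)).symm.contDiff).isPlot
  · exact (hf.comp (toEuclidean (E := W)).symm.contDiff).isPlot

namespace BasedPath

/-- A based path, extended to all real times by constants. -/
noncomputable def extend (γ : BasedPath EG G) (t : ℝ) : G := γ (projIcc 0 1 zero_le_one t)

theorem apply_zero (γ : BasedPath EG G) : γ 0 = 1 := γ.2.1

theorem extend_coe (γ : BasedPath EG G) (t : unitInterval) : γ.extend t = γ t := by
  rw [extend, projIcc_val]

theorem eventually_extend_eq_of_le (γ : BasedPath EG G) {t : ℝ} (ht : t ≤ 0) :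
    ∀ᶠ s in 𝓝 t, γ.extend s = 1 := by
  have h0 : projIcc (0 : ℝ) 1 zero_le_one t = 0 := projIcc_of_le_left _ ht
  have h1 := (continuous_projIcc (h := zero_le_one' ℝ)).tendsto t
  rw [h0] at h1
  filter_upwards [h1.eventually γ.2.2.1] with s hs
  exact hs.trans γ.2.1

theorem eventually_extend_eq_of_ge (γ : BasedPath EG G) {t : ℝ} (ht : 1 ≤ t) :
    ∀ᶠ s in 𝓝 t, γ.extend s = γ 1 := by
  have h0 : projIcc (0 : ℝ) 1 zero_le_one t = 1 := projIcc_of_right_le _ ht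
  have h1 := (continuous_projIcc (h := zero_le_one' ℝ)).tendsto t
  rw [h0] at h1
  exact h1.eventually γ.2.2.2

/-- Constancy near the end points makes the extension locally constant outside `(0, 1)`. Inside, a
map shrinking into `(0, 1)` turns real time into a plot of the interval. -/
theorem contMDiff_extend (γ : BasedPath EG G) : ContMDiff 𝓘(ℝ, ℝ) 𝓘(ℝ, EG) ∞ γ.extend := by
  intro t
  rcases le_or_gt t 0 with h0 | h0
  · exact contMDiffAt_const.congr_of_eventuallyEq (γ.eventually_extend_eq_of_le h0)
  rcases le_or_gt 1 t with h1 | h1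
  · exact contMDiffAt_const.congr_of_eventuallyEq (γ.eventually_extend_eq_of_ge h1)
  obtain ⟨f, hf, hfu, hft⟩ := exists_contDiff_shrink (isOpen_Ioo (a := (0 : ℝ)) (b := 1)) ⟨h0, h1⟩
  have h2 := contMDiff_basedPath_family (n := 0) (g := fun _ => γ) isPlot_const
    (a := fun _ : ℝ => 0) contDiff_const hf (fun w => Ioo_subset_Icc_self (hfu w))
  refine (h2 t).congr_of_eventuallyEq ?_
  filter_upwards [hft] with s hs
  rw [← γ.extend_coe]
  exact congrArg _ hs.symm

end BasedPath

/-- The loop `α⁻ ⋆ γ`, extended to all real times. -/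
noncomputable def loopExtend (α γ : BasedPath EG G) (t : ℝ) : G :=
  if t ≤ 1 / 2 then γ.extend (2 * t) else α.extend (2 - 2 * t)

theorem loop_eq_loopExtend (α γ : BasedPath EG G) (t : unitInterval) :
    loop α γ t = loopExtend α γ t := by
  unfold loop loopExtend concatPath revPath
  split_ifs with h
  · rfl
  · rw [unitInterval.symm_projIcc, BasedPath.extend]
    congr 2
    ring

/-- At `t = 1 / 2` both halves are locally constant, with common value `γ 1 = α 1`. -/
theorem contMDiff_loopExtend {α γ : BasedPath EG G} (h : γ 1 = α 1) :
    ContMDiff 𝓘(ℝ, ℝ) 𝓘(ℝ, EG) ∞ (loopExtend α γ) := by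
  intro t
  rcases lt_trichotomy t (1 / 2) with ht | ht | ht
  · have h1 : ContMDiff 𝓘(ℝ, ℝ) 𝓘(ℝ, EG) ∞ (fun t : ℝ => γ.extend (2 * t)) :=
      γ.contMDiff_extend.comp (contDiff_const.mul contDiff_id).contMDiff
    refine (h1 t).congr_of_eventuallyEq ?_
    filter_upwards [eventually_lt_nhds ht] with s hs
    rw [loopExtend, if_pos hs.le]
  · have h1 : Tendsto (fun s : ℝ => 2 * s) (𝓝 t) (𝓝 1) := by
      have : Continuous fun s : ℝ => 2 * s := by fun_prop
      simpa [ht] using this.tendsto t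
    have h2 : Tendsto (fun s : ℝ => 2 - 2 * s) (𝓝 t) (𝓝 1) := by
      have : Continuous fun s : ℝ => 2 - 2 * s := by fun_prop
      convert this.tendsto t using 2
      rw [ht]; norm_num
    refine (contMDiffAt_const (c := γ 1)).congr_of_eventuallyEq ?_
    filter_upwards [h1.eventually (γ.eventually_extend_eq_of_ge le_rfl),
      h2.eventually (α.eventually_extend_eq_of_ge le_rfl)] with s hs1 hs2
    rw [loopExtend]
    split_ifs
    · exact hs1
    · rw [hs2, h]
  · have h1 : ContMDiff 𝓘(ℝ, ℝ) 𝓘(ℝ, EG) ∞ (fun t : ℝ => α.extend (2 - 2 * t)) :=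
      α.contMDiff_extend.comp (contDiff_const.sub (contDiff_const.mul contDiff_id)).contMDiff
    refine (h1 t).congr_of_eventuallyEq ?_
    filter_upwards [eventually_gt_nhds ht] with s hs
    rw [loopExtend, if_neg (not_le.2 hs)]

variable [MulAction G M] [ContMDiffSMul 𝓘(ℝ, EG) 𝓘(ℝ, EM) ∞ G M] [LieGroup 𝓘(ℝ, EH) ∞ H]
  [FiniteDimensional ℝ EH] (A : Connection B)

theorem hasUniqueHorizontalLift_orbitPath (γ : BasedPath EG G) (p : P) :
    HasUniqueHorizontalLift A (orbitPath γ (B.proj p)) p := by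
  refine hasUniqueHorizontalLift A (c := fun t => γ.extend t • B.proj p)
    (γ.contMDiff_extend.smul contMDiff_const) (fun t => ?_) ?_
  · rw [γ.extend_coe]; rfl
  · rw [(γ.eventually_extend_eq_of_le le_rfl).self_of_nhds, one_smul]

theorem hasUniqueHorizontalLift_loop {α γ : BasedPath EG G} (h : γ 1 = α 1) (p : P) :
    HasUniqueHorizontalLift A (orbitPath (loop α γ) (B.proj p)) p := by
  refine hasUniqueHorizontalLift A (c := fun t => loopExtend α γ t • B.proj p)
    ((contMDiff_loopExtend h).smul contMDiff_const) (fun t => ?_) ?_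
  · rw [← loop_eq_loopExtend]; rfl
  · rw [loopExtend, if_pos (by norm_num), mul_zero,
      (γ.eventually_extend_eq_of_le le_rfl).self_of_nhds, one_smul]

theorem exists_lift_pt (γ : BasedPath EG G) (p : P) :
    ∃ σ : ℝ → P, IsHorizontalLift A (orbitPath γ (B.proj p)) σ ∧ σ 0 = p ∧ pt A γ p = σ 1 := by
  obtain ⟨σ, hσ, rfl⟩ := (hasUniqueHorizontalLift_orbitPath A γ p).1
  exact ⟨σ, hσ, rfl, hσ.transport_eq⟩

theorem proj_pt (γ : BasedPath EG G) (p : P) : B.proj (pt A γ p) = γ 1 • B.proj p := by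
  obtain ⟨σ, hσ, -, h⟩ := exists_lift_pt A γ p
  rw [h]
  exact hσ.lift 1

theorem pt_act (γ : BasedPath EG G) (p : P) (h : H) : pt A γ (B.act p h) = B.act (pt A γ p) h := by
  obtain ⟨σ, hσ, h0, h1⟩ := exists_lift_pt A γ p
  rw [h1, pt, B.proj_act, ← h0]
  rw [← h0] at hσ
  exact (hσ.act_const h).transport_eq

/-- Smoothness of parallel transport along the paths of a smooth family. -/
theorem contMDiff_pt {n : ℕ} {g : EuclideanSpace ℝ (Fin n) → BasedPath EG G} (hg : IsPlot g)
    {p : EuclideanSpace ℝ (Fin n) → P}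
    (hp : ContMDiff 𝓘(ℝ, EuclideanSpace ℝ (Fin n)) 𝓘(ℝ, EP) ∞ p) :
    ContMDiff 𝓘(ℝ, EuclideanSpace ℝ (Fin n)) 𝓘(ℝ, EP) ∞ (fun v => pt A (g v) (p v)) := by
  -- The intervals on which the paths are constant need not be uniform in `v`, so joint smoothness
  -- of the extensions by constants is not evident. Reparametrizing by `Real.smoothTransition` gives
  -- a jointly smooth family in real time with the same transports.
  have hQm : ∀ t : ℝ, Real.smoothTransition t ∈ Icc (0 : ℝ) 1 := fun t =>
    ⟨Real.smoothTransition.nonneg t, Real.smoothTransition.le_one t⟩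
  let q : ℝ → unitInterval := fun t => ⟨Real.smoothTransition t, hQm t⟩
  have h1 : ContMDiff 𝓘(ℝ, EuclideanSpace ℝ (Fin n) × ℝ) 𝓘(ℝ, EG) ∞
      (fun z : EuclideanSpace ℝ (Fin n) × ℝ => g z.1 (q z.2)) :=
    contMDiff_basedPath_family hg contDiff_fst (Real.smoothTransition.contDiff.comp contDiff_snd)
      (fun _ => hQm _)
  have h2 : ContMDiff 𝓘(ℝ, EuclideanSpace ℝ (Fin n) × ℝ) 𝓘(ℝ, EM) ∞
      (fun z : EuclideanSpace ℝ (Fin n) × ℝ => g z.1 (q z.2) • B.proj (p z.1)) :=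
    h1.smul (B.proj_smooth.comp (hp.comp contDiff_fst.contMDiff))
  have hq0 : q 0 = 0 := Subtype.ext Real.smoothTransition.zero
  refine (contMDiff_transport (A := A) h2 hp fun v => ?_).congr fun v => ?_
  · simp only [hq0]
    rw [BasedPath.apply_zero, one_smul]
  · obtain ⟨σ, hσ, h0, h3⟩ := exists_lift_pt A (g v) (p v)
    have h4 := hσ.reparam (Q := Real.smoothTransition) Real.smoothTransition.contDiff
      (fun t _ => hQm t) (c' := fun t => g v (q t) • B.proj (p v)) (fun t s hs => by
        have : q t = s := Subtype.ext hs.symm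
        simp only [this]; rfl)
    have h5 := h4.transport_eq
    rw [Function.comp_apply, Function.comp_apply, Real.smoothTransition.zero,
      Real.smoothTransition.one, h0] at h5
    rw [h3, ← h5]

/-- Let `ρ` be the lift of the loop from `p`. Its first half lifts `γ` from `p`; its second half,
reversed, lifts `α` from `ρ 1`, the holonomy of `p`. Both transports end at `ρ (1 / 2)`. -/
theorem pt_hol {α γ : BasedPath EG G} (h : γ 1 = α 1) (p : P) :
    pt A α (hol A α γ p) = pt A γ p := by
  obtain ⟨ρ, hρ, hρ0⟩ := (hasUniqueHorizontalLift_loop A h p).1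
  have h1 : hol A α γ p = ρ 1 := by
    rw [hol, ← hρ0]
    rw [← hρ0] at hρ
    exact hρ.transport_eq
  have h2 := (hρ.reparam (Q := fun t => t / 2) (contDiff_id.div_const _)
    (fun t ht => ⟨by linarith [ht.1], by linarith [ht.2]⟩) (c' := orbitPath γ (B.proj p))
    (fun t s hs => by
      have hs' : (s : ℝ) = t / 2 := hs
      rw [orbitPath, orbitPath, loop_eq_loopExtend, loopExtend, if_pos (by
        rw [hs']; linarith [t.2.2]), hs', mul_div_cancel₀ _ two_ne_zero, γ.extend_coe])).transport_eq
  have h3 : B.proj (ρ 1) = B.proj p := by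
    refine (hρ.lift 1).trans ?_
    rw [orbitPath, loop_eq_loopExtend, loopExtend, if_neg (by norm_num)]
    norm_num
    rw [(α.eventually_extend_eq_of_le le_rfl).self_of_nhds, one_smul]
  have h4 := (hρ.reparam (Q := fun t => 1 - t / 2) (contDiff_const.sub (contDiff_id.div_const _))
    (fun t ht => ⟨by linarith [ht.2], by linarith [ht.1]⟩) (c' := orbitPath α (B.proj p))
    (fun t s hs => by
      have hs' : (s : ℝ) = 1 - t / 2 := hs
      rw [orbitPath, orbitPath, loop_eq_loopExtend, loopExtend]
      split_ifs with hle
      -- At `t = 1` the reversed half meets time `1 / 2`, where the first branch of `loopExtend`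
      -- applies; equality of the end points reconciles the two.
      · have ht : t = 1 := Subtype.ext (le_antisymm t.2.2 (show (1 : ℝ) ≤ t by rw [hs'] at hle; linarith))
        have hs1 : 2 * (s : ℝ) = 1 := by rw [hs', ht]; norm_num
        rw [hs1, (γ.eventually_extend_eq_of_ge le_rfl).self_of_nhds, h, ht]
      · rw [hs', show 2 - 2 * (1 - (t : ℝ) / 2) = t by ring, α.extend_coe])).transport_eq
  simp only [Function.comp_apply, zero_div, sub_zero, hρ0] at h2 h4
  rw [h1, pt, h3, h4, pt, h2]
  norm_num

end Paths
end Transport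
end SymExt

namespace SymExt
-- Equivariant diffeomorphisms and the diffeological group `Sym_G(P)`.
section Symmetries

variable {EH EM EP EG H M P G : Type*}
  [NormedAddCommGroup EH] [NormedSpace ℝ EH]
  [NormedAddCommGroup EM] [NormedSpace ℝ EM]
  [NormedAddCommGroup EP] [NormedSpace ℝ EP]
  [TopologicalSpace H] [ChartedSpace EH H] [Group H]
  [TopologicalSpace M] [ChartedSpace EM M]
  [TopologicalSpace P] [ChartedSpace EP P]
  {B : PrincipalBundle EH EM EP H M P}
  [Group G] [MulAction G M]

namespace PrincipalBundle

/-- An equivariant map covering the action of a group element is bijective. -/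
theorem bijective_of_equivariant {f : P → P} {g : G} (hf : ∀ p h, f (B.act p h) = B.act (f p) h)
    (hg : ∀ p, B.proj (f p) = g • B.proj p) : Function.Bijective f := by
  constructor
  · intro p q e
    have h1 : B.proj p = B.proj q := by
      have := congrArg B.proj e
      rwa [hg, hg, smul_left_cancel_iff] at this
    have h2 : B.act (f p) (B.div p q) = B.act (f p) 1 := by
      rw [← hf, B.act_div h1, B.act_one, e]
    rw [← B.act_div h1, B.act_injective _ h2, B.act_one]
  · intro q
    obtain ⟨U, s, τ, -, hx, -, -, hs, -, -⟩ := B.exists_local (g⁻¹ • B.proj q)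
    have h1 : B.proj (f (s (g⁻¹ • B.proj q))) = B.proj q := by
      rw [hg, hs _ hx, smul_inv_smul]
    exact ⟨_, (hf _ _).trans (B.act_div h1)⟩

variable [NormedAddCommGroup EG] [NormedSpace ℝ EG] [TopologicalSpace G] [ChartedSpace EG G]
  [LieGroup 𝓘(ℝ, EG) ∞ G] [LieGroup 𝓘(ℝ, EH) ∞ H] [ContMDiffSMul 𝓘(ℝ, EG) 𝓘(ℝ, EM) ∞ G M]

/-- The inverses of a smooth family of equivariant maps covering a smooth family of group elements
form a smooth family. -/
theorem contMDiff_inverse_family {V : Type*} [NormedAddCommGroup V] [NormedSpace ℝ V]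
    [FiniteDimensional ℝ V] {f r : V → P → P} {g : V → G} (hgs : ContMDiff 𝓘(ℝ, V) 𝓘(ℝ, EG) ∞ g)
    (hf : ∀ v p h, f v (B.act p h) = B.act (f v p) h)
    (hg : ∀ v p, B.proj (f v p) = g v • B.proj p)
    (hfs : ∀ b : V → P, ContMDiff 𝓘(ℝ, V) 𝓘(ℝ, EP) ∞ b → ContMDiff 𝓘(ℝ, V) 𝓘(ℝ, EP) ∞ (fun v => f v (b v)))
    (hr : ∀ v p, f v (r v p) = p) {b : V → P} (hb : ContMDiff 𝓘(ℝ, V) 𝓘(ℝ, EP) ∞ b) :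
    ContMDiff 𝓘(ℝ, V) 𝓘(ℝ, EP) ∞ (fun v => r v (b v)) := by
  intro v₀
  have hw : ContMDiff 𝓘(ℝ, V) 𝓘(ℝ, EM) ∞ (fun v => (g v)⁻¹ • B.proj (b v)) :=
    hgs.inv.smul (B.proj_smooth.comp hb)
  obtain ⟨U, s, τ, hU, hx, hss, -, hs, -, -⟩ := B.exists_local ((g v₀)⁻¹ • B.proj (b v₀))
  obtain ⟨k, hk, hku, hkv⟩ := exists_contDiff_shrink (hU.preimage hw.continuous) hx
  -- For `v` near `v₀`, `q v` lies in the fibre that `f v` carries to the fibre of `b v`. By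
  -- equivariance, correcting `q v` by the division of `f v (q v)` into `b v` gives the preimage.
  let q : V → P := fun v => s ((g (k v))⁻¹ • B.proj (b (k v)))
  have hq : ContMDiff 𝓘(ℝ, V) 𝓘(ℝ, EP) ∞ q :=
    contMDiffOn_univ.1 (hss.comp (hw.comp hk.contMDiff).contMDiffOn fun v _ => hku v)
  have hfq := hfs q hq
  obtain ⟨N, hN, hNo, hvN⟩ := eventually_nhds_iff.1 hkv
  have hproj : ∀ v ∈ N, B.proj (f v (q v)) = B.proj (b v) := fun v hv => by
    rw [hg, hs _ (hku v), hN v hv, smul_inv_smul]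
  have h1 := ((B.contMDiffWithinAt_act (hq.contMDiffAt.contMDiffWithinAt (s := N))
    (B.contMDiffWithinAt_div hvN hfq.contMDiffAt.contMDiffWithinAt
      hb.contMDiffAt.contMDiffWithinAt hproj)).contMDiffAt (hNo.mem_nhds hvN))
  refine h1.congr_of_eventuallyEq ?_
  filter_upwards [hNo.mem_nhds hvN] with v hv
  refine (bijective_of_equivariant (hf v) (hg v)).1 ?_
  rw [hr, hf, B.act_div (hproj v hv)]

end PrincipalBundle

namespace SymG

theorem apply_mul (ψ φ : SymG EG G B) (p : P) : (ψ * φ) p = ψ (φ p) := rfl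

theorem apply_inv_apply (ψ : SymG EG G B) (p : P) : ψ (ψ⁻¹ p) = p := ψ.diffeo.apply_symm_apply p

theorem ext_apply {ψ φ : SymG EG G B} (h : ψ.base = φ.base) (h' : ∀ p, ψ p = φ p) : ψ = φ :=
  SymG.ext h (Diffeomorph.ext h')

/-- The element of `Gau(P)` given by an element of `Sym_G(P)` over `1`. -/
def toGau (ψ : SymG EG G B) (h : ψ.base = 1) : Gau B :=
  ⟨ψ.diffeo, ψ.equivariant, fun p => by rw [ψ.covers, h, one_smul]⟩

theorem incl_toGau (ψ : SymG EG G B) (h : ψ.base = 1) : incl EG G B (ψ.toGau h) = ψ :=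
  SymG.ext h.symm rfl

theorem incl_injective : Function.Injective (incl EG G B) := fun _ _ h =>
  Gau.ext (congrArg SymG.diffeo h)

theorem range_incl : (incl EG G B).range = (proj EG G B).ker := by
  ext ψ
  rw [MonoidHom.mem_range, MonoidHom.mem_ker]
  constructor
  · rintro ⟨φ, rfl⟩
    rfl
  · intro h
    exact ⟨ψ.toGau h, ψ.incl_toGau h⟩

variable [NormedAddCommGroup EG] [NormedSpace ℝ EG] [TopologicalSpace G] [ChartedSpace EG G]

theorem isPlot_iff {n : ℕ} {p : EuclideanSpace ℝ (Fin n) → SymG EG G B} :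
    IsPlot p ↔ (∀ (k : ℕ) (a : EuclideanSpace ℝ (Fin k) → EuclideanSpace ℝ (Fin n))
      (b : EuclideanSpace ℝ (Fin k) → P), ContDiff ℝ ∞ a →
      ContMDiff 𝓘(ℝ, EuclideanSpace ℝ (Fin k)) 𝓘(ℝ, EP) ∞ b →
      ContMDiff 𝓘(ℝ, EuclideanSpace ℝ (Fin k)) 𝓘(ℝ, EP) ∞ (fun v => p (a v) (b v))) ∧
      ContMDiff 𝓘(ℝ, EuclideanSpace ℝ (Fin n)) 𝓘(ℝ, EG) ∞ (fun v => (p v).base) := by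
  constructor
  · intro h
    refine ⟨fun k a b ha hb => ?_, isPlot_mfd_iff.1 h.2⟩
    exact isPlot_mfd_iff.1 (h.1 k (fun v => (a v, b v)) ⟨ha.isPlot, isPlot_mfd_iff.2 hb⟩)
  · rintro ⟨h1, h2⟩
    exact ⟨fun k q hq => isPlot_mfd_iff.2 (h1 k (fun v => (q v).1) (fun v => (q v).2)
      (IsPlot.contDiff hq.1) (isPlot_mfd_iff.1 hq.2)), isPlot_mfd_iff.2 h2⟩

theorem isPlot_incl_iff {n : ℕ} (p : EuclideanSpace ℝ (Fin n) → Gau B) :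
    IsPlot p ↔ IsPlot (incl EG G B ∘ p) :=
  ⟨fun h => ⟨h, isPlot_const⟩, fun h => h.1⟩

theorem isPlot_toGau_iff {n : ℕ} {p : EuclideanSpace ℝ (Fin n) → SymG EG G B}
    (h : ∀ y, (p y).base = 1) : IsPlot (fun y => (p y).toGau (h y)) ↔ IsPlot p := by
  rw [isPlot_incl_iff (EG := EG) (G := G)]
  have : incl EG G B ∘ (fun y => (p y).toGau (h y)) = p := funext fun y => incl_toGau _ _
  rw [this]

/-- The universal property of `Sym_G(P)` among the actions which lift an action through `G`. -/
theorem existsUnique_lift {EK K : Type*} [NormedAddCommGroup EK] [NormedSpace ℝ EK]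
    [TopologicalSpace K] [ChartedSpace EK K] [Group K] [MulAction K P]
    [ContMDiffSMul 𝓘(ℝ, EK) 𝓘(ℝ, EP) ∞ K P] (φ : K →* G)
    (hφ : ContMDiff 𝓘(ℝ, EK) 𝓘(ℝ, EG) ∞ φ)
    (hact : ∀ (k : K) (p : P) (h : H), k • B.act p h = B.act (k • p) h)
    (hproj : ∀ (k : K) (p : P), B.proj (k • p) = φ k • B.proj p) :
    ∃! F : K →* SymG EG G B, DSmooth (X := Mfd EK K) (Y := SymG EG G B) F ∧
      (∀ k, SymG.proj EG G B (F k) = φ k) ∧ ∀ (k : K) (p : P), F k p = k • p := by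
  have hsm : ∀ k : K, ContMDiff 𝓘(ℝ, EP) 𝓘(ℝ, EP) ∞ (fun p : P => k • p) := fun k =>
    ContMDiff.smul (I := 𝓘(ℝ, EK)) (f := fun _ : P => k) contMDiff_const contMDiff_id
  let F : K →* SymG EG G B :=
    { toFun := fun k => ⟨φ k, ⟨MulAction.toPerm k, hsm k, hsm k⁻¹⟩, hact k, hproj k⟩
      map_one' := ext_apply (map_one φ) fun p => one_smul K p
      map_mul' := fun k l => ext_apply (map_mul φ k l) fun p => mul_smul k l p }
  refine ⟨F, ⟨fun n p hp => isPlot_iff.2 ⟨fun k a b ha hb => ?_, hφ.comp (isPlot_mfd_iff.1 hp)⟩,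
    fun k => rfl, fun k p => rfl⟩, fun F' h => ?_⟩
  · let p' : EuclideanSpace ℝ (Fin n) → K := p
    have hp' : ContMDiff 𝓘(ℝ, EuclideanSpace ℝ (Fin n)) 𝓘(ℝ, EK) ∞ p' := isPlot_mfd_iff.1 hp
    exact (hp'.comp ha.contMDiff).smul hb
  · exact MonoidHom.ext fun k => ext_apply (h.2.1 k) fun p => h.2.2 k p

variable [LieGroup 𝓘(ℝ, EG) ∞ G] [LieGroup 𝓘(ℝ, EH) ∞ H] [ContMDiffSMul 𝓘(ℝ, EG) 𝓘(ℝ, EM) ∞ G M]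

/-- The diffeology constrains only the maps and base points, not the inverse maps. Smoothness of
inversion thus needs the bundle structure, through `contMDiff_inverse_family`. -/
theorem isDiffGroup : IsDiffGroup (SymG EG G B) where
  smooth_mul n p hp := by
    obtain ⟨h1, h2⟩ := isPlot_iff.1 hp.1
    obtain ⟨h3, h4⟩ := isPlot_iff.1 hp.2
    exact isPlot_iff.2 ⟨fun k a b ha hb => h1 k a _ ha (h3 k a b ha hb), h2.mul h4⟩
  smooth_inv n p hp := by
    obtain ⟨h1, h2⟩ := isPlot_iff.1 hp
    refine isPlot_iff.2 ⟨fun k a b ha hb => ?_, h2.inv⟩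
    exact B.contMDiff_inverse_family (f := fun v => p (a v)) (r := fun v q => ((p (a v))⁻¹ : SymG EG G B) q)
      (h2.comp ha.contMDiff) (fun v => (p (a v)).equivariant) (fun v => (p (a v)).covers)
      (fun b hb => h1 k a b ha hb) (fun v q => apply_inv_apply _ q) hb

/-- The symmetry given by a smooth equivariant map covering the action of a group element. -/
theorem exists_of_equivariant [FiniteDimensional ℝ EP] [IsManifold 𝓘(ℝ, EP) ∞ P] {f : P → P} {g : G}
    (hfs : ContMDiff 𝓘(ℝ, EP) 𝓘(ℝ, EP) ∞ f) (hf : ∀ p h, f (B.act p h) = B.act (f p) h)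
    (hg : ∀ p, B.proj (f p) = g • B.proj p) : ∃ ψ : SymG EG G B, ψ.base = g ∧ ∀ p, ψ p = f p := by
  let e := Equiv.ofBijective f (B.bijective_of_equivariant hf hg)
  have he : ContMDiff 𝓘(ℝ, EP) 𝓘(ℝ, EP) ∞ e.symm := by
    rw [← dSmooth_mfd_iff]
    intro n b hb
    exact isPlot_mfd_iff.2 (B.contMDiff_inverse_family (EG := EG) (f := fun _ => f)
      (r := fun _ => e.symm) (g := fun _ => g)
      contMDiff_const (fun _ => hf) (fun _ => hg) (fun b hb => hfs.comp hb)
      (fun _ => e.apply_symm_apply) (isPlot_mfd_iff.1 hb))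
  exact ⟨⟨g, ⟨e, hfs, he⟩, hf, hg⟩, rfl, fun p => rfl⟩

end SymG
end Symmetries
end SymExt

namespace SymExt
-- Existence of connections.
section ConnectionExistence

variable {EH EM EP H M P : Type*}
  [NormedAddCommGroup EH] [NormedSpace ℝ EH]
  [NormedAddCommGroup EM] [NormedSpace ℝ EM]
  [NormedAddCommGroup EP] [NormedSpace ℝ EP]
  [TopologicalSpace H] [ChartedSpace EH H] [Group H]
  [TopologicalSpace M] [ChartedSpace EM M]
  [TopologicalSpace P] [ChartedSpace EP P]
  [LieGroup 𝓘(ℝ, EH) ∞ H]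

/-- The Maurer-Cartan form is smooth. -/
theorem contMDiff_maurerCartan : ContMDiff 𝓘(ℝ, EH).tangent 𝓘(ℝ, EH) (M' := EH) ∞
    (fun v : TangentBundle 𝓘(ℝ, EH) H => (maurerCartan EH v.proj v.snd : EH)) := by
  have : IsManifold 𝓘(ℝ, EH) ∞ H := inferInstance
  have : IsManifold 𝓘(ℝ, EH) 1 H := .of_le (n := ∞) (by simp)
  -- The form at `v` over `h` is the tangent map of multiplication applied to the zero vector at
  -- `h⁻¹` and `v`, which makes its smoothness visible.
  let fz : TangentBundle 𝓘(ℝ, EH) H → TangentBundle 𝓘(ℝ, EH) H :=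
    fun v => Bundle.TotalSpace.mk' EH (v.proj)⁻¹ 0
  have hproj : ContMDiff 𝓘(ℝ, EH).tangent 𝓘(ℝ, EH) ∞
      (fun v : TangentBundle 𝓘(ℝ, EH) H => v.proj) := Bundle.contMDiff_proj _
  have hz : ContMDiff 𝓘(ℝ, EH).tangent 𝓘(ℝ, EH).tangent ∞ fz :=
    (Bundle.contMDiff_zeroSection ℝ (TangentSpace 𝓘(ℝ, EH) (M := H))).comp hproj.inv
  have h2 : ContMDiff (𝓘(ℝ, EH).tangent.prod 𝓘(ℝ, EH).tangent) (𝓘(ℝ, EH).prod 𝓘(ℝ, EH)).tangent ∞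
      (equivTangentBundleProd 𝓘(ℝ, EH) H 𝓘(ℝ, EH) H).symm := contMDiff_equivTangentBundleProd_symm
  have h3 : ContMDiff (𝓘(ℝ, EH).prod 𝓘(ℝ, EH)).tangent 𝓘(ℝ, EH).tangent ∞
      (tangentMap (𝓘(ℝ, EH).prod 𝓘(ℝ, EH)) 𝓘(ℝ, EH) (fun z : H × H => z.1 * z.2)) :=
    (contMDiff_mul 𝓘(ℝ, EH) ∞).contMDiff_tangentMap (by simp)
  have h4 : ContMDiff 𝓘(ℝ, EH).tangent 𝓘(ℝ, EH).tangent ∞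
      (fun v : TangentBundle 𝓘(ℝ, EH) H =>
        (⟨1, maurerCartan EH v.proj v.snd⟩ : TangentBundle 𝓘(ℝ, EH) H)) := by
    refine ((h3.comp h2).comp (hz.prodMk contMDiff_id)).congr fun v => ?_
    have h5 : ∀ (x : H) (w : EH), x = 1 → (⟨1, w⟩ : TangentBundle 𝓘(ℝ, EH) H) = ⟨x, w⟩ := by
      rintro _ w rfl; rfl
    refine (h5 (v.proj⁻¹ * v.proj) _ (inv_mul_cancel _)).trans ?_
    refine congrArg (fun w : EH => (⟨v.proj⁻¹ * v.proj, w⟩ : TangentBundle 𝓘(ℝ, EH) H)) ?_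
    refine Eq.trans ?_ (mfderiv_prod_eq_add_apply (I := 𝓘(ℝ, EH)) (I' := 𝓘(ℝ, EH)) (I'' := 𝓘(ℝ, EH))
      (f := fun z : H × H => z.1 * z.2) (p := (v.proj⁻¹, v.proj)) (v := ((0 : EH), v.snd))
      (((contMDiff_mul 𝓘(ℝ, EH) ∞).mdifferentiable (by simp)) _)).symm
    let L : EH →L[ℝ] EH := mfderiv 𝓘(ℝ, EH) 𝓘(ℝ, EH) (fun k : H => k * v.proj) v.proj⁻¹
    let w : EH := maurerCartan EH v.proj v.snd
    have h6 : w = L 0 + w := by rw [map_zero, zero_add]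
    exact h6
  intro v
  -- The fibre coordinate is read in the trivialization at `1`, where the coordinate change is the
  -- identity.
  have h5 := (Bundle.contMDiffAt_totalSpace.1 (h4 v)).2
  refine h5.congr_of_eventuallyEq (Eventually.of_forall fun w => ?_)
  exact ((tangentBundleCore 𝓘(ℝ, EH) H).coordChange_self (achart EH 1) 1 (mem_chart_source EH 1) _).symm

variable (EH EP) in
/-- The pullback of the Maurer-Cartan form. -/
noncomputable def pullbackMaurerCartan (τ : P → H) (p : P) :
    TangentSpace 𝓘(ℝ, EP) p →L[ℝ] GroupLieAlgebra 𝓘(ℝ, EH) H :=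
  (maurerCartan EH (τ p)).comp (mfderiv 𝓘(ℝ, EP) 𝓘(ℝ, EH) τ p)

variable [IsManifold 𝓘(ℝ, EP) ∞ P]

theorem contMDiffOn_pullbackMaurerCartan {τ : P → H} {S : Set P} (hS : IsOpen S)
    (hτ : ContMDiffOn 𝓘(ℝ, EP) 𝓘(ℝ, EH) ∞ τ S) :
    ContMDiffOn 𝓘(ℝ, EP).tangent 𝓘(ℝ, EH) (M' := EH) ∞
      (fun v : TangentBundle 𝓘(ℝ, EP) P => (pullbackMaurerCartan EH EP τ v.proj v.snd : EH))
      (Bundle.TotalSpace.proj ⁻¹' S) := by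
  have : IsManifold 𝓘(ℝ, EH) ∞ H := inferInstance
  have : IsManifold 𝓘(ℝ, EH) 1 H := .of_le (n := ∞) (by simp)
  have : IsManifold 𝓘(ℝ, EP) 1 P := .of_le (n := ∞) (by simp)
  have h1 := hτ.contMDiffOn_tangentMapWithin (m := ∞) (by simp) hS.uniqueMDiffOn
  refine (contMDiff_maurerCartan.comp_contMDiffOn h1).congr fun v hv => ?_
  exact congrArg (fun L : EP →L[ℝ] EH => (maurerCartan EH (τ v.proj) (L v.snd) : EH))
    (mfderivWithin_of_isOpen hS hv).symm

/-- Differentiate `(q, k) ↦ (τ p * h)⁻¹ * (τ q * k)` at `(p, h)` in two ways. As a composite through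
the action it gives the left side. Its partial derivatives give the `Ad` term, from `h⁻¹ * ((τ p)⁻¹
* τ q) * h`, and the Maurer-Cartan term. -/
theorem pullbackMaurerCartan_mfderiv_act (B : PrincipalBundle EH EM EP H M P) {τ : P → H} {S : Set P}
    (hS : IsOpen S) (hτ : ContMDiffOn 𝓘(ℝ, EP) 𝓘(ℝ, EH) ∞ τ S)
    (hτa : ∀ p ∈ S, ∀ h, τ (B.act p h) = τ p * h) {p : P} (hp : p ∈ S) (h : H)
    (hph : B.act p h ∈ S) (v : TangentSpace 𝓘(ℝ, EP) p) (ξ : TangentSpace 𝓘(ℝ, EH) h) :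
    pullbackMaurerCartan EH EP τ (B.act p h)
      (mfderiv (𝓘(ℝ, EP).prod 𝓘(ℝ, EH)) 𝓘(ℝ, EP) (fun z : P × H => B.act z.1 z.2) (p, h) (v, ξ)) =
    adInv EH h (pullbackMaurerCartan EH EP τ p v) + maurerCartan EH h ξ := by
  have : IsManifold 𝓘(ℝ, EP) 1 P := .of_le (n := ∞) (by simp)
  have : IsManifold 𝓘(ℝ, EH) 1 H := .of_le (n := ∞) (by simp)
  have hτd : ∀ q ∈ S, MDifferentiableAt 𝓘(ℝ, EP) 𝓘(ℝ, EH) τ q := fun q hq =>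
    (hτ.contMDiffAt (hS.mem_nhds hq)).mdifferentiableAt (by simp)
  have hL : ∀ a : H, MDifferentiable 𝓘(ℝ, EH) 𝓘(ℝ, EH) (fun k : H => a * k) := fun a =>
    (contMDiff_mul_left (n := ∞)).mdifferentiable (by simp)
  have hA : MDifferentiable (𝓘(ℝ, EP).prod 𝓘(ℝ, EH)) 𝓘(ℝ, EP) (fun z : P × H => B.act z.1 z.2) :=
    B.act_smooth.mdifferentiable (by simp)
  let F : P × H → H := fun z => (τ p * h)⁻¹ * (τ z.1 * z.2)
  have e0 : τ (B.act p h) = τ p * h := hτa p hp h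
  have hmul : MDifferentiable (𝓘(ℝ, EH).prod 𝓘(ℝ, EH)) 𝓘(ℝ, EH) (fun z : H × H => z.1 * z.2) :=
    (contMDiff_mul 𝓘(ℝ, EH) ∞).mdifferentiable (by simp)
  have hFd : MDifferentiableAt (𝓘(ℝ, EP).prod 𝓘(ℝ, EH)) 𝓘(ℝ, EH) F (p, h) :=
    (hL _ _).comp (p, h) ((hmul _).comp (p, h)
      (((hτd p hp).comp (p, h) mdifferentiableAt_fst).prodMk mdifferentiableAt_snd))
  have h1 : HasMFDerivAt (𝓘(ℝ, EP).prod 𝓘(ℝ, EH)) 𝓘(ℝ, EH)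
      (fun z : P × H => (τ (B.act p h))⁻¹ * τ (B.act z.1 z.2)) (p, h)
      ((pullbackMaurerCartan EH EP τ (B.act p h)).comp
        (mfderiv (𝓘(ℝ, EP).prod 𝓘(ℝ, EH)) 𝓘(ℝ, EP) (fun z : P × H => B.act z.1 z.2) (p, h))) :=
    HasMFDerivAt.comp (p, h) (g := fun q => (τ (B.act p h))⁻¹ * τ q) (I' := 𝓘(ℝ, EP))
      (f := fun z : P × H => B.act z.1 z.2)
      (HasMFDerivAt.comp (B.act p h) (I' := 𝓘(ℝ, EH)) (hL _ _).hasMFDerivAt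
        (hτd _ hph).hasMFDerivAt) (hA (p, h)).hasMFDerivAt
  have h2 : F =ᶠ[𝓝 (p, h)] (fun z : P × H => (τ (B.act p h))⁻¹ * τ (B.act z.1 z.2)) := by
    filter_upwards [continuous_fst.tendsto (p, h) (hS.mem_nhds hp)] with z hz
    rw [e0, hτa z.1 hz]
  have h3 := (h1.congr_of_eventuallyEq h2).mfderiv
  have h4 := mfderiv_prod_eq_add_apply (I := 𝓘(ℝ, EP)) (I' := 𝓘(ℝ, EH)) (I'' := 𝓘(ℝ, EH))
    (f := F) (p := (p, h)) (v := (v, ξ)) hFd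
  have h5 : (fun k : H => F (p, k)) = fun k => h⁻¹ * k := by
    funext k; simp [F, mul_assoc]
  have hAd : MDifferentiable 𝓘(ℝ, EH) 𝓘(ℝ, EH) (fun k : H => h⁻¹ * k * h) :=
    ((contMDiff_mul_right (n := ∞)).comp (contMDiff_mul_left (n := ∞))).mdifferentiable (by simp)
  have h6 : HasMFDerivAt 𝓘(ℝ, EP) 𝓘(ℝ, EH) (fun q : P => F (q, h)) p
      ((mfderiv 𝓘(ℝ, EH) 𝓘(ℝ, EH) (fun k : H => h⁻¹ * k * h) ((τ p)⁻¹ * τ p)).comp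
        (pullbackMaurerCartan EH EP τ p)) := by
    have h7 : (fun q : P => F (q, h)) = (fun k : H => h⁻¹ * k * h) ∘ fun q => (τ p)⁻¹ * τ q := by
      funext q; simp [F, mul_assoc]
    rw [h7]
    exact HasMFDerivAt.comp p (I' := 𝓘(ℝ, EH)) (hAd _).hasMFDerivAt
      (HasMFDerivAt.comp p (I' := 𝓘(ℝ, EH)) (hL _ _).hasMFDerivAt (hτd p hp).hasMFDerivAt)
  have h8 : (mfderiv 𝓘(ℝ, EP) 𝓘(ℝ, EH) (fun q : P => F (q, h)) p v : EH) =
      adInv EH h (pullbackMaurerCartan EH EP τ p v) := by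
    rw [h6.mfderiv]
    exact mfderiv_apply_congr (inv_mul_cancel _) _
  have h9 : (mfderiv 𝓘(ℝ, EH) 𝓘(ℝ, EH) (fun k : H => F (p, k)) h ξ : EH) =
      maurerCartan EH h ξ := by
    rw [h5]; rfl
  refine (DFunLike.congr_fun h3 (v, ξ)).symm.trans (h4.trans ?_)
  exact congrArg₂ (fun a b : EH => a + b) h8 h9

namespace PrincipalBundle

/-- Every principal bundle over a second countable Hausdorff manifold has a connection. -/
theorem exists_connection [FiniteDimensional ℝ EM] [IsManifold 𝓘(ℝ, EM) ∞ M] [T2Space M]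
    [SecondCountableTopology M] (B : PrincipalBundle EH EM EP H M P) : Nonempty (Connection B) := by
  have : IsManifold 𝓘(ℝ, EP) 1 P := .of_le (n := ∞) (by simp)
  have : LocallyCompactSpace M := ChartedSpace.locallyCompactSpace EM M
  choose U s τ hU hx hs hτ hps hτa hst using B.exists_local
  obtain ⟨ρ, hρ⟩ := SmoothPartitionOfUnity.exists_isSubordinate 𝓘(ℝ, EM) isClosed_univ U hU
    fun x _ => mem_iUnion_of_mem x (hx x)
  have hUo : ∀ i, IsOpen (B.proj ⁻¹' U i) := fun i => (hU i).preimage B.proj_smooth.continuous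
  -- Each trivialization has a flat connection form, the pullback of the Maurer-Cartan form by its
  -- fibre coordinate. Values off the trivialization are irrelevant, as `ρ i` vanishes there.
  let θ : M → P → EP →L[ℝ] EH := fun i p => pullbackMaurerCartan EH EP (τ i) p
  have hfin : ∀ x : M, (Function.support fun i => ρ i x).Finite := fun x => ρ.locallyFinite.point_finite x
  have happ : ∀ (p : P) (v : EP), (∑ᶠ i, ρ i (B.proj p) • θ i p) v = ∑ᶠ i, ρ i (B.proj p) • θ i p v := by
    intro p v
    have hf : (Function.support fun i => ρ i (B.proj p) • θ i p).Finite :=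
      (hfin (B.proj p)).subset fun i hi h0 => hi (by simp only [h0, zero_smul])
    exact (ContinuousLinearMap.apply ℝ EH v).toLinearMap.toAddMonoidHom.map_finsum hf
  have hmem : ∀ i p, ρ i (B.proj p) ≠ 0 → B.proj p ∈ U i := fun i p h =>
    hρ i (subset_tsupport _ h)
  refine ⟨⟨fun p => (∑ᶠ i, ρ i (B.proj p) • θ i p : EP →L[ℝ] EH), ?_, ?_⟩⟩
  · have hproj : ContMDiff 𝓘(ℝ, EP).tangent 𝓘(ℝ, EM) ∞
        (fun v : TangentBundle 𝓘(ℝ, EP) P => B.proj v.proj) :=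
      B.proj_smooth.comp (Bundle.contMDiff_proj _)
    have h1 : ContMDiff 𝓘(ℝ, EP).tangent 𝓘(ℝ, EH) ∞ (fun v : TangentBundle 𝓘(ℝ, EP) P =>
        ∑ᶠ i, ρ i (B.proj v.proj) • θ i v.proj v.snd) := by
      refine contMDiff_finsum (fun i v => ?_) ?_
      · by_cases hv : B.proj v.proj ∈ tsupport (ρ i)
        · refine ContMDiffAt.smul (((ρ i).contMDiff.comp hproj) v) ?_
          exact (contMDiffOn_pullbackMaurerCartan (hUo i) (hτ i)).contMDiffAt
            (((hUo i).preimage (Bundle.contMDiff_proj (n := ∞) (IB := 𝓘(ℝ, EP))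
              (TangentSpace 𝓘(ℝ, EP) (M := P))).continuous).mem_nhds (hρ i hv))
        · refine (contMDiffAt_const (c := (0 : EH))).congr_of_eventuallyEq ?_
          filter_upwards [hproj.continuous.continuousAt.preimage_mem_nhds
            ((isClosed_tsupport (ρ i)).isOpen_compl.mem_nhds hv)] with w hw
          rw [image_eq_zero_of_notMem_tsupport hw, zero_smul]
      · refine (ρ.locallyFinite.preimage_continuous hproj.continuous).subset fun i v hv h0 => hv ?_
        simp only [h0, zero_smul]
    exact h1.congr fun v => happ v.proj v.snd
  · intro p h v ξ
    refine (happ _ _).trans ?_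
    have h1 : ∀ i, ρ i (B.proj (B.act p h)) • θ i (B.act p h)
        (mfderiv (𝓘(ℝ, EP).prod 𝓘(ℝ, EH)) 𝓘(ℝ, EP) (fun z : P × H => B.act z.1 z.2) (p, h) (v, ξ)) =
        (ρ i (B.proj p) • (adInv EH h (θ i p v) : EH) + ρ i (B.proj p) • (maurerCartan EH h ξ : EH)) := by
      intro i
      rw [B.proj_act]
      by_cases hi : ρ i (B.proj p) = 0
      · simp only [hi, zero_smul, add_zero]
        rfl
      · rw [← smul_add]
        refine congrArg (fun w : EH => ρ i (B.proj p) • w) ?_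
        have hp := hmem i p hi
        exact pullbackMaurerCartan_mfderiv_act B (hUo i) (hτ i) (hτa i) hp h
          (by rw [mem_preimage, B.proj_act]; exact hp) v ξ
    have h2 : ∀ w : M → EH, (Function.support fun i => ρ i (B.proj p) • w i).Finite := fun w =>
      (hfin (B.proj p)).subset fun i hi h0 => hi (by simp only [h0, zero_smul])
    -- The connection identity is affine: the Maurer-Cartan term survives the averaging because the
    -- weights sum to `1`.
    have h3 : ∑ᶠ i, ρ i (B.proj p) • (maurerCartan EH h ξ : EH) = (maurerCartan EH h ξ : EH) := by
      rw [← finsum_smul' (hfin (B.proj p)), ρ.sum_eq_one (mem_univ _), one_smul]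
    let Ad : EH →L[ℝ] EH := adInv EH h
    have h4 : ∀ w : EP, ∑ᶠ i, ρ i (B.proj p) • Ad (θ i p w) =
        Ad ((∑ᶠ i, ρ i (B.proj p) • θ i p) w) := by
      intro w
      rw [happ]
      refine Eq.trans (finsum_congr fun i => (Ad.map_smul _ _).symm) ?_
      exact (Ad.toLinearMap.toAddMonoidHom.map_finsum (h2 _)).symm
    refine (finsum_congr h1).trans ((finsum_add_distrib (h2 _) (h2 _)).trans ?_)
    exact congrArg₂ (fun a b : EH => a + b) (h4 v) h3

end PrincipalBundle
end ConnectionExistence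
end SymExt

namespace SymExt
-- Quotients by subductions, and end points of based paths.
section PathSubduction

variable {EG G : Type*} [NormedAddCommGroup EG] [NormedSpace ℝ EG] [Group G]
    [TopologicalSpace G] [ChartedSpace EG G]

theorem IsSubduction.surjective {X Y : Type*} [DiffeologicalSpace X] [DiffeologicalSpace Y] {f : X → Y}
    (hf : IsSubduction f) : Function.Surjective f := fun y => by
  obtain ⟨q, -, hq⟩ := hf.2 0 (fun _ => y) isPlot_const 0
  exact ⟨_, hq.self_of_nhds⟩

/-- A subduction identifies the quotient by its kernel with its codomain. -/
theorem IsSubduction.exists_quot_equiv {X Y : Type*} [DiffeologicalSpace X] [DiffeologicalSpace Y]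
    {f : X → Y} (hf : IsSubduction f) {r : X → X → Prop} (hr : ∀ a b, r a b ↔ f a = f b) :
    ∃ e : Quot r ≃ Y, DSmooth e ∧ DSmooth e.symm ∧ ∀ a, e (Quot.mk r a) = f a := by
  let F : Quot r → Y := Quot.lift f fun a b h => (hr a b).1 h
  have hF : Function.Bijective F := by
    constructor
    · rintro ⟨a⟩ ⟨b⟩ h
      exact Quot.sound ((hr a b).2 h)
    · intro y
      obtain ⟨a, rfl⟩ := hf.surjective y
      exact ⟨Quot.mk r a, rfl⟩
  refine ⟨Equiv.ofBijective F hF, fun n p hp => ?_, fun n p hp x => ?_, fun a => rfl⟩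
  · refine isPlot_of_eventuallyEq fun x => ?_
    obtain ⟨q, hq, hqp⟩ := hp x
    refine ⟨f ∘ q, hf.1 n q hq, ?_⟩
    filter_upwards [hqp] with y hy
    exact congrArg F hy
  · obtain ⟨q, hq, hqp⟩ := hf.2 n p hp x
    refine ⟨q, hq, ?_⟩
    filter_upwards [hqp] with y hy
    exact ((Equiv.ofBijective F hF).symm_apply_eq.2 hy.symm).symm

namespace BasedPath

theorem isPlot_iff {n : ℕ} {g : EuclideanSpace ℝ (Fin n) → BasedPath EG G} :
    IsPlot g ↔ ∀ (k : ℕ) (a : EuclideanSpace ℝ (Fin k) → EuclideanSpace ℝ (Fin n))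
      (b : EuclideanSpace ℝ (Fin k) → unitInterval), ContDiff ℝ ∞ a →
      ContDiff ℝ ∞ (fun v => (b v : ℝ)) →
      ContMDiff 𝓘(ℝ, EuclideanSpace ℝ (Fin k)) 𝓘(ℝ, EG) ∞ (fun v => g (a v) (b v)) := by
  constructor
  · intro h k a b ha hb
    exact isPlot_mfd_iff.1 (h k (fun v => (a v, b v)) ⟨ha.isPlot, hb.isPlot⟩)
  · intro h k q hq
    exact isPlot_mfd_iff.2 (h k (fun v => (q v).1) (fun v => (q v).2) (IsPlot.contDiff hq.1)
      (IsPlot.contDiff (X := ℝ) hq.2))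

theorem dSmooth_apply_one : DSmooth (Y := Mfd EG G) (fun γ : BasedPath EG G => γ 1) := fun _ _ hp =>
  isPlot_mfd_iff.2 (isPlot_iff.1 hp _ id (fun _ => 1) contDiff_id contDiff_const)

/-- The elements of a suitable neighbourhood of `1` are the end points of based paths which depend
smoothly on the element. -/
theorem exists_local_family [LieGroup 𝓘(ℝ, EG) ∞ G] : ∃ U : Set G, IsOpen U ∧ 1 ∈ U ∧
    ∀ (n : ℕ) (q : EuclideanSpace ℝ (Fin n) → G),
      ContMDiff 𝓘(ℝ, EuclideanSpace ℝ (Fin n)) 𝓘(ℝ, EG) ∞ q → (∀ y, q y ∈ U) →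
      ∃ γ : EuclideanSpace ℝ (Fin n) → BasedPath EG G, IsPlot γ ∧ ∀ y, γ y 1 = q y := by
  have : IsManifold 𝓘(ℝ, EG) ∞ G := inferInstance
  set ψ := extChartAt 𝓘(ℝ, EG) (1 : G) with hψ
  have ht : IsOpen ψ.target := isOpen_extChartAt_target _
  obtain ⟨ε, hε, hball⟩ := Metric.isOpen_iff.1 ht (ψ 1) (mem_extChartAt_target _)
  -- The paths are straight segments in a chart ball, run with speed governed by `χ`: it is `0` up
  -- to `1 / 3` and `1` from `2 / 3` on, as constancy near the ends requires.
  let χ : ℝ → ℝ := fun t => Real.smoothTransition (3 * t - 1)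
  have hχ : ContDiff ℝ ∞ χ :=
    Real.smoothTransition.contDiff.comp ((contDiff_const.mul contDiff_id).sub contDiff_const)
  have hχ0 : ∀ t, t ≤ 1 / 3 → χ t = 0 := fun t h =>
    Real.smoothTransition.zero_of_nonpos (by linarith)
  have hχ1 : ∀ t, 2 / 3 ≤ t → χ t = 1 := fun t h => Real.smoothTransition.one_of_one_le (by linarith)
  refine ⟨ψ.source ∩ ψ ⁻¹' Metric.ball (ψ 1) ε,
    (continuousOn_extChartAt _).isOpen_inter_preimage (isOpen_extChartAt_source _) Metric.isOpen_ball,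
    ⟨mem_extChartAt_source _, Metric.mem_ball_self hε⟩, fun n q hq hqU => ?_⟩
  have hline : ∀ y t, ψ 1 + χ t • (ψ (q y) - ψ 1) ∈ ψ.target := fun y t => by
    apply hball
    have h1 := (hqU y).2
    rw [mem_preimage, Metric.mem_ball, dist_eq_norm] at h1
    rw [Metric.mem_ball, dist_eq_norm, add_sub_cancel_left, norm_smul, Real.norm_eq_abs,
      abs_of_nonneg (Real.smoothTransition.nonneg _)]
    exact (mul_le_of_le_one_left (norm_nonneg _) (Real.smoothTransition.le_one _)).trans_lt h1
  let f : EuclideanSpace ℝ (Fin n) → ℝ → G := fun y t => ψ.symm (ψ 1 + χ t • (ψ (q y) - ψ 1))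
  have hψq : ContDiff ℝ ∞ (fun y => ψ (q y)) := by
    rw [← contMDiff_iff_contDiff, ← contMDiffOn_univ]
    refine ContMDiffOn.comp (t := (chartAt EG (1 : G)).source) contMDiffOn_extChartAt
      hq.contMDiffOn fun y _ => ?_
    rw [← extChartAt_source 𝓘(ℝ, EG)]
    exact (hqU y).1
  have hf : ∀ (k : ℕ) (a : EuclideanSpace ℝ (Fin k) → EuclideanSpace ℝ (Fin n))
      (b : EuclideanSpace ℝ (Fin k) → ℝ), ContDiff ℝ ∞ a → ContDiff ℝ ∞ b →
      ContMDiff 𝓘(ℝ, EuclideanSpace ℝ (Fin k)) 𝓘(ℝ, EG) ∞ (fun v => f (a v) (b v)) := by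
    intro k a b ha hb
    have h1 : ContDiff ℝ ∞ (fun v => ψ 1 + χ (b v) • (ψ (q (a v)) - ψ 1)) :=
      contDiff_const.add ((hχ.comp hb).smul ((hψq.comp ha).sub contDiff_const))
    exact contMDiffOn_univ.1 ((contMDiffOn_extChartAt_symm _).comp h1.contMDiff.contMDiffOn
      fun v _ => hline _ _)
  have hf0 : ∀ y t, t ≤ 1 / 3 → f y t = 1 := fun y t h => by
    simp only [f, hχ0 t h, zero_smul, add_zero]
    exact extChartAt_to_inv _
  have hf1 : ∀ y t, 2 / 3 ≤ t → f y t = q y := fun y t h => by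
    simp only [f, hχ1 t h, one_smul, add_sub_cancel]
    exact ψ.left_inv (hqU y).1
  let γ : EuclideanSpace ℝ (Fin n) → BasedPath EG G := fun y =>
    ⟨⟨fun t => f y t, fun k b hb => isPlot_mfd_iff.2 (hf k (fun _ => y) (fun v => (b v : ℝ))
      contDiff_const (IsPlot.contDiff (X := ℝ) hb))⟩, hf0 y _ (by norm_num), by
        filter_upwards [(continuous_subtype_val.tendsto (0 : unitInterval)).eventually
          (ge_mem_nhds (show ((0 : unitInterval) : ℝ) < 1 / 3 by norm_num))] with t h
        exact (hf0 y t h).trans (hf0 y _ (by norm_num)).symm, by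
        filter_upwards [(continuous_subtype_val.tendsto (1 : unitInterval)).eventually
          (le_mem_nhds (show 2 / 3 < ((1 : unitInterval) : ℝ) by norm_num))] with t h
        exact (hf1 y t h).trans (hf1 y _ (by norm_num)).symm⟩
  exact ⟨γ, isPlot_iff.2 fun k a b ha hb => hf k a _ ha hb, fun y => hf1 y _ (by norm_num)⟩

variable [LieGroup 𝓘(ℝ, EG) ∞ G] [ConnectedSpace G]

/-- End points are closed under products and contain a neighbourhood of `1`. So they form a nonempty
open and closed set, which is all of the connected group. -/
theorem exists_apply_one_eq (g : G) : ∃ γ : BasedPath EG G, γ 1 = g := by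
  obtain ⟨U, hU, h1U, hγ⟩ := exists_local_family (EG := EG) (G := G)
  have hUr : ∀ u ∈ U, ∃ γ : BasedPath EG G, γ 1 = u := fun u hu => by
    obtain ⟨γ, -, h⟩ := hγ 0 (fun _ => u) contMDiff_const fun _ => hu
    exact ⟨γ 0, h 0⟩
  have hmul : ∀ a b : G, (∃ γ : BasedPath EG G, γ 1 = a) → (∃ γ : BasedPath EG G, γ 1 = b) →
      ∃ γ : BasedPath EG G, γ 1 = a * b := by
    rintro _ _ ⟨γ, rfl⟩ ⟨δ, rfl⟩
    exact ⟨γ * δ, rfl⟩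
  have : IsTopologicalGroup G := topologicalGroup_of_lieGroup 𝓘(ℝ, EG) ∞
  have hclopen : IsClopen {g : G | ∃ γ : BasedPath EG G, γ 1 = g} := by
    constructor
    · rw [← isOpen_compl_iff, isOpen_iff_mem_nhds]
      intro g hg
      have hc : Continuous fun k : G => k⁻¹ * g := by fun_prop
      filter_upwards [hc.continuousAt.preimage_mem_nhds
        (hU.mem_nhds (by simpa using h1U) : U ∈ 𝓝 (g⁻¹ * g))] with k hk hk'
      exact hg (by simpa using hmul k (k⁻¹ * g) hk' (hUr _ hk))
    · rw [isOpen_iff_mem_nhds]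
      intro g hg
      have hc : Continuous fun k : G => g⁻¹ * k := by fun_prop
      filter_upwards [hc.continuousAt.preimage_mem_nhds
        (hU.mem_nhds (by simpa using h1U) : U ∈ 𝓝 (g⁻¹ * g))] with k hk
      simpa using hmul g (g⁻¹ * k) hg (hUr _ hk)
  exact eq_univ_iff_forall.1 (hclopen.eq_univ ⟨1, 1, rfl⟩) g

/-- Near `x` write `p y = p x * ((p x)⁻¹ * p y)`: one fixed path to `p x`, multiplied pointwise by
the smooth local family near `1`. -/
theorem isSubduction_apply_one : IsSubduction (Y := Mfd EG G) (fun γ : BasedPath EG G => γ 1) := by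
  refine ⟨dSmooth_apply_one, fun n p hp x => ?_⟩
  let p' : EuclideanSpace ℝ (Fin n) → G := p
  have hp' : ContMDiff 𝓘(ℝ, EuclideanSpace ℝ (Fin n)) 𝓘(ℝ, EG) ∞ p' := isPlot_mfd_iff.1 hp
  obtain ⟨U, hU, h1U, hγ⟩ := exists_local_family (EG := EG) (G := G)
  obtain ⟨γ₀, h₀⟩ := exists_apply_one_eq (EG := EG) (p' x)
  have hs : ContMDiff 𝓘(ℝ, EuclideanSpace ℝ (Fin n)) 𝓘(ℝ, EG) ∞ (fun y => (p' x)⁻¹ * p' y) :=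
    contMDiff_const.mul hp'
  obtain ⟨k, hk, hku, hkx⟩ := exists_smooth_shrink (hU.preimage hs.continuous) (x := x) (by simpa using h1U)
  obtain ⟨γ, hγp, hγ1⟩ := hγ n (fun y => (p' x)⁻¹ * p' (k y)) (hs.comp hk.contMDiff) hku
  refine ⟨fun y => γ₀ * γ y, isPlot_iff.2 fun m a b ha hb => ?_, ?_⟩
  · exact (isPlot_iff.1 (isPlot_const (x := γ₀)) m a b ha hb).mul (isPlot_iff.1 hγp m a b ha hb)
  · filter_upwards [hkx] with y hy
    change γ₀ 1 * γ y 1 = p' y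
    rw [h₀, hγ1, mul_inv_cancel_left, hy]

end BasedPath
end PathSubduction
end SymExt

namespace SymExt
-- The descended group `L_G` and its comparison with `Sym_G(P)`.
section Descent

variable {EG EH EM EP G H M P : Type*}
  [NormedAddCommGroup EG] [NormedSpace ℝ EG]
  [TopologicalSpace G] [ChartedSpace EG G] [Group G] [LieGroup 𝓘(ℝ, EG) ∞ G]
  [NormedAddCommGroup EH] [NormedSpace ℝ EH] [FiniteDimensional ℝ EH]
  [TopologicalSpace H] [ChartedSpace EH H] [Group H] [LieGroup 𝓘(ℝ, EH) ∞ H]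
  [NormedAddCommGroup EM] [NormedSpace ℝ EM]
  [TopologicalSpace M] [ChartedSpace EM M]
  [MulAction G M] [ContMDiffSMul 𝓘(ℝ, EG) 𝓘(ℝ, EM) ∞ G M]
  [NormedAddCommGroup EP] [NormedSpace ℝ EP] [FiniteDimensional ℝ EP]
  [TopologicalSpace P] [ChartedSpace EP P] [IsManifold 𝓘(ℝ, EP) ∞ P]
  {B : PrincipalBundle EH EM EP H M P} (A : Connection B)

theorem exists_ptSym (γ : BasedPath EG G) :
    ∃ ψ : SymG EG G B, ψ.base = γ 1 ∧ ∀ p, ψ p = pt A γ p :=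
  SymG.exists_of_equivariant
    (dSmooth_mfd_iff.1 fun _ _ hp => isPlot_mfd_iff.2 (contMDiff_pt A isPlot_const hp))
    (pt_act A γ) (proj_pt A γ)

/-- Parallel transport along the paths `γ_x` as a symmetry of the bundle. -/
noncomputable def ptSym (γ : BasedPath EG G) : SymG EG G B := (exists_ptSym A γ).choose

theorem ptSym_base (γ : BasedPath EG G) : (ptSym A γ).base = γ 1 := (exists_ptSym A γ).choose_spec.1

theorem ptSym_apply (γ : BasedPath EG G) (p : P) : ptSym A γ p = pt A γ p :=
  (exists_ptSym A γ).choose_spec.2 p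

theorem dSmooth_ptSym : DSmooth (ptSym A : BasedPath EG G → SymG EG G B) := fun n g hg => by
  refine SymG.isPlot_iff.2 ⟨fun k a b ha hb => ?_, ?_⟩
  · simp only [Function.comp_apply, ptSym_apply]
    exact contMDiff_pt A (isPlot_reparam hg ha) hb
  · simp only [Function.comp_apply, ptSym_base]
    exact isPlot_mfd_iff.1 (BasedPath.dSmooth_apply_one n g hg)

omit [LieGroup 𝓘(ℝ, EG) ∞ G] [FiniteDimensional ℝ EP] in
theorem pt_one (p : P) : pt A (1 : BasedPath EG G) p = p := by
  obtain ⟨σ, hσ, h0, -⟩ := exists_lift_pt A (1 : BasedPath EG G) p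
  have h1 := (hσ.reparam (Q := fun _ => 0) contDiff_const (fun _ _ => left_mem_Icc.2 zero_le_one)
    (c' := orbitPath (1 : BasedPath EG G) (B.proj p)) fun _ _ _ => rfl).transport_eq
  rw [Function.comp_apply, Function.comp_apply, h0] at h1
  exact h1

theorem ptSym_one : ptSym A (1 : BasedPath EG G) = 1 :=
  SymG.ext_apply (ptSym_base A 1) fun p => (ptSym_apply A 1 p).trans (pt_one A p)

theorem ptSym_base_eq_iff {γ α : BasedPath EG G} :
    ((ptSym A α)⁻¹ * ptSym A γ).base = 1 ↔ γ 1 = α 1 := by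
  change (ptSym A α).base⁻¹ * (ptSym A γ).base = 1 ↔ _
  rw [ptSym_base, ptSym_base, inv_mul_eq_one, eq_comm]

/-- The holonomies `hol(P, α, γ)` form a smooth family of gauge transformations. -/
theorem exists_dSmooth_hol : ∃ g : PathPair EG G → Gau B, DSmooth g ∧
    ∀ (z : PathPair EG G) (p : P), g z p = hol A z.1.2 z.1.1 p := by
  -- By `pt_hol` the holonomy is `pt_α⁻¹ ∘ pt_γ`, so its smoothness reduces to the diffeological
  -- group structure of `Sym_G(P)`.
  refine ⟨fun z => SymG.toGau ((ptSym A z.1.2)⁻¹ * ptSym A z.1.1) ((ptSym_base_eq_iff A).2 z.2),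
    fun n q hq => ?_, fun z p => ?_⟩
  · refine (SymG.isPlot_toGau_iff fun y => (ptSym_base_eq_iff A).2 (q y).2).2 ?_
    exact SymG.isDiffGroup.smooth_mul n (fun y => ((ptSym A (q y).1.2)⁻¹, ptSym A (q y).1.1))
      ⟨SymG.isDiffGroup.smooth_inv n _ (dSmooth_ptSym A n _ hq.2), dSmooth_ptSym A n _ hq.1⟩
  · refine (ptSym A z.1.2).diffeo.injective ?_
    refine (SymG.apply_inv_apply _ _).trans ?_
    exact (ptSym_apply A _ p).trans ((pt_hol A z.2 p).symm.trans (ptSym_apply A _ _).symm)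

variable (EG G) in
/-- The map `(γ, φ) ↦ (γ 1, pt_γ ∘ φ)`. -/
noncomputable def descend (z : BasedPath EG G × Gau B) : SymG EG G B :=
  ptSym A z.1 * SymG.incl EG G B z.2

theorem descend_base (z : BasedPath EG G × Gau B) : (descend EG G A z).base = z.1 1 :=
  (mul_one _).trans (ptSym_base A z.1)

theorem descend_apply (z : BasedPath EG G × Gau B) (p : P) :
    descend EG G A z p = pt A z.1 (z.2 p) := ptSym_apply A z.1 _

theorem pt_injective (γ : BasedPath EG G) : Function.Injective (pt A γ) := by
  have h : pt A γ = ptSym A γ := funext fun p => (ptSym_apply A γ p).symm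
  rw [h]
  exact (ptSym A γ).diffeo.injective

/-- By `pt_hol` and injectivity of `pt_α`, the condition `φ' = hol(P, α, γ) ∘ φ` is the same as
`pt_α ∘ φ' = pt_γ ∘ φ`. Hence the relation is an equivalence and its quotient is governed by
`descend`. -/
theorem lRel_iff (a b : BasedPath EG G × Gau B) :
    LRel EG G A a b ↔ descend EG G A a = descend EG G A b := by
  constructor
  · rintro ⟨h1, h2⟩
    refine SymG.ext_apply (by rw [descend_base, descend_base, h1]) fun p => ?_
    rw [descend_apply, descend_apply, h2, pt_hol A h1]
  · intro h
    have h1 : a.1 1 = b.1 1 := by rw [← descend_base A a, h, descend_base]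
    refine ⟨h1, fun p => pt_injective A b.1 ?_⟩
    rw [pt_hol A h1, ← descend_apply, ← descend_apply, h]

theorem equivalence_lRel : Equivalence (LRel EG G A) where
  refl a := (lRel_iff A a a).2 rfl
  symm h := (lRel_iff A _ _).2 ((lRel_iff A _ _).1 h).symm
  trans h h' := (lRel_iff A _ _).2 (((lRel_iff A _ _).1 h).trans ((lRel_iff A _ _).1 h'))

variable [ConnectedSpace G]

theorem isSubduction_descend : IsSubduction (descend EG G A) := by
  refine ⟨fun n q hq => ?_, fun n p hp x => ?_⟩
  · exact SymG.isDiffGroup.smooth_mul n (fun y => (ptSym A (q y).1, SymG.incl EG G B (q y).2))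
      ⟨dSmooth_ptSym A n _ hq.1, (SymG.isPlot_incl_iff _).1 hq.2⟩
  · obtain ⟨γ, hγ, hγp⟩ := (BasedPath.isSubduction_apply_one (EG := EG) (G := G)).2 n _
      (isPlot_mfd_iff.2 (SymG.isPlot_iff.1 hp).2) x
    obtain ⟨N, hN, hNo, hxN⟩ := eventually_nhds_iff.1 hγp
    -- Shrinking makes the base points match for every `y`, so that `pt_γ⁻¹ ∘ p` is everywhere a
    -- gauge transformation.
    obtain ⟨k, hk, hkN, hkx⟩ := exists_smooth_shrink hNo hxN
    have hb : ∀ y, ((ptSym A (γ (k y)))⁻¹ * p (k y)).base = 1 := fun y => by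
      change (ptSym A (γ (k y))).base⁻¹ * (p (k y)).base = 1
      rw [ptSym_base, inv_mul_eq_one]
      exact hN _ (hkN y)
    refine ⟨fun y => (γ (k y), SymG.toGau _ (hb y)), ⟨isPlot_reparam hγ hk, ?_⟩, ?_⟩
    · refine (SymG.isPlot_toGau_iff hb).2 ?_
      exact SymG.isDiffGroup.smooth_mul n (fun y => ((ptSym A (γ (k y)))⁻¹, p (k y)))
        ⟨SymG.isDiffGroup.smooth_inv n _ (dSmooth_ptSym A n _ (isPlot_reparam hγ hk)),
          isPlot_reparam hp hk⟩
    · filter_upwards [hkx] with y hy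
      rw [descend, SymG.incl_toGau, mul_inv_cancel_left, hy]

-- Local lifts of a plot of `G` to based paths become symmetries by parallel transport; `A` serves
-- only this construction.
include A in
theorem isSubduction_proj : IsSubduction (SymG.proj EG G B) := by
  refine ⟨fun n p hp => isPlot_mfd_iff.2 (SymG.isPlot_iff.1 hp).2, fun n p hp x => ?_⟩
  obtain ⟨γ, hγ, hγp⟩ := (BasedPath.isSubduction_apply_one (EG := EG) (G := G)).2 n p hp x
  refine ⟨fun y => ptSym A (γ y), dSmooth_ptSym A n γ hγ, ?_⟩
  filter_upwards [hγp] with y hy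
  have h : (ptSym A (γ y)).base = γ y 1 := ptSym_base A (γ y)
  exact h.trans hy

include A in
theorem isDiffExtension_symG : IsDiffExtension (SymG.incl EG G B) (SymG.proj EG G B) :=
  .of_subduction SymG.isDiffGroup isDiffGroup_mfd SymG.incl_injective SymG.range_incl
    (fun _ => SymG.isPlot_incl_iff) (isSubduction_proj A)

/-- An extension can be transported along an isomorphism of diffeological groups. -/
theorem IsDiffExtension.congr {K E E' Q : Type*} [Group K] [Group E] [Group E'] [Group Q]
    [DiffeologicalSpace K] [DiffeologicalSpace E] [DiffeologicalSpace E'] [DiffeologicalSpace Q]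
    {i : K →* E} {π : E →* Q} (h : IsDiffExtension i π) (e : E' ≃* E) (he : DSmooth e)
    (he' : DSmooth e.symm) :
    IsDiffExtension (e.symm.toMonoidHom.comp i) (π.comp e.toMonoidHom) := by
  have hsymm : ∀ {n : ℕ} {p : EuclideanSpace ℝ (Fin n) → E}, IsPlot (e.symm ∘ p) → IsPlot p := by
    intro n p hp
    have h1 := he n _ hp
    rwa [show e ∘ (e.symm ∘ p) = p from funext fun y => e.apply_symm_apply _] at h1
  refine .of_subduction (h.group_mid.of_induction e.toMonoidHom fun n p => ⟨fun hp => he n p hp,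
    fun hp => ?_⟩) h.group_right (e.symm.injective.comp h.injective) ?_ (fun n p => ?_) ?_
  · have h1 := he' n _ hp
    rwa [show e.symm ∘ (e.toMonoidHom ∘ p) = p from funext fun y => e.symm_apply_apply _] at h1
  · ext x
    rw [MonoidHom.mem_range, MonoidHom.mem_ker]
    have h1 : e x ∈ i.range ↔ e x ∈ π.ker := by rw [h.exact]
    rw [MonoidHom.mem_range, MonoidHom.mem_ker] at h1
    refine Iff.trans (exists_congr fun k => ?_) h1
    exact e.symm_apply_eq
  · rw [h.induction]
    exact ⟨fun hp => he' n _ hp, fun hp => hsymm hp⟩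
  · refine ⟨fun n p hp => h.subduction.1 n _ (he n p hp), fun n p hp x => ?_⟩
    obtain ⟨q, hq, hqp⟩ := h.subduction.2 n p hp x
    refine ⟨e.symm ∘ q, he' n q hq, ?_⟩
    filter_upwards [hqp] with y hy
    refine Eq.trans ?_ hy
    exact congrArg π (e.apply_symm_apply _)

/-- The group `L_G` obtained by descent is an extension isomorphic to `Sym_G(P)`. -/
theorem exists_group_descent : ∃ _ : Group (LG EG G A),
    (∀ (γ γ' : BasedPath EG G) (φ φ' : Gau B), ∃ χ : Gau B,
      (∀ p : P, pt A (γ * γ') (χ p) = pt A γ (φ (pt A γ' (φ' p)))) ∧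
      LG.mk A γ φ * LG.mk A γ' φ' = LG.mk A (γ * γ') χ) ∧
    ∃ (i : Gau B →* LG EG G A) (π : LG EG G A →* Mfd EG G),
      (∀ φ : Gau B, i φ = LG.mk A 1 φ) ∧
      (∀ (γ : BasedPath EG G) (φ : Gau B), π (LG.mk A γ φ) = γ 1) ∧
      IsDiffExtension i π ∧
      ∃ Γ : LG EG G A ≃* SymG EG G B,
        DSmooth Γ ∧ DSmooth Γ.symm ∧
        (∀ (γ : BasedPath EG G) (φ : Gau B) (p : P), Γ (LG.mk A γ φ) p = pt A γ (φ p)) ∧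
        (∀ φ : Gau B, Γ (i φ) = SymG.incl EG G B φ) ∧
        ∀ x : LG EG G A, SymG.proj EG G B (Γ x) = π x := by
  obtain ⟨e, he, he', hmk⟩ := (isSubduction_descend (EG := EG) (G := G) A).exists_quot_equiv
    (lRel_iff A)
  let e' : LG EG G A ≃ SymG EG G B := e
  -- The group structure is transported from `Sym_G(P)`, so well-definedness and the group axioms
  -- need no check on representatives.
  let instG : Group (LG EG G A) := e'.group
  let Γ : LG EG G A ≃* SymG EG G B := { e' with map_mul' := fun x y => e'.apply_symm_apply _ }
  have hΓ : ∀ (γ : BasedPath EG G) (φ : Gau B),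
      Γ (LG.mk A γ φ) = descend EG G A (γ, φ) := fun γ φ => hmk (γ, φ)
  refine ⟨instG, fun γ γ' φ φ' => ?_, Γ.symm.toMonoidHom.comp (SymG.incl EG G B),
    (SymG.proj EG G B).comp Γ.toMonoidHom, fun φ => ?_, fun γ φ => ?_,
    (isDiffExtension_symG A).congr Γ he he', Γ, he, he', fun γ φ p => ?_,
    fun φ => Γ.apply_symm_apply _, fun x => rfl⟩
  -- The witness `χ` is `pt_{γγ'}⁻¹ ∘ pt_γ ∘ φ ∘ pt_{γ'} ∘ φ'`; it covers the identity because end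
  -- points multiply under pointwise products.
  · have hb : ((ptSym A (γ * γ'))⁻¹ * (descend EG G A (γ, φ) * descend EG G A (γ', φ'))).base = 1 := by
      change (ptSym A (γ * γ')).base⁻¹ *
        ((descend EG G A (γ, φ)).base * (descend EG G A (γ', φ')).base) = 1
      rw [ptSym_base, descend_base, descend_base, inv_mul_eq_one]
      rfl
    have hd : descend EG G A (γ * γ', SymG.toGau _ hb) =
        descend EG G A (γ, φ) * descend EG G A (γ', φ') := by
      rw [descend, SymG.incl_toGau, mul_inv_cancel_left]
    refine ⟨SymG.toGau _ hb, fun p => ?_, Γ.injective ?_⟩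
    · rw [← descend_apply A (γ * γ', SymG.toGau _ hb) p, hd, SymG.apply_mul, descend_apply,
        descend_apply]
    · rw [map_mul, hΓ, hΓ, hΓ, hd]
  · refine Γ.injective ((Γ.apply_symm_apply _).trans ?_)
    rw [hΓ, descend, ptSym_one, one_mul]
  · have h : (Γ (LG.mk A γ φ)).base = γ 1 := by rw [hΓ, descend_base]
    exact h
  · rw [hΓ, descend_apply]

end Descent
end SymExt

/-! ### The main theorem. -/

open SymExt

theorem mainTheorem12
    {EG EH EM EP G H M P : Type*}
    -- the connected Lie group `G`
    [NormedAddCommGroup EG] [NormedSpace ℝ EG] [FiniteDimensional ℝ EG]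
    [TopologicalSpace G] [ChartedSpace EG G] [Group G] [LieGroup 𝓘(ℝ, EG) ∞ G]
    [T2Space G] [SecondCountableTopology G] [ConnectedSpace G]
    -- the Lie group `H`
    [NormedAddCommGroup EH] [NormedSpace ℝ EH] [FiniteDimensional ℝ EH]
    [TopologicalSpace H] [ChartedSpace EH H] [Group H] [LieGroup 𝓘(ℝ, EH) ∞ H]
    [T2Space H] [SecondCountableTopology H]
    -- the manifold `M` with a smooth action of `G`
    [NormedAddCommGroup EM] [NormedSpace ℝ EM] [FiniteDimensional ℝ EM]
    [TopologicalSpace M] [ChartedSpace EM M] [IsManifold 𝓘(ℝ, EM) ∞ M]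
    [T2Space M] [SecondCountableTopology M]
    [MulAction G M] [ContMDiffSMul 𝓘(ℝ, EG) 𝓘(ℝ, EM) ∞ G M]
    -- the principal `H`-bundle `P` over `M`
    [NormedAddCommGroup EP] [NormedSpace ℝ EP] [FiniteDimensional ℝ EP]
    [TopologicalSpace P] [ChartedSpace EP P] [IsManifold 𝓘(ℝ, EP) ∞ P]
    [T2Space P] [SecondCountableTopology P]
    (B : PrincipalBundle EH EM EP H M P) :
    -- `Sym_G(P)` is an extension of diffeological groups
    IsDiffExtension (SymG.incl EG G B) (SymG.proj EG G B) ∧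
    -- it acts smoothly on `P`, covering the action of `G` on `M`
    (DSmooth (X := SymG EG G B × Mfd EP P) (Y := Mfd EP P) (fun z => z.1 z.2) ∧
      (∀ p : P, (1 : SymG EG G B) p = p) ∧
      (∀ (ψ φ : SymG EG G B) (p : P), (ψ * φ) p = ψ (φ p)) ∧
      ∀ (ψ : SymG EG G B) (p : P), B.proj (ψ p) = ψ.base • B.proj p) ∧
    -- it is universal among the lifts of the action
    (∀ (EK K : Type*) [NormedAddCommGroup EK] [NormedSpace ℝ EK] [FiniteDimensional ℝ EK]
      [TopologicalSpace K] [ChartedSpace EK K] [Group K] [LieGroup 𝓘(ℝ, EK) ∞ K]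
      [MulAction K P] [ContMDiffSMul 𝓘(ℝ, EK) 𝓘(ℝ, EP) ∞ K P] (φ : K →* G),
      ContMDiff 𝓘(ℝ, EK) 𝓘(ℝ, EG) ∞ φ →
      (∀ (k : K) (p : P) (h : H), k • B.act p h = B.act (k • p) h) →
      (∀ (k : K) (p : P), B.proj (k • p) = φ k • B.proj p) →
      ∃! F : K →* SymG EG G B, DSmooth (X := Mfd EK K) (Y := SymG EG G B) F ∧
        (∀ k, SymG.proj EG G B (F k) = φ k) ∧ ∀ (k : K) (p : P), F k p = k • p) ∧
    -- for every connection on `P`: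
    ∀ A : Connection B,
      -- parallel transport along the paths and loops in question is well defined
      (∀ (γ : BasedPath EG G) (p : P), HasUniqueHorizontalLift A (orbitPath γ (B.proj p)) p) ∧
      (∀ (α γ : BasedPath EG G) (p : P), γ 1 = α 1 →
        HasUniqueHorizontalLift A (orbitPath (loop α γ) (B.proj p)) p) ∧
      -- the holonomies are smooth descent data with values in `Gau(P)`
      (∃ g : PathPair EG G → Gau B, DSmooth g ∧
        ∀ (z : PathPair EG G) (p : P), g z p = hol A z.1.2 z.1.1 p) ∧
      Equivalence (LRel EG G A) ∧
      -- `L_G` is an extension of diffeological groups with the stated multiplication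
      ∃ _ : Group (LG EG G A),
        (∀ (γ γ' : BasedPath EG G) (φ φ' : Gau B), ∃ χ : Gau B,
          (∀ p : P, pt A (γ * γ') (χ p) = pt A γ (φ (pt A γ' (φ' p)))) ∧
          LG.mk A γ φ * LG.mk A γ' φ' = LG.mk A (γ * γ') χ) ∧
        ∃ (i : Gau B →* LG EG G A) (π : LG EG G A →* Mfd EG G),
          (∀ φ : Gau B, i φ = LG.mk A 1 φ) ∧
          (∀ (γ : BasedPath EG G) (φ : Gau B), π (LG.mk A γ φ) = γ 1) ∧
          IsDiffExtension i π ∧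
          -- `Γ` is an isomorphism of diffeological extensions of `G`
          ∃ Γ : LG EG G A ≃* SymG EG G B,
            DSmooth Γ ∧ DSmooth Γ.symm ∧
            (∀ (γ : BasedPath EG G) (φ : Gau B) (p : P), Γ (LG.mk A γ φ) p = pt A γ (φ p)) ∧
            (∀ φ : Gau B, Γ (i φ) = SymG.incl EG G B φ) ∧
            ∀ x : LG EG G A, SymG.proj EG G B (Γ x) = π x := by
  -- The first assertion mentions no connection, but its proof that the projection is a subduction
  -- uses one.
  obtain ⟨A⟩ := B.exists_connection
  refine ⟨isDiffExtension_symG A, ⟨fun n p hp => ?_, fun p => rfl, fun ψ φ p => rfl, fun ψ p => ψ.covers p⟩,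
    fun EK K => ?_, fun A => ⟨hasUniqueHorizontalLift_orbitPath A,
      fun α γ p h => hasUniqueHorizontalLift_loop A h p, exists_dSmooth_hol A, equivalence_lRel A,
      exists_group_descent A⟩⟩
  · exact isPlot_mfd_iff.2 ((SymG.isPlot_iff.1 hp.1).1 n id _ contDiff_id (isPlot_mfd_iff.1 hp.2))
  · intros
    exact SymG.existsUnique_lift _ ‹_› ‹_› ‹_›
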